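/- There is a universal constant $K>0$ such that the following holds. Let $d,T\ge 1$ be integers, let $\mathcal X,\mathcal Y\subset\mathbb R^d$ be nonempty compact sets (not necessarily convex), and let $D=\max\{\sup_{x,x'\in\mathcal X}\|x-x'\|_1,\ \sup_{y,y'\in\mathcal Y}\|y-y'\|_1\}$, with $D>0$. Let $f$ be Lipschitz with respect to $\|\cdot\|_1$ on $\mathcal X\times\mathcal Y$, differentiable in $x$ and in $y$ on $\operatorname{conv}\mathcal X\times\operatorname{conv}\mathcal Y$ (relative to these sets), with partial gradients $\nabla_xf,\nabla_yf$ such that $$\max\{\|\nabla_xf(x,y)\|_\infty,\|\nabla_yf(x,y)\|_\infty\}\le G\qquad(x\in\mathcal X,\ y\in\mathcal Y),$$ $$\|\nabla_xf(x,y)-\nabla_xf(x',y')\|_\infty+\|\nabla_yf(x,y)-\nabla_yf(x',y')\|_\infty\le L\|x-x'\|_1+L\|y-y'\|_1\qquad(x,x'\in\operatorname{conv}\mathcal X,\ y,y'\in\operatorname{conv}\mathcal Y).$$ For probability measures $P,Q$ write $f(P,y)=\mathbb E_{x\sim P}f(x,y)$ and $f(x,Q)=\mathbb E_{y\sim Q}f(x,y)$.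 Put $\eta=10d^2D(L+1)$ and $m=T$, and consider the game $\min_{x\in\mathcal X}\max_{y\in\mathcal Y}f(x,y)$ played for $T$ rounds as follows. All perturbation vectors $\tilde\sigma^1_{t,j},\tilde\sigma^2_{t,j},\sigma^1_{t,j},\sigma^2_{t,j}\in\mathbb R^d$ ($1\le t\le T$, $1\le j\le m$) have independent entries, and are mutually independent, each entry being exponentially distributed with mean $\eta$. In round $t$ the players compute, for $j=1,\dots,m$, random points $$\tilde x_{t-1,j}\in\operatorname*{argmin}_{x\in\mathcal X}\ \sum_{i<t}f(x,Q_i)-\langle\tilde\sigma^1_{t,j},x\rangle,\qquad \tilde y_{t-1,j}\in\operatorname*{argmax}_{y\in\mathcal Y}\ \sum_{i<t}f(P_i,y)+\langle\tilde\sigma^2_{t,j},y\rangle,$$ let $\tilde P_{t-1},\tilde Q_{t-1}$ be the empirical distributions of these points, then compute $$x_{t,j}\in\operatorname*{argmin}_{x\in\mathcal X}\ \sum_{i<t}f(x,Q_i)+f(x,\tilde Q_{t-1})-\langle\sigma^1_{t,j},x\rangle,\qquad y_{t,j}\in\operatorname*{argmax}_{y\in\mathcal Y}\ \sum_{i<t}f(P_i,y)+f(\tilde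 P_{t-1},y)+\langle\sigma^2_{t,j},y\rangle,$$ and play the empirical distributions $P_t,Q_t$ of $\{x_{t,j}\}_j,\{y_{t,j}\}_j$. Then $$\sup_{x\in\mathcal X,\,y\in\mathcal Y}\mathbb E\Big[f\Big(\tfrac1T\sum_{t=1}^TP_t,\,y\Big)-f\Big(x,\,\tfrac1T\sum_{t=1}^TQ_t\Big)\Big]\le K\,\frac{d^2D^2(L+1)\max\{1,\log d\}}{T}+K\min\Big\{D^2L,\ \frac{d^2G^2\log T}{LT}\Big\},$$ where the minimum is read as $0$ if $L=0$. If instead the first round is played without guesses (the terms $f(x,\tilde Q_0)$ and $f(\tilde P_0,y)$ are omitted in round $1$), the same bound holds with the additional term $K\,GD/T$ on the right-hand side. -/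

import Mathlib

open MeasureTheory ProbabilityTheory
open scoped ENNReal

namespace OFTPL

/-- The `ℓ¹` norm on `ℝ^d`. (The norm that `Fin d → ℝ` carries in Mathlib is the `ℓ^∞` norm.) -/
def l1Norm {d : ℕ} (v : Fin d → ℝ) : ℝ := ∑ i, |v i|

/-- The `ℓ¹` diameter of a (nonempty, bounded) subset of `ℝ^d`. -/
noncomputable def l1Diam {d : ℕ} (X : Set (Fin d → ℝ)) : ℝ :=
  sSup {r : ℝ | ∃ x ∈ X, ∃ x' ∈ X, r = l1Norm (x - x')}

/-- The linear functional `u ↦ ⟨g, u⟩` on `ℝ^d`. -/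
noncomputable def pairing {d : ℕ} (g : Fin d → ℝ) : (Fin d → ℝ) →L[ℝ] ℝ :=
  ∑ i, g i • ContinuousLinearMap.proj i

/-- The equally weighted mixture `(1/n) ∑ k, P k` of `n` distributions. -/
noncomputable def mixture {E : Type*} [MeasurableSpace E] {n : ℕ} (P : Fin n → Measure E) :
    Measure E :=
  (n : ℝ≥0∞)⁻¹ • ∑ k, P k

/-- The empirical distribution of `m` points. -/
noncomputable def empirical {E : Type*} [MeasurableSpace E] {m : ℕ} (x : Fin m → E) :
    Measure E :=
  mixture fun j => Measure.dirac (x j)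

/-- `f(P, y)`, the expectation of `f(x, y)` for `x ∼ P`. -/
noncomputable def evalLeft {d : ℕ} (f : (Fin d → ℝ) → (Fin d → ℝ) → ℝ)
    (P : Measure (Fin d → ℝ)) (y : Fin d → ℝ) : ℝ :=
  ∫ x, f x y ∂P

/-- `f(x, Q)`, the expectation of `f(x, y)` for `y ∼ Q`. -/
noncomputable def evalRight {d : ℕ} (f : (Fin d → ℝ) → (Fin d → ℝ) → ℝ)
    (x : Fin d → ℝ) (Q : Measure (Fin d → ℝ)) : ℝ :=
  ∫ y, f x y ∂Q

/-- The game `min_{x ∈ X} max_{y ∈ Y} f x y` is Lipschitz and smooth with respect to the `ℓ¹` norm,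
with gradient fields `gx = ∇_x f`, `gy = ∇_y f`, gradient bound `G` on `X × Y` and smoothness
constant `L`. The sets `X` and `Y` need not be convex; the gradients exist and are Lipschitz along
the segments that join points of `X` (of `Y`), i.e. on the convex hulls, which are `X` and `Y`
themselves when these are convex. The norm `‖·‖` below is the `ℓ^∞` norm. -/
structure IsSmoothGame {d : ℕ} (X Y : Set (Fin d → ℝ)) (f : (Fin d → ℝ) → (Fin d → ℝ) → ℝ)
    (gx gy : (Fin d → ℝ) → (Fin d → ℝ) → (Fin d → ℝ)) (G L : ℝ) : Prop where
  lipschitz : ∃ M : ℝ, ∀ x ∈ X, ∀ x' ∈ X, ∀ y ∈ Y, ∀ y' ∈ Y,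
    |f x y - f x' y'| ≤ M * (l1Norm (x - x') + l1Norm (y - y'))
  grad_x : ∀ x ∈ convexHull ℝ X, ∀ y ∈ convexHull ℝ Y,
    HasFDerivWithinAt (fun u => f u y) (pairing (gx x y)) (convexHull ℝ X) x
  grad_y : ∀ x ∈ convexHull ℝ X, ∀ y ∈ convexHull ℝ Y,
    HasFDerivWithinAt (fun v => f x v) (pairing (gy x y)) (convexHull ℝ Y) y
  grad_bound : ∀ x ∈ X, ∀ y ∈ Y, max ‖gx x y‖ ‖gy x y‖ ≤ G
  smooth : ∀ x ∈ convexHull ℝ X, ∀ x' ∈ convexHull ℝ X,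
    ∀ y ∈ convexHull ℝ Y, ∀ y' ∈ convexHull ℝ Y,
    ‖gx x y - gx x' y'‖ + ‖gy x y - gy x' y'‖ ≤ L * l1Norm (x - x') + L * l1Norm (y - y')

/-- The two players. -/
inductive Player
  | px
  | py

/-- In each round a player first computes the samples that the guesses are made of, and then, with
fresh perturbations, the samples that are played. -/
inductive Phase
  | guess
  | play

/-- What is done in the very first round: either the guesses of that round are used like those of
every other round, or the first round is played with the guess `0`. -/
inductive FirstRound
  | optimistic
  | plain

/-- The factor in front of the guess in round `t` (rounds are numbered from `0`). -/
def guessWeight {T : ℕ} : FirstRound → Fin T → ℝ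
  | .optimistic, _ => 1
  | .plain, t => if t.val = 0 then 0 else 1

/-- All coordinates of all perturbation vectors are independent with law `Exp(η)`, the exponential
distribution with mean `η` (rate `1/η`). -/
structure IsExpPerturbation {d T m : ℕ} {Ω : Type*} [MeasurableSpace Ω] (μ : Measure Ω) (η : ℝ)
    (σ : Player → Phase → Fin T → Fin m → Fin d → Ω → ℝ) : Prop where
  law : ∀ p h t j i, HasLaw (σ p h t j i) (expMeasure η⁻¹) μ
  indep : iIndepFun (fun k : Player × Phase × Fin T × Fin m × Fin d =>
    σ k.1 k.2.1 k.2.2.1 k.2.2.2.1 k.2.2.2.2) μ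

/-- The empirical distribution of the `m` samples that a player computes in one phase of round `t`.
In the notation `P_t, Q_t` for the distributions played in round `t` and `P̃_{t-1}, Q̃_{t-1}` for
those that the guesses of round `t` are made of, `dist z .px .play`, `dist z .py .play` are the
former and `dist z .px .guess`, `dist z .py .guess` the latter. -/
noncomputable def dist {d T m : ℕ} {Ω : Type*}
    (z : Player → Phase → Fin T → Fin m → Ω → (Fin d → ℝ)) (p : Player) (h : Phase) (t : Fin T)
    (ω : Ω) : Measure (Fin d → ℝ) :=
  empirical fun j => z p h t j ω

/-- `z` is a run of nonconvex OFTPL for both players, with linear perturbation functions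
`u ↦ ⟨σ, u⟩`. Any minimizer and any maximizer may be returned by the oracles. -/
structure IsRun {d T m : ℕ} {Ω : Type*} [MeasurableSpace Ω] (μ : Measure Ω)
    (X Y : Set (Fin d → ℝ)) (f : (Fin d → ℝ) → (Fin d → ℝ) → ℝ) (w : FirstRound)
    (σ : Player → Phase → Fin T → Fin m → Fin d → Ω → ℝ)
    (z : Player → Phase → Fin T → Fin m → Ω → (Fin d → ℝ)) : Prop where
  aemeasurable : ∀ p h t j, AEMeasurable (z p h t j) μ
  mem_x : ∀ h t j, ∀ᵐ ω ∂μ, z .px h t j ω ∈ X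
  mem_y : ∀ h t j, ∀ᵐ ω ∂μ, z .py h t j ω ∈ Y
  guess_x : ∀ t j, ∀ᵐ ω ∂μ, IsMinOn
    (fun u => ∑ s ∈ Finset.Iio t, evalRight f u (dist z .py .play s ω)
      - ∑ i, σ .px .guess t j i ω * u i) X (z .px .guess t j ω)
  guess_y : ∀ t j, ∀ᵐ ω ∂μ, IsMaxOn
    (fun v => ∑ s ∈ Finset.Iio t, evalLeft f (dist z .px .play s ω) v
      + ∑ i, σ .py .guess t j i ω * v i) Y (z .py .guess t j ω)
  play_x : ∀ t j, ∀ᵐ ω ∂μ, IsMinOn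
    (fun u => ∑ s ∈ Finset.Iio t, evalRight f u (dist z .py .play s ω)
      + guessWeight w t * evalRight f u (dist z .py .guess t ω)
      - ∑ i, σ .px .play t j i ω * u i) X (z .px .play t j ω)
  play_y : ∀ t j, ∀ᵐ ω ∂μ, IsMaxOn
    (fun v => ∑ s ∈ Finset.Iio t, evalLeft f (dist z .px .play s ω) v
      + guessWeight w t * evalLeft f (dist z .px .guess t ω) v
      + ∑ i, σ .py .play t j i ω * v i) Y (z .py .play t j ω)

/-- `f((1/T) ∑ P_t, y) - f(x, (1/T) ∑ Q_t)` -/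
noncomputable def gap {d T m : ℕ} {Ω : Type*} (f : (Fin d → ℝ) → (Fin d → ℝ) → ℝ)
    (z : Player → Phase → Fin T → Fin m → Ω → (Fin d → ℝ)) (x y : Fin d → ℝ) (ω : Ω) : ℝ :=
  evalLeft f (mixture fun t => dist z .px .play t ω) y
    - evalRight f x (mixture fun t => dist z .py .play t ω)

end OFTPL

/-!
The proof is a potential argument. For a loss `h` on `X` and a random perturbation `s` let
`value h s = min_{x ∈ X} (h x - ⟨s, x⟩)` and let `potential η h` be its expectation, normalized to
vanish at `h = 0`. The potential is concave, its derivative at `h` evaluates losses at the perturbed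
minimizer `best h s` of `h`, and `potential η h ≤ h x + D E[max_i s i]` for all `x ∈ X`
(`potential_le`). If `F` and `H` are the total losses of the two players after `T` rounds, then
`T` times the duality gap at `(x, y)` is `-F x - H y`. So it is enough to bound the potentials of `F`
and of `H` from below, i.e. to show that the two potentials together decrease little in each round.

* Stability. If one coordinate of `s` moves by `c`, the same coordinate of the minimizer follows it,
  and the law of `s` changes by a factor `exp (c / η)` only. Hence the square of the expected distance
  of the perturbed minimizers of two losses (`drift`) is at most `γ = 8 d² D / η` times the Bregman
  divergence of the potential (`drift_sq_le`).
* Sampling. The points played are a sample of size `m`. That a player reacts to the sample and not to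
  its law costs `O(γ L² D² / m)`, since stability bounds the effect of exchanging one point of the
  sample (`integral_mean_mixed_sub_avg_le`); for `m = T` this is `O(γ L² D²)` in all rounds.
* Optimism. In a round with guesses the potential of a player increases at least by its expected
  loss plus `A² / γ` minus `γ L² B² / 4`, up to the sampling errors. Here `A` is the movement of this
  player's minimizer that its guess causes, and `B` is the corresponding movement of the opponent
  (`le_integral_potential_sub`, `le_integral_gain`). The expected losses of the players add up to
  zero, and the negative terms of each player are covered by the positive terms of the other one, as
  `γ L ≤ 2` (`le_integral_gain_add`). A round without guesses costs the oscillation of the loss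
  (`le_gain_zero_add`).

These bounds are for fixed total losses at the beginning of a round. They apply to the game because
these total losses are functions of the perturbations of the previous rounds, which are independent
of those of the current round (`IsPlay.determined`, `IsPlay.neg_sum_le_integral_potential`). The
points may be returned by arbitrary oracles: as the loss is independent of the perturbation, and as
`value h` is Lipschitz and therefore differentiable almost everywhere, the minimizer is almost surely
unique and equal to `best` (`ae_eq_sample`, `IsOracleRun.isPlay`).
-/

namespace OFTPL

/-! ### The law of a perturbation vector -/

/-- The law of a perturbation vector: `d` independent exponential coordinates with mean `η`. -/
noncomputable def perturbLaw (η : ℝ) (d : ℕ) : Measure (Fin d → ℝ) :=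
  Measure.pi fun _ => expMeasure η⁻¹

lemma isProbabilityMeasure_perturbLaw {η : ℝ} (hη : 0 < η) (d : ℕ) :
    IsProbabilityMeasure (perturbLaw η d) := by
  have := isProbabilityMeasure_expMeasure (inv_pos.2 hη)
  unfold perturbLaw
  infer_instance

lemma expMeasure_eq_withDensity (r : ℝ) :
    expMeasure r = volume.withDensity (exponentialPDF r) := rfl

lemma measurable_exponentialPDF (r : ℝ) : Measurable (exponentialPDF r) :=
  (measurable_exponentialPDFReal r).ennreal_ofReal

lemma pi_absolutelyContinuous {n : ℕ} {μ ν : Fin n → Measure ℝ} [∀ i, SigmaFinite (μ i)]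
    [∀ i, SigmaFinite (ν i)] (h : ∀ i, μ i ≪ ν i) : Measure.pi μ ≪ Measure.pi ν := by
  induction n with
  | zero => rw [Measure.pi_of_empty, Measure.pi_of_empty]
  | succ n ih =>
    have hμ := (measurePreserving_piFinSuccAbove μ 0).symm
    have hν := (measurePreserving_piFinSuccAbove ν 0).symm
    rw [← hμ.map_eq, ← hν.map_eq]
    exact ((h 0).prod (ih fun j => h _)).map hμ.measurable

lemma perturbLaw_absolutelyContinuous {η : ℝ} (hη : 0 < η) (d : ℕ) :
    perturbLaw η d ≪ volume := by
  have := isProbabilityMeasure_expMeasure (inv_pos.2 hη)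
  exact pi_absolutelyContinuous fun _ => withDensity_absolutelyContinuous _ _

/-- A shift by `c` changes the exponential density by a factor `exp (r c)` at most. -/
lemma exponentialPDF_sub_le {r c : ℝ} (hr : 0 < r) (hc : 0 ≤ c) (a : ℝ) :
    exponentialPDF r (a - c) ≤ ENNReal.ofReal (Real.exp (r * c)) * exponentialPDF r a := by
  rw [exponentialPDF_eq, exponentialPDF_eq, ← ENNReal.ofReal_mul (Real.exp_pos _).le]
  apply ENNReal.ofReal_le_ofReal
  split_ifs with h1 h2
  · rw [mul_left_comm, ← Real.exp_add]
    apply le_of_eq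
    congr 2
    ring
  · linarith
  · positivity
  · simp

lemma lintegral_expMeasure_add_le {r c : ℝ} (hr : 0 < r) (hc : 0 ≤ c) {g : ℝ → ℝ≥0∞}
    (hg : Measurable g) :
    ∫⁻ a, g (a + c) ∂expMeasure r ≤
      ENNReal.ofReal (Real.exp (r * c)) * ∫⁻ a, g a ∂expMeasure r := by
  have hp := measurable_exponentialPDF r
  rw [expMeasure_eq_withDensity, lintegral_withDensity_eq_lintegral_mul _ hp (by fun_prop),
    lintegral_withDensity_eq_lintegral_mul _ hp hg,
    ← lintegral_const_mul _ (hp.mul hg)]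
  have h := lintegral_add_right_eq_self (μ := (volume : Measure ℝ))
    (fun a => exponentialPDF r (a - c) * g a) c
  simp only [add_sub_cancel_right] at h
  simp only [Pi.mul_apply]
  rw [h]
  refine lintegral_mono fun a => ?_
  rw [← mul_assoc]
  gcongr
  exact exponentialPDF_sub_le hr hc a

lemma lintegral_perturbLaw_add_single_le {η c : ℝ} (hη : 0 < η) (hc : 0 ≤ c) {d : ℕ} (i : Fin d)
    {g : (Fin d → ℝ) → ℝ≥0∞} (hg : Measurable g) :
    ∫⁻ s, g (s + Pi.single i c) ∂perturbLaw η d ≤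
      ENNReal.ofReal (Real.exp (c / η)) * ∫⁻ s, g s ∂perturbLaw η d := by
  have := isProbabilityMeasure_expMeasure (inv_pos.2 hη)
  obtain _ | n := d
  · exact i.elim0
  have hp := (measurePreserving_piFinSuccAbove (fun _ : Fin (n + 1) => expMeasure η⁻¹) i).symm
  have key : ∀ (a : ℝ) (q : Fin n → ℝ),
      i.insertNth (α := fun _ => ℝ) a q + Pi.single i c =
        i.insertNth (α := fun _ => ℝ) (a + c) q := by
    intro a q
    ext j
    refine Fin.succAboveCases i ?_ (fun k => ?_) j <;> simp
  unfold perturbLaw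
  rw [← hp.lintegral_comp (by fun_prop), ← hp.lintegral_comp hg]
  have hm : ∀ q : Fin n → ℝ,
      Measurable fun a : ℝ => g (i.insertNth (α := fun _ => ℝ) a q) := by
    intro q
    exact (hg.comp hp.measurable).comp (measurable_id.prodMk measurable_const)
  rw [lintegral_prod_symm, lintegral_prod_symm, ← lintegral_const_mul]
  · refine lintegral_mono fun q => ?_
    have := lintegral_expMeasure_add_le (inv_pos.2 hη) hc (hm q)
    rw [div_eq_inv_mul]
    refine le_trans (le_of_eq (lintegral_congr fun a => ?_)) this
    exact congrArg g (key a q)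
  · exact (hg.comp hp.measurable).lintegral_prod_left'
  · exact (hg.comp hp.measurable).aemeasurable
  · exact ((hg.comp (measurable_add_const (Pi.single i c))).comp hp.measurable).aemeasurable

/-- Moving one coordinate of the perturbation by `c` changes the mean of a function with values in
an interval of length `D` by at most `(c / η) D`. -/
lemma integral_perturbLaw_add_single_le {η c D lo : ℝ} (hη : 0 < η) (hc : 0 ≤ c)
    {d : ℕ} (i : Fin d) {g : (Fin d → ℝ) → ℝ} (hg : Measurable g) (h0 : ∀ s, lo ≤ g s)
    (h1 : ∀ s, g s ≤ lo + D) :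
    ∫ s, g (s + Pi.single i c) ∂perturbLaw η d ≤ ∫ s, g s ∂perturbLaw η d + c / η * D := by
  have := isProbabilityMeasure_perturbLaw hη d
  have hD : 0 ≤ D := by linarith [h0 0, h1 0]
  have hm : Measurable fun s : Fin d → ℝ => g (s + Pi.single i c) :=
    hg.comp (measurable_add_const _)
  have hb : ∀ s, ‖g s‖ ≤ |lo| + D := fun s => by
    rw [Real.norm_eq_abs, abs_le]
    constructor <;> cases abs_cases lo <;> linarith [h0 s, h1 s]
  have hi : Integrable g (perturbLaw η d) :=
    Integrable.of_bound hg.aestronglyMeasurable _ (ae_of_all _ hb)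
  have hi' : Integrable (fun s => g (s + Pi.single i c)) (perturbLaw η d) :=
    Integrable.of_bound hm.aestronglyMeasurable _ (ae_of_all _ fun s => hb _)
  -- the comparison of the two laws applies to the nonnegative function `g - lo`
  have key : ∫ s, (g (s + Pi.single i c) - lo) ∂perturbLaw η d ≤
      Real.exp (c / η) * ∫ s, (g s - lo) ∂perturbLaw η d := by
    rw [integral_eq_lintegral_of_nonneg_ae (ae_of_all _ fun s => by simp [h0])
      (hm.sub_const _).aestronglyMeasurable,
      integral_eq_lintegral_of_nonneg_ae (ae_of_all _ fun s => by simp [h0])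
      (hg.sub_const _).aestronglyMeasurable,
      ← ENNReal.toReal_ofReal (Real.exp_pos (c / η)).le, ← ENNReal.toReal_mul]
    apply ENNReal.toReal_mono
    · refine ENNReal.mul_ne_top ENNReal.ofReal_ne_top ?_
      exact (hi.sub (integrable_const lo)).lintegral_lt_top.ne
    · exact lintegral_perturbLaw_add_single_le hη hc i
        (g := fun s => ENNReal.ofReal (g s - lo)) (hg.sub_const _).ennreal_ofReal
  have hle : ∫ s, (g (s + Pi.single i c) - lo) ∂perturbLaw η d ≤ D := by
    calc _ ≤ ∫ s, D ∂perturbLaw η d := by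
          refine integral_mono (hi'.sub (integrable_const lo)) (integrable_const D) fun s => ?_
          simp only; linarith [h1 (s + Pi.single i c)]
      _ = D := by simp
  rw [integral_sub hi' (integrable_const lo)] at key hle
  rw [integral_sub hi (integrable_const lo)] at key
  simp only [integral_const, probReal_univ, smul_eq_mul] at key hle
  have hx : 0 ≤ c / η := by positivity
  have he := Real.add_one_le_exp (-(c / η))
  have hee : Real.exp (-(c / η)) * Real.exp (c / η) = 1 := by
    rw [← Real.exp_add]; simp
  have h2 := mul_le_mul_of_nonneg_left key (Real.exp_pos (-(c / η))).le
  rw [← mul_assoc, hee, one_mul] at h2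
  set A := ∫ s, g (s + Pi.single i c) ∂perturbLaw η d
  have hA : 0 ≤ A - lo := by
    have : ∫ s, lo ∂perturbLaw η d ≤ A :=
      integral_mono (integrable_const lo) hi' fun s => h0 _
    simp at this; linarith
  have h3 := mul_le_mul_of_nonneg_right he hA
  nlinarith [mul_le_mul_of_nonneg_left hle hx]

/-- The moment generating function of the exponential law at half of its rate. -/
lemma lintegral_exp_half_expMeasure {r : ℝ} (hr : 0 < r) :
    ∫⁻ a, ENNReal.ofReal (Real.exp (r / 2 * a)) ∂expMeasure r = 2 := by
  have hp := measurable_exponentialPDF r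
  rw [expMeasure_eq_withDensity, lintegral_withDensity_eq_lintegral_mul _ hp (by fun_prop)]
  have h2 := lintegral_exponentialPDF_eq_one (half_pos hr)
  calc _ = ∫⁻ a, 2 * exponentialPDF (r / 2) a := by
        congr 1 with a
        simp only [Pi.mul_apply]
        rw [exponentialPDF_eq, exponentialPDF_eq, ← ENNReal.ofReal_mul' (Real.exp_pos _).le,
          ← ENNReal.ofReal_ofNat, ← ENNReal.ofReal_mul (by norm_num)]
        congr 1
        split_ifs
        · rw [mul_assoc, ← Real.exp_add, ← mul_assoc]
          congr 2 <;> ring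
        · simp
    _ = 2 := by
        rw [lintegral_const_mul _ (measurable_exponentialPDF _), h2, mul_one]

lemma integrable_exp_half_expMeasure {r : ℝ} (hr : 0 < r) :
    Integrable (fun a => Real.exp (r / 2 * a)) (expMeasure r) := by
  refine ⟨by fun_prop, ?_⟩
  rw [hasFiniteIntegral_iff_ofReal (ae_of_all _ fun a => (Real.exp_pos _).le),
    lintegral_exp_half_expMeasure hr]
  norm_num

lemma integral_exp_half_expMeasure {r : ℝ} (hr : 0 < r) :
    ∫ a, Real.exp (r / 2 * a) ∂expMeasure r = 2 := by
  rw [integral_eq_lintegral_of_nonneg_ae (ae_of_all _ fun a => (Real.exp_pos _).le)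
    (by fun_prop), lintegral_exp_half_expMeasure hr]
  norm_num

lemma ae_nonneg_perturbLaw {η : ℝ} (hη : 0 < η) (d : ℕ) :
    ∀ᵐ s ∂perturbLaw η d, ∀ i, 0 ≤ s i := by
  have := isProbabilityMeasure_expMeasure (inv_pos.2 hη)
  have h1 : ∀ᵐ a ∂expMeasure η⁻¹, 0 ≤ a := by
    rw [expMeasure_eq_withDensity, ae_withDensity_iff (measurable_exponentialPDF _)]
    refine ae_of_all _ fun a ha => ?_
    by_contra h
    exact ha (exponentialPDF_of_neg (not_le.1 h))
  rw [ae_all_iff]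
  intro i
  exact (measurePreserving_eval (fun _ : Fin d => expMeasure η⁻¹) i).quasiMeasurePreserving.ae h1

/-- An upper bound for the largest coordinate of `s` that is easy to integrate; it comes from
`t ≤ log A + exp t / A - 1` with `A = d` and `t = s i / (2 η)`. -/
noncomputable def maxBound (η : ℝ) {d : ℕ} (s : Fin d → ℝ) : ℝ :=
  2 * η * (Real.log d - 1 + (d : ℝ)⁻¹ * ∑ i, Real.exp (η⁻¹ / 2 * s i))

lemma le_maxBound {η : ℝ} (hη : 0 < η) {d : ℕ} (s : Fin d → ℝ) (i : Fin d) :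
    s i ≤ maxBound η s := by
  have hd : (0 : ℝ) < d := by exact_mod_cast i.pos
  have h1 : Real.exp (η⁻¹ / 2 * s i) ≤ ∑ j, Real.exp (η⁻¹ / 2 * s j) :=
    Finset.single_le_sum (f := fun j => Real.exp (η⁻¹ / 2 * s j))
      (fun j _ => (Real.exp_pos _).le) (Finset.mem_univ i)
  have h2 := Real.log_le_sub_one_of_pos
    (mul_pos (inv_pos.2 hd) (Real.exp_pos (η⁻¹ / 2 * s i)))
  rw [Real.log_mul (by positivity) (by positivity), Real.log_inv, Real.log_exp] at h2
  have h3 := mul_le_mul_of_nonneg_left h1 (inv_pos.2 hd).le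
  have h4 : η⁻¹ / 2 * s i ≤
      Real.log d - 1 + (d : ℝ)⁻¹ * ∑ i, Real.exp (η⁻¹ / 2 * s i) := by linarith
  have h5 := mul_le_mul_of_nonneg_left h4 (by positivity : 0 ≤ 2 * η)
  unfold maxBound
  refine le_trans (le_of_eq ?_) h5
  field_simp

lemma integrable_exp_half_perturbLaw {η : ℝ} (hη : 0 < η) {d : ℕ} (i : Fin d) :
    Integrable (fun s : Fin d → ℝ => Real.exp (η⁻¹ / 2 * s i)) (perturbLaw η d) := by
  have := isProbabilityMeasure_expMeasure (inv_pos.2 hη)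
  exact integrable_comp_eval (μ := fun _ : Fin d => expMeasure η⁻¹) (i := i)
    (integrable_exp_half_expMeasure (inv_pos.2 hη))

lemma integrable_maxBound {η : ℝ} (hη : 0 < η) (d : ℕ) :
    Integrable (maxBound η) (perturbLaw η d) := by
  have := isProbabilityMeasure_perturbLaw hη d
  unfold maxBound
  exact ((integrable_const _).add ((integrable_finsetSum _ fun i _ =>
    integrable_exp_half_perturbLaw hη i).const_mul _)).const_mul _

lemma integral_maxBound {η : ℝ} (hη : 0 < η) {d : ℕ} (hd : 0 < d) :
    ∫ s, maxBound η s ∂perturbLaw η d = 2 * η * (Real.log d + 1) := by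
  have := isProbabilityMeasure_expMeasure (inv_pos.2 hη)
  have := isProbabilityMeasure_perturbLaw hη d
  have hd' : (d : ℝ) ≠ 0 := by positivity
  have h1 : ∀ i : Fin d, ∫ s, Real.exp (η⁻¹ / 2 * s i) ∂perturbLaw η d = 2 := by
    intro i
    refine Eq.trans ?_ (integral_exp_half_expMeasure (inv_pos.2 hη))
    exact integral_comp_eval (μ := fun _ : Fin d => expMeasure η⁻¹) (i := i)
      (f := fun a => Real.exp (η⁻¹ / 2 * a)) (by fun_prop)
  unfold maxBound
  rw [integral_const_mul, integral_add (integrable_const _)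
    ((integrable_finsetSum _ fun i _ => integrable_exp_half_perturbLaw hη i).const_mul _),
    integral_const_mul, integral_finsetSum _ fun i _ => integrable_exp_half_perturbLaw hη i]
  simp only [h1, integral_const, probReal_univ, one_smul, Finset.sum_const, Finset.card_univ,
    Fintype.card_fin, nsmul_eq_mul]
  field_simp
  ring

/-! ### The perturbed minimizer -/

lemma l1Norm_nonneg {d : ℕ} (v : Fin d → ℝ) : 0 ≤ l1Norm v :=
  Finset.sum_nonneg fun _ _ => abs_nonneg _

lemma abs_le_l1Norm {d : ℕ} (v : Fin d → ℝ) (i : Fin d) : |v i| ≤ l1Norm v :=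
  Finset.single_le_sum (f := fun i => |v i|) (fun _ _ => abs_nonneg _) (Finset.mem_univ i)

lemma continuous_l1Norm {d : ℕ} : Continuous (l1Norm (d := d)) := by
  unfold l1Norm
  fun_prop

/-- The `ℓ¹` distance of two points of a subset of `ℝ^d`. -/
noncomputable def l1Dist {d : ℕ} {X : Set (Fin d → ℝ)} (x y : X) : ℝ :=
  l1Norm ((x : Fin d → ℝ) - (y : Fin d → ℝ))

lemma l1Dist_nonneg {d : ℕ} {X : Set (Fin d → ℝ)} (x y : X) : 0 ≤ l1Dist x y :=
  l1Norm_nonneg _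

lemma l1Dist_comm {d : ℕ} {X : Set (Fin d → ℝ)} (x y : X) : l1Dist x y = l1Dist y x := by
  simp [l1Dist, l1Norm, abs_sub_comm]

lemma measurable_l1Dist {d : ℕ} {X : Set (Fin d → ℝ)} {α : Type*} [MeasurableSpace α] {f g : α → X}
    (hf : Measurable f) (hg : Measurable g) : Measurable fun a => l1Dist (f a) (g a) :=
  continuous_l1Norm.measurable.comp
    ((measurable_subtype_coe.comp hf).sub (measurable_subtype_coe.comp hg))

/-- The space of continuous losses carries its Borel `σ`-algebra. -/
instance {X : Type*} [TopologicalSpace X] : MeasurableSpace C(X, ℝ) := borel _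

instance {X : Type*} [TopologicalSpace X] : BorelSpace C(X, ℝ) := ⟨rfl⟩

section

variable {d : ℕ} {X : Set (Fin d → ℝ)}

/-- The optimal value `min_{x ∈ X} (h x - ⟨s, x⟩)` of the loss `h` perturbed by `s`. -/
noncomputable def value (h : C(X, ℝ)) (s : Fin d → ℝ) : ℝ :=
  ⨅ x : X, (h x - s ⬝ᵥ (x : Fin d → ℝ))

open Classical in
/-- The minimizer of `h x - ⟨s, x⟩` over `X`, as a jointly measurable function of `h` and `s`: by
the envelope theorem its coordinates are the partial derivatives of `-value h` at `s`. Where these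
do not give a point of `X` (which happens for a null set of `s` only) an arbitrary point is
taken. -/
noncomputable def best [Nonempty X] (h : C(X, ℝ)) (s : Fin d → ℝ) : X :=
  if hx : (fun i => -fderiv ℝ (value h) s (Pi.single i 1)) ∈ X then ⟨_, hx⟩
  else Classical.arbitrary X

lemma continuous_perturbed (h : C(X, ℝ)) (s : Fin d → ℝ) :
    Continuous fun x : X => h x - s ⬝ᵥ (x : Fin d → ℝ) := by
  exact h.continuous.sub (continuous_const.dotProduct continuous_subtype_val)

variable [CompactSpace X]

lemma value_le (h : C(X, ℝ)) (s : Fin d → ℝ) (x : X) :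
    value h s ≤ h x - s ⬝ᵥ (x : Fin d → ℝ) :=
  ciInf_le (isCompact_range (continuous_perturbed h s)).bddBelow x

/-- A bound for the coordinates of the points of a compact set. -/
lemma exists_coord_bound (X : Set (Fin d → ℝ)) [CompactSpace X] :
    ∃ R : ℝ, 0 ≤ R ∧ ∀ (x : X) (i : Fin d), |(x : Fin d → ℝ) i| ≤ R := by
  have hX : IsCompact X := isCompact_iff_compactSpace.2 inferInstance
  obtain ⟨R, hR⟩ := hX.isBounded.exists_norm_le
  exact ⟨max R 0, le_max_right _ _, fun x i =>
    ((norm_le_pi_norm (x : Fin d → ℝ) i).trans (hR x x.2)).trans (le_max_left _ _)⟩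

variable [Nonempty X]

lemma exists_value_eq (h : C(X, ℝ)) (s : Fin d → ℝ) :
    ∃ x : X, value h s = h x - s ⬝ᵥ (x : Fin d → ℝ) := by
  obtain ⟨x, -, hx⟩ := isCompact_univ.exists_isMinOn (Set.univ_nonempty (α := X))
    (continuous_perturbed h s).continuousOn
  exact ⟨x, le_antisymm (value_le h s x) (le_ciInf fun y => hx (Set.mem_univ y))⟩

lemma abs_value_sub_le_norm (h h' : C(X, ℝ)) (s : Fin d → ℝ) :
    |value h s - value h' s| ≤ ‖h - h'‖ := by
  have key : ∀ h h' : C(X, ℝ), value h s - value h' s ≤ ‖h - h'‖ := by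
    intro h h'
    obtain ⟨x, hx⟩ := exists_value_eq h' s
    have h1 := value_le h s x
    have h2 := (le_abs_self _).trans ((h - h').norm_coe_le_norm x)
    simp only [ContinuousMap.sub_apply] at h2
    linarith
  rw [abs_le]
  constructor
  · rw [norm_sub_rev]; linarith [key h' h]
  · exact key h h'

lemma exists_lipschitzWith_value (X : Set (Fin d → ℝ)) [CompactSpace X] [Nonempty X] :
    ∃ C : NNReal, ∀ h : C(X, ℝ), LipschitzWith C (value h) := by
  obtain ⟨R, hR0, hR⟩ := exists_coord_bound X
  refine ⟨⟨d * R, by positivity⟩, fun h => LipschitzWith.of_le_add_mul _ fun s s' => ?_⟩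
  obtain ⟨x, hx⟩ := exists_value_eq h s'
  have h1 := value_le h s x
  have h2 : (s' - s) ⬝ᵥ (x : Fin d → ℝ) ≤ d * R * Dist.dist s s' := by
    calc _ ≤ ∑ i : Fin d, Dist.dist s s' * R := by
          refine Finset.sum_le_sum fun i _ => (le_abs_self _).trans ?_
          rw [abs_mul]
          gcongr
          · rw [dist_comm]; exact dist_le_pi_dist s' s i
          · exact hR x i
      _ = _ := by simp; ring
  rw [sub_dotProduct] at h2
  change _ ≤ _ + d * R * Dist.dist s s'
  linarith

lemma continuous_value :
    Continuous (Function.uncurry (value : C(X, ℝ) → (Fin d → ℝ) → ℝ)) := by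
  obtain ⟨C, hC⟩ := exists_lipschitzWith_value X
  refine continuous_prod_of_continuous_lipschitzWith _ 1 (fun h => (hC h).continuous) fun s => ?_
  refine LipschitzWith.of_dist_le_mul fun h h' => ?_
  rw [Real.dist_eq, dist_eq_norm, NNReal.coe_one, one_mul]
  exact abs_value_sub_le_norm h h' s

lemma measurable_best :
    Measurable fun p : C(X, ℝ) × (Fin d → ℝ) => best p.1 p.2 := by
  have hX : IsCompact X := isCompact_iff_compactSpace.2 inferInstance
  have hg : Measurable fun p : C(X, ℝ) × (Fin d → ℝ) =>
      (fun i => -fderiv ℝ (value p.1) p.2 (Pi.single i 1) : Fin d → ℝ) :=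
    measurable_pi_iff.2 fun i =>
      (measurable_fderiv_apply_const_with_param ℝ continuous_value (Pi.single i 1)).neg
  have : Measurable fun p : C(X, ℝ) × (Fin d → ℝ) => ((best p.1 p.2 : X) : Fin d → ℝ) := by
    classical
    have h2 : Measurable fun p : C(X, ℝ) × (Fin d → ℝ) =>
        if (fun i => -fderiv ℝ (value p.1) p.2 (Pi.single i 1)) ∈ X then
          (fun i => -fderiv ℝ (value p.1) p.2 (Pi.single i 1))
        else ((Classical.arbitrary X : X) : Fin d → ℝ) :=
      Measurable.ite (hg hX.measurableSet) hg measurable_const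
    convert! h2 using 2 with p
    unfold best
    by_cases hp : (fun i => -fderiv ℝ (value p.1) p.2 (Pi.single i 1)) ∈ X
    · rw [dif_pos hp, if_pos hp]
    · rw [dif_neg hp, if_neg hp]
  exact this.subtype_mk

lemma measurable_best_right (h : C(X, ℝ)) : Measurable (best h) := by
  have h1 : Measurable fun s : Fin d → ℝ => (h, s) := measurable_prodMk_left
  have h2 := Measurable.comp measurable_best h1
  exact h2

/-- The envelope theorem: where `value h` is differentiable, every minimizer equals `best h s`, and
in particular the minimizer is unique. -/
lemma best_eq_of_differentiableAt {h : C(X, ℝ)} {s : Fin d → ℝ}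
    (hs : DifferentiableAt ℝ (value h) s) {x : X}
    (hx : value h s = h x - s ⬝ᵥ (x : Fin d → ℝ)) : best h s = x := by
  have hlin : HasFDerivAt (fun s' : Fin d → ℝ => s' ⬝ᵥ (x : Fin d → ℝ)) (pairing x) s := by
    have : (fun s' : Fin d → ℝ => s' ⬝ᵥ (x : Fin d → ℝ)) = pairing (x : Fin d → ℝ) := by
      ext s'
      simp [pairing, dotProduct, mul_comm]
    rw [this]
    exact (pairing (x : Fin d → ℝ)).hasFDerivAt
  -- `value h + ⟨·, x⟩` is at most `h x` everywhere, with equality at `s`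
  have hmax : IsLocalMax (fun s' => value h s' + s' ⬝ᵥ (x : Fin d → ℝ)) s := by
    refine Filter.Eventually.of_forall fun s' => ?_
    simp only
    linarith [value_le h s' x]
  have h0 := hmax.hasFDerivAt_eq_zero (hs.hasFDerivAt.add hlin)
  have hco : ∀ i, -fderiv ℝ (value h) s (Pi.single i 1) = (x : Fin d → ℝ) i := by
    intro i
    have h1 := congrArg (fun l : (Fin d → ℝ) →L[ℝ] ℝ => l (Pi.single i 1)) h0
    simp [pairing, Pi.single_apply] at h1
    linarith
  have hx' : (fun i => -fderiv ℝ (value h) s (Pi.single i 1)) = (x : Fin d → ℝ) := funext hco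
  unfold best
  rw [dif_pos (by rw [hx']; exact x.2)]
  exact Subtype.ext hx'

lemma ae_value_eq (h : C(X, ℝ)) : ∀ᵐ s : Fin d → ℝ,
    value h s = h (best h s) - s ⬝ᵥ (best h s : Fin d → ℝ) := by
  obtain ⟨C, hC⟩ := exists_lipschitzWith_value X
  filter_upwards [(hC h).ae_differentiableAt (μ := volume)] with s hs
  obtain ⟨x, hx⟩ := exists_value_eq h s
  rw [best_eq_of_differentiableAt hs hx]
  exact hx

lemma ae_value_eq_add (h : C(X, ℝ)) (v : Fin d → ℝ) : ∀ᵐ s : Fin d → ℝ,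
    value h (s + v) = h (best h (s + v)) - (s + v) ⬝ᵥ (best h (s + v) : Fin d → ℝ) :=
  (measurePreserving_add_right volume v).quasiMeasurePreserving.ae (ae_value_eq h)

end

/-! ### The perturbed potential and the stability of the minimizer -/

section

variable {d : ℕ} {X : Set (Fin d → ℝ)}

/-- The expected optimal value of the perturbed loss, normalized to vanish at `h = 0`. -/
noncomputable def potential (η : ℝ) (h : C(X, ℝ)) : ℝ :=
  ∫ s, (value h s - value (0 : C(X, ℝ)) s) ∂perturbLaw η d

variable [Nonempty X]

/-- The expected distance between the perturbed minimizers of two losses, computed with the same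
perturbation. -/
noncomputable def drift (η : ℝ) (h h' : C(X, ℝ)) : ℝ :=
  ∫ s, l1Dist (best h s) (best h' s) ∂perturbLaw η d

/-- The expectation of `k` at the perturbed minimizer of `h`. -/
noncomputable def mean (η : ℝ) (h k : C(X, ℝ)) : ℝ :=
  ∫ s, k (best h s) ∂perturbLaw η d

/-- The Bregman divergence of the (concave) potential, whose derivative at `h` is `mean η h`. -/
noncomputable def bregman (η : ℝ) (h' h : C(X, ℝ)) : ℝ :=
  potential η h + mean η h (h' - h) - potential η h'

variable [CompactSpace X] {η : ℝ}

lemma integrable_value_sub (hη : 0 < η) (h h' : C(X, ℝ)) :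
    Integrable (fun s => value h s - value h' s) (perturbLaw η d) := by
  have := isProbabilityMeasure_perturbLaw hη d
  obtain ⟨C, hC⟩ := exists_lipschitzWith_value X
  exact Integrable.of_bound ((hC h).continuous.sub (hC h').continuous).aestronglyMeasurable ‖h - h'‖
    (ae_of_all _ fun s => abs_value_sub_le_norm h h' s)

lemma potential_sub (hη : 0 < η) (h h' : C(X, ℝ)) :
    potential η h - potential η h' = ∫ s, (value h s - value h' s) ∂perturbLaw η d := by
  unfold potential
  rw [← integral_sub (integrable_value_sub hη _ _) (integrable_value_sub hη _ _)]
  simp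

lemma abs_potential_sub_le (hη : 0 < η) (h h' : C(X, ℝ)) :
    |potential η h - potential η h'| ≤ ‖h - h'‖ := by
  have := isProbabilityMeasure_perturbLaw hη d
  rw [potential_sub hη]
  have := norm_integral_le_of_norm_le_const (μ := perturbLaw η d)
    (f := fun s => value h s - value h' s)
    (ae_of_all _ fun s => abs_value_sub_le_norm h h' s)
  simpa using this

lemma continuous_potential (hη : 0 < η) :
    Continuous (potential η : C(X, ℝ) → ℝ) := by
  have : LipschitzWith 1 (potential η : C(X, ℝ) → ℝ) := by
    refine LipschitzWith.of_dist_le_mul fun h h' => ?_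
    rw [Real.dist_eq, dist_eq_norm, NNReal.coe_one, one_mul]
    exact abs_potential_sub_le hη h h'
  exact this.continuous

omit [Nonempty X] [CompactSpace X] in
lemma potential_zero : potential η (0 : C(X, ℝ)) = 0 := by simp [potential]

lemma integrable_comp_best (hη : 0 < η) (h k : C(X, ℝ)) :
    Integrable (fun s => k (best h s)) (perturbLaw η d) := by
  have := isProbabilityMeasure_perturbLaw hη d
  exact Integrable.of_bound
    (k.continuous.measurable.comp (measurable_best_right h)).aestronglyMeasurable ‖k‖
    (ae_of_all _ fun s => k.norm_coe_le_norm _)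

lemma mean_sub (hη : 0 < η) (h k k' : C(X, ℝ)) :
    mean η h (k - k') = mean η h k - mean η h k' := by
  unfold mean
  rw [← integral_sub (integrable_comp_best hη _ _) (integrable_comp_best hη _ _)]
  rfl

lemma bregman_add_bregman (hη : 0 < η) (h h' : C(X, ℝ)) :
    bregman η h' h + bregman η h h' = mean η h (h' - h) - mean η h' (h' - h) := by
  have : h - h' = 0 - (h' - h) := by abel
  unfold bregman
  rw [this, mean_sub hη h', show mean η h' 0 = 0 by simp [mean]]
  ring

/-- The Bregman divergence is the mean suboptimality, for the perturbed loss `h'`, of the perturbed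
minimizer of `h`. -/
lemma bregman_eq_integral (hη : 0 < η) (h h' : C(X, ℝ)) :
    Integrable (fun s => h' (best h s) - s ⬝ᵥ (best h s : Fin d → ℝ) - value h' s)
      (perturbLaw η d) ∧
    bregman η h' h =
      ∫ s, (h' (best h s) - s ⬝ᵥ (best h s : Fin d → ℝ) - value h' s) ∂perturbLaw η d := by
  have hae : (fun s => (value h s - value h' s) + (h' - h) (best h s)) =ᵐ[perturbLaw η d]
      fun s => h' (best h s) - s ⬝ᵥ (best h s : Fin d → ℝ) - value h' s := by
    filter_upwards [(perturbLaw_absolutelyContinuous hη d).ae_le (ae_value_eq h)] with s hs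
    rw [hs]
    simp only [ContinuousMap.sub_apply]
    ring
  have h1 := integrable_value_sub hη h h'
  have h2 := integrable_comp_best hη h (h' - h)
  refine ⟨(h1.add h2).congr hae, ?_⟩
  rw [← integral_congr_ae hae, integral_add h1 h2, ← potential_sub hη]
  unfold bregman mean
  ring

lemma bregman_nonneg (hη : 0 < η) (h h' : C(X, ℝ)) : 0 ≤ bregman η h' h := by
  rw [(bregman_eq_integral hη h h').2]
  exact integral_nonneg fun s => sub_nonneg.2 (value_le h' s _)

omit [Nonempty X] in
/-- If the perturbation is moved by `c` along a coordinate, then that coordinate of the minimizer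
follows, up to the suboptimality of the point `x` it is compared with. -/
lemma mul_coord_sub_le {h : C(X, ℝ)} {s : Fin d → ℝ} {c : ℝ} {i : Fin d} {u : X}
    (hu : value h (s + Pi.single i c) =
      h u - (s + Pi.single i c) ⬝ᵥ (u : Fin d → ℝ)) (x : X) :
    c * ((x : Fin d → ℝ) i - (u : Fin d → ℝ) i) ≤
      h x - s ⬝ᵥ (x : Fin d → ℝ) - value h s := by
  have h1 := value_le h (s + Pi.single i c) x
  have h2 := value_le h s u
  rw [hu] at h1
  rw [add_dotProduct, add_dotProduct, single_dotProduct, single_dotProduct] at h1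
  linarith

omit [Nonempty X] in
/-- A common bound for the coordinates of two minimizers: both lie, up to the suboptimality of the
first for the loss of the second, between the minimizers for the perturbations moved by `±c`. -/
lemma abs_coord_sub_le {h : C(X, ℝ)} {s : Fin d → ℝ} {c : ℝ} (hc : 0 < c) {i : Fin d}
    {a x u v : X} (hx : value h s = h x - s ⬝ᵥ (x : Fin d → ℝ))
    (hu : value h (s + Pi.single i c) =
      h u - (s + Pi.single i c) ⬝ᵥ (u : Fin d → ℝ))
    (hv : value h (s + Pi.single i (-c)) =
      h v - (s + Pi.single i (-c)) ⬝ᵥ (v : Fin d → ℝ)) :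
    |(a : Fin d → ℝ) i - (x : Fin d → ℝ) i| ≤
      (u : Fin d → ℝ) i - (v : Fin d → ℝ) i +
        (h a - s ⬝ᵥ (a : Fin d → ℝ) - value h s) / c := by
  have h1 := mul_coord_sub_le hu a
  have h2 := mul_coord_sub_le hu x
  have h3 := mul_coord_sub_le hv a
  have h4 := mul_coord_sub_le hv x
  set g := h a - s ⬝ᵥ (a : Fin d → ℝ) - value h s
  have h0 : h x - s ⬝ᵥ (x : Fin d → ℝ) - value h s = 0 := by linarith
  rw [h0] at h2 h4
  have e1 : (a : Fin d → ℝ) i - (u : Fin d → ℝ) i ≤ g / c := by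
    rw [le_div_iff₀ hc]; linarith
  have e2 : (x : Fin d → ℝ) i ≤ (u : Fin d → ℝ) i := by
    by_contra hcon
    nlinarith
  have e3 : (v : Fin d → ℝ) i - (a : Fin d → ℝ) i ≤ g / c := by
    rw [le_div_iff₀ hc]; linarith
  have e4 : (v : Fin d → ℝ) i ≤ (x : Fin d → ℝ) i := by
    by_contra hcon
    nlinarith
  rw [abs_le]
  constructor <;> linarith

lemma measurable_coord_best (h : C(X, ℝ)) (i : Fin d) :
    Measurable fun s => (best h s : Fin d → ℝ) i :=
  (measurable_pi_apply i).comp (measurable_subtype_coe.comp (measurable_best_right h))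

lemma exists_coord_range {D : ℝ} (hD : ∀ x x' : X, l1Dist x x' ≤ D)
    (i : Fin d) : ∃ lo : ℝ, ∀ x : X, lo ≤ (x : Fin d → ℝ) i ∧ (x : Fin d → ℝ) i ≤ lo + D := by
  obtain ⟨m, -, hm⟩ := isCompact_univ.exists_isMinOn (Set.univ_nonempty (α := X))
    (f := fun x : X => (x : Fin d → ℝ) i)
    ((continuous_apply i).comp continuous_subtype_val).continuousOn
  refine ⟨(m : Fin d → ℝ) i, fun x => ⟨hm (Set.mem_univ x), ?_⟩⟩
  have h1 := (le_abs_self _).trans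
    ((abs_le_l1Norm ((x : Fin d → ℝ) - (m : Fin d → ℝ)) i).trans (hD x m))
  simp only [Pi.sub_apply] at h1
  linarith

lemma measurable_l1Dist_best (h h' : C(X, ℝ)) :
    Measurable fun s => l1Dist (best h s) (best h' s) :=
  measurable_l1Dist (measurable_best_right h) (measurable_best_right h')

variable {D : ℝ} (hD : ∀ x x' : X, l1Dist x x' ≤ D)

include hD

lemma integrable_l1Dist_best (hη : 0 < η) (h h' : C(X, ℝ)) :
    Integrable (fun s => l1Dist (best h s) (best h' s)) (perturbLaw η d) := by
  have := isProbabilityMeasure_perturbLaw hη d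
  refine Integrable.of_bound (measurable_l1Dist_best h h').aestronglyMeasurable D
    (ae_of_all _ fun s => ?_)
  rw [Real.norm_eq_abs, abs_of_nonneg (l1Dist_nonneg _ _)]
  exact hD _ _

/-- `abs_coord_sub_le` on average: the two perturbations moved by `±c` cost `(c / η) D` each. -/
lemma integral_abs_coord_sub_le (hη : 0 < η) (h h' : C(X, ℝ)) {c : ℝ} (hc : 0 < c) (i : Fin d) :
    Integrable (fun s => |(best h s : Fin d → ℝ) i - (best h' s : Fin d → ℝ) i|)
      (perturbLaw η d) ∧
    ∫ s, |(best h s : Fin d → ℝ) i - (best h' s : Fin d → ℝ) i| ∂perturbLaw η d ≤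
      2 * (c / η * D) + bregman η h' h / c := by
  have := isProbabilityMeasure_perturbLaw hη d
  obtain ⟨lo, hlo⟩ := exists_coord_range hD i
  set g : (Fin d → ℝ) → ℝ := fun s => (best h' s : Fin d → ℝ) i with hg
  have hgm : Measurable g := measurable_coord_best h' i
  have hgc : ∀ c : ℝ, Measurable fun s : Fin d → ℝ => g (s + Pi.single i c) :=
    fun c => hgm.comp (measurable_add_const _)
  have hgi : ∀ c : ℝ, Integrable (fun s => g (s + Pi.single i c)) (perturbLaw η d) := by
    intro c
    refine Integrable.of_bound (hgc c).aestronglyMeasurable (|lo| + |D|)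
      (ae_of_all _ fun s => ?_)
    have := hlo (best h' (s + Pi.single i c))
    rw [Real.norm_eq_abs, abs_le]
    constructor <;> cases abs_cases lo <;> cases abs_cases D <;> linarith [this.1, this.2]
  have hup := integral_perturbLaw_add_single_le hη hc.le i hgm (fun s => (hlo _).1)
    (fun s => (hlo _).2)
  have hdn := integral_perturbLaw_add_single_le hη hc.le i (hgc (-c)) (fun s => (hlo _).1)
    (fun s => (hlo _).2)
  have hz : ∀ s : Fin d → ℝ, s + Pi.single i c + Pi.single i (-c) = s := by
    intro s
    rw [add_assoc, ← Pi.single_add]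
    simp
  simp only [hz] at hdn
  obtain ⟨hbi, hb⟩ := bregman_eq_integral hη h h'
  have hpt : ∀ᵐ s ∂perturbLaw η d,
      |(best h s : Fin d → ℝ) i - (best h' s : Fin d → ℝ) i| ≤
        g (s + Pi.single i c) - g (s + Pi.single i (-c)) +
          (h' (best h s) - s ⬝ᵥ (best h s : Fin d → ℝ) - value h' s) / c := by
    have hac := (perturbLaw_absolutelyContinuous hη d).ae_le
    filter_upwards [hac (ae_value_eq h'), hac (ae_value_eq_add h' (Pi.single i c)),
      hac (ae_value_eq_add h' (Pi.single i (-c)))] with s h1 h2 h3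
    exact abs_coord_sub_le hc h1 h2 h3
  have hint := ((hgi c).sub (hgi (-c))).add (hbi.div_const c)
  have hi : Integrable (fun s => |(best h s : Fin d → ℝ) i - (best h' s : Fin d → ℝ) i|)
      (perturbLaw η d) := by
    refine hint.mono' ((measurable_coord_best h i).sub
      (measurable_coord_best h' i)).norm.aestronglyMeasurable ?_
    filter_upwards [hpt] with s hs
    rw [Real.norm_eq_abs, abs_abs]
    exact hs
  refine ⟨hi, (integral_mono_ae hi hint hpt).trans ?_⟩
  have e1 := integral_add ((hgi c).sub (hgi (-c))) (hbi.div_const c)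
  have e2 := integral_sub (hgi c) (hgi (-c))
  rw [integral_div, ← hb] at e1
  simp only [Pi.add_apply, Pi.sub_apply] at e1 e2 ⊢
  rw [e1, e2]
  linarith

lemma drift_le (hη : 0 < η) (h h' : C(X, ℝ)) {c : ℝ} (hc : 0 < c) :
    drift η h h' ≤ d * (2 * (c / η * D) + bregman η h' h / c) := by
  unfold drift l1Dist l1Norm
  simp only [Pi.sub_apply]
  rw [integral_finsetSum _ fun i _ => (integral_abs_coord_sub_le hD hη h h' hc i).1]
  calc _ ≤ ∑ i : Fin d, (2 * (c / η * D) + bregman η h' h / c) :=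
        Finset.sum_le_sum fun i _ => (integral_abs_coord_sub_le hD hη h h' hc i).2
    _ = _ := by simp; ring

lemma drift_le_diam (hη : 0 < η) (h h' : C(X, ℝ)) : drift η h h' ≤ D := by
  have := isProbabilityMeasure_perturbLaw hη d
  have := integral_mono (integrable_l1Dist_best hD hη h h') (integrable_const D) fun s => hD _ _
  simpa [drift] using this

omit hD [CompactSpace X] in
lemma drift_nonneg (h h' : C(X, ℝ)) : 0 ≤ drift η h h' :=
  integral_nonneg fun _ => l1Dist_nonneg _ _

omit hD [CompactSpace X] in
lemma drift_comm (h h' : C(X, ℝ)) : drift η h h' = drift η h' h := by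
  simp only [drift, l1Dist_comm]

/-- The constant that relates the squared drift of the minimizer to the Bregman divergence of the
potential. -/
noncomputable def stabilityConst (d : ℕ) (D η : ℝ) : ℝ := 8 * d ^ 2 * D / η

/-- The squared drift is controlled by the Bregman divergence of the potential; dually, the potential
is strongly smooth. -/
lemma drift_sq_le (hη : 0 < η) (hD0 : 0 < D) (h h' : C(X, ℝ)) :
    drift η h h' ^ 2 ≤ stabilityConst d D η * bregman η h' h := by
  unfold stabilityConst
  have hB := bregman_nonneg hη h h'
  rcases (drift_nonneg (η := η) h h').eq_or_lt with h0 | h0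
  · rw [← h0]; simp only [ne_eq, OfNat.ofNat_ne_zero, not_false_eq_true, zero_pow]; positivity
  have hd : (0 : ℝ) < d := by
    rcases Nat.eq_zero_or_pos d with hd | hd
    · have := drift_le hD hη h h' one_pos
      rw [show (d : ℝ) = 0 by exact_mod_cast hd, zero_mul] at this
      linarith
    · exact_mod_cast hd
  set W := drift η h h'
  -- this `c` makes the first term of the bound equal to half of the drift
  have h1 := drift_le hD hη h h' (c := W * η / (4 * d * D)) (by positivity)
  have h2 : d * (2 * (W * η / (4 * d * D) / η * D) + bregman η h' h / (W * η / (4 * d * D))) =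
      W / 2 + 4 * d ^ 2 * D / η * bregman η h' h / W := by
    field_simp
    ring
  rw [h2] at h1
  have h3 : W / 2 ≤ 4 * d ^ 2 * D / η * bregman η h' h / W := by linarith
  rw [le_div_iff₀ h0] at h3
  have h4 : 8 * d ^ 2 * D / η * bregman η h' h = 2 * (4 * d ^ 2 * D / η * bregman η h' h) := by ring
  rw [h4]
  nlinarith

end

/-! ### Averages of the losses generated by the opponent -/

section

variable {d : ℕ} {X Y : Set (Fin d → ℝ)} {η : ℝ}

/-- The average of the losses generated by `m` points of the opponent. -/
noncomputable def avg {m : ℕ} (k : C(Y, C(X, ℝ))) (ys : Fin m → Y) : C(X, ℝ) :=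
  (m : ℝ)⁻¹ • ∑ j, k (ys j)

/-- The expected loss generated by a random point of the opponent. -/
noncomputable def mixed [CompactSpace X] (k : C(Y, C(X, ℝ))) (τ : Measure Y) : C(X, ℝ) :=
  ∫ y, k y ∂τ

/-- The mixed second differences of the loss `k y x` are bounded by `L` times the product of the
`ℓ¹` distances. This is the only consequence of smoothness that the
analysis of a round with guesses uses. -/
def MixedLipschitz (k : C(Y, C(X, ℝ))) (L : ℝ) : Prop :=
  ∀ (x x' : X) (y y' : Y),
    |(k y - k y') x - (k y - k y') x'| ≤ L * l1Dist x x' * l1Dist y y'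

lemma continuous_avg {m : ℕ} (k : C(Y, C(X, ℝ))) :
    Continuous (avg k : (Fin m → Y) → C(X, ℝ)) := by
  unfold avg
  have : Continuous fun ys : Fin m → Y => ∑ j, k (ys j) :=
    continuous_finsetSum _ fun j _ => k.continuous.comp (continuous_apply j)
  exact this.const_smul (m : ℝ)⁻¹

variable [CompactSpace X] [CompactSpace Y]

lemma norm_avg_le {m : ℕ} (k : C(Y, C(X, ℝ))) (ys : Fin m → Y) : ‖avg k ys‖ ≤ ‖k‖ := by
  rcases Nat.eq_zero_or_pos m with rfl | hm
  · simp only [avg, Finset.univ_eq_empty, Finset.sum_empty, smul_zero, norm_zero]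
    exact norm_nonneg k
  have hm' : (0 : ℝ) < m := by exact_mod_cast hm
  unfold avg
  rw [norm_smul, norm_inv, RCLike.norm_natCast, inv_mul_le_iff₀ hm']
  calc _ ≤ ∑ j, ‖k (ys j)‖ := norm_sum_le _ _
    _ ≤ ∑ j : Fin m, ‖k‖ := Finset.sum_le_sum fun j _ => k.norm_coe_le_norm _
    _ = _ := by simp

lemma integrable_of_continuous {α E : Type*} [TopologicalSpace α] [CompactSpace α]
    [MeasurableSpace α] [BorelSpace α] [SecondCountableTopology α] [NormedAddCommGroup E]
    {f : α → E} (hf : Continuous f) (τ : Measure α) [IsFiniteMeasure τ] : Integrable f τ := by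
  obtain ⟨C, hC⟩ := isCompact_univ.exists_bound_of_continuousOn hf.continuousOn
  exact Integrable.of_bound hf.aestronglyMeasurable C (ae_of_all _ fun x => hC x (Set.mem_univ x))

lemma integral_avg {m : ℕ} (hm : 0 < m) (k : C(Y, C(X, ℝ))) (τ : Measure Y)
    [IsProbabilityMeasure τ] :
    ∫ ys : Fin m → Y, avg k ys ∂Measure.pi (fun _ => τ) = mixed k τ := by
  have hm' : (m : ℝ) ≠ 0 := by positivity
  have hi : ∀ j : Fin m, Integrable (fun ys : Fin m → Y => k (ys j)) (Measure.pi fun _ => τ) :=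
    fun j => integrable_of_continuous (k.continuous.comp (continuous_apply j)) _
  unfold avg mixed
  rw [integral_smul, integral_finsetSum _ fun j _ => hi j]
  have : ∀ j : Fin m, ∫ ys : Fin m → Y, k (ys j) ∂Measure.pi (fun _ => τ) = ∫ y, k y ∂τ :=
    fun j => integral_comp_eval (μ := fun _ : Fin m => τ) (i := j) (f := fun y => k y)
      k.continuous.aestronglyMeasurable
  simp only [this, Finset.sum_const, Finset.card_univ, Fintype.card_fin]
  rw [← Nat.cast_smul_eq_nsmul ℝ, smul_smul, inv_mul_cancel₀ hm', one_smul]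

variable [Nonempty X]

lemma measurable_mean (hη : 0 < η) :
    Measurable fun p : C(X, ℝ) × C(X, ℝ) => mean η p.1 p.2 := by
  have := isProbabilityMeasure_perturbLaw hη d
  have h1 : Measurable fun q : (C(X, ℝ) × C(X, ℝ)) × (Fin d → ℝ) => best q.1.1 q.2 := by
    have h0 : Measurable fun q : (C(X, ℝ) × C(X, ℝ)) × (Fin d → ℝ) => (q.1.1, q.2) := by fun_prop
    have h2 := Measurable.comp measurable_best h0
    exact h2
  have h3 : Measurable fun q : C(X, ℝ) × X => q.1 q.2 := continuous_eval.measurable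
  have h4 : Measurable fun q : (C(X, ℝ) × C(X, ℝ)) × (Fin d → ℝ) =>
      (q.1.2, best q.1.1 q.2) := (measurable_snd.comp measurable_fst).prodMk h1
  have h5 : Measurable fun q : (C(X, ℝ) × C(X, ℝ)) × (Fin d → ℝ) => q.1.2 (best q.1.1 q.2) :=
    Measurable.comp h3 h4
  exact h5.stronglyMeasurable.integral_prod_right.measurable

lemma measurable_drift (hη : 0 < η) :
    Measurable fun p : C(X, ℝ) × C(X, ℝ) => drift η p.1 p.2 := by
  have := isProbabilityMeasure_perturbLaw hη d
  have h0 : Measurable fun q : (C(X, ℝ) × C(X, ℝ)) × (Fin d → ℝ) => (q.1.1, q.2) := by fun_prop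
  have h1 : Measurable fun q : (C(X, ℝ) × C(X, ℝ)) × (Fin d → ℝ) => (q.1.2, q.2) := by fun_prop
  have h2 := Measurable.comp measurable_best h0
  have h3 := Measurable.comp measurable_best h1
  have h4 : Measurable fun q : (C(X, ℝ) × C(X, ℝ)) × (Fin d → ℝ) =>
      l1Dist (best q.1.1 q.2) (best q.1.2 q.2) :=
    measurable_l1Dist h2 h3
  exact h4.stronglyMeasurable.integral_prod_right.measurable

lemma abs_mean_le (hη : 0 < η) (h k : C(X, ℝ)) : |mean η h k| ≤ ‖k‖ := by
  have := isProbabilityMeasure_perturbLaw hη d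
  have := norm_integral_le_of_norm_le_const (μ := perturbLaw η d) (f := fun s => k (best h s))
    (ae_of_all _ fun s => k.norm_coe_le_norm _)
  simpa [mean] using this

/-- `mean η h` as a continuous linear functional. -/
noncomputable def meanCLM (hη : 0 < η) (h : C(X, ℝ)) : C(X, ℝ) →L[ℝ] ℝ :=
  LinearMap.mkContinuous
    { toFun := mean η h
      map_add' := fun a b => by
        unfold mean
        rw [← integral_add (integrable_comp_best hη _ _) (integrable_comp_best hη _ _)]
        rfl
      map_smul' := fun c a => by
        unfold mean
        rw [RingHom.id_apply, smul_eq_mul, ← integral_const_mul]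
        rfl }
    1 fun k => by rw [one_mul]; exact abs_mean_le hη h k

lemma integral_mean {α : Type*} [MeasurableSpace α] {ρ : Measure α} (hη : 0 < η) (h : C(X, ℝ))
    {φ : α → C(X, ℝ)} (hφ : Integrable φ ρ) :
    ∫ a, mean η h (φ a) ∂ρ = mean η h (∫ a, φ a ∂ρ) :=
  (meanCLM hη h).integral_comp_comm hφ

variable {D : ℝ} (hD : ∀ x x' : X, l1Dist x x' ≤ D)

include hD

lemma abs_mean_sub_mean_le (hη : 0 < η) {c : ℝ} {q : C(X, ℝ)}
    (hq : ∀ x x' : X, |q x - q x'| ≤ c * l1Dist x x') (h h' : C(X, ℝ)) :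
    |mean η h q - mean η h' q| ≤ c * drift η h h' := by
  unfold mean drift
  rw [← integral_sub (integrable_comp_best hη _ _) (integrable_comp_best hη _ _),
    ← integral_const_mul, ← Real.norm_eq_abs]
  exact norm_integral_le_of_norm_le ((integrable_l1Dist_best hD hη h h').const_mul c)
    (ae_of_all _ fun s => hq _ _)

/-- The perturbed minimizer is stable: its drift is bounded by the Lipschitz constant of the
change of the loss. -/
lemma drift_le_of_lipschitz (hη : 0 < η) (hD0 : 0 < D) {c : ℝ} (hc : 0 ≤ c) {h h' : C(X, ℝ)}
    (hq : ∀ x x' : X, |(h' - h) x - (h' - h) x'| ≤ c * l1Dist x x') :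
    drift η h h' ≤ stabilityConst d D η / 2 * c := by
  have h1 := drift_sq_le hD hη hD0 h h'
  have h2 := drift_sq_le hD hη hD0 h' h
  rw [drift_comm h' h] at h2
  have h3 := bregman_add_bregman hη h h'
  have h4 := (le_abs_self _).trans (abs_mean_sub_mean_le hD hη hq h h')
  have hγ : 0 ≤ stabilityConst d D η := by unfold stabilityConst; positivity
  rcases (drift_nonneg (η := η) h h').eq_or_lt with h0 | h0
  · rw [← h0]; positivity
  have h5 : 2 * drift η h h' ^ 2 ≤ stabilityConst d D η * (c * drift η h h') :=
    calc _ ≤ stabilityConst d D η * (bregman η h' h + bregman η h h') := by linarith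
      _ ≤ _ := mul_le_mul_of_nonneg_left (by linarith) hγ
  nlinarith

end

/-! ### One round, for one player -/

section

variable {d : ℕ} {X Y : Set (Fin d → ℝ)} {η : ℝ}

lemma avg_swap_sub {m : ℕ} (k : C(Y, C(X, ℝ))) (z : Fin (m + 1) → Y) (j : Fin m) :
    (avg k fun i => z (Equiv.swap 0 j.succ i.succ)) - (avg k fun i => z i.succ) =
      (m : ℝ)⁻¹ • (k (z 0) - k (z j.succ)) := by
  unfold avg
  rw [← smul_sub, ← Finset.sum_sub_distrib, Finset.sum_eq_single j]
  · simp only [Equiv.swap_apply_right]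
  · intro i _ hij
    beta_reduce
    rw [Equiv.swap_apply_of_ne_of_ne (Fin.succ_ne_zero i)
      fun h => hij (Fin.succ_injective _ h), sub_self]
  · simp

lemma MixedLipschitz.lipschitz_sub {k : C(Y, C(X, ℝ))} {L D : ℝ} (hk : MixedLipschitz k L)
    (hL : 0 ≤ L) (hY : ∀ y y' : Y, l1Dist y y' ≤ D) (x x' : X) (y y' : Y) :
    |(k y - k y') x - (k y - k y') x'| ≤ L * D * l1Dist x x' := by
  refine (hk x x' y y').trans ?_
  have := mul_le_mul_of_nonneg_left (hY y y') (mul_nonneg hL (l1Dist_nonneg x x'))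
  linarith

/-- Averaging over an exchange of two points of an i.i.d. sample. -/
lemma integral_le_of_add_swap_le {Z : Type*} [MeasurableSpace Z] {n : ℕ} {τ : Measure Z}
    [IsProbabilityMeasure τ] (a b : Fin n) {Θ : (Fin n → Z) → ℝ} {N : ℝ}
    (hi : Integrable Θ (Measure.pi fun _ => τ))
    (hN : ∀ z, Θ z + Θ (fun i => z (Equiv.swap a b i)) ≤ 2 * N) :
    ∫ z, Θ z ∂Measure.pi (fun _ => τ) ≤ N := by
  have hmp := measurePreserving_piCongrLeft (fun _ : Fin n => τ) (Equiv.swap a b)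
  have hswap : ∀ z : Fin n → Z, MeasurableEquiv.piCongrLeft (fun _ => Z) (Equiv.swap a b) z =
      fun i => z (Equiv.swap a b i) := by
    intro z
    ext i
    have := Equiv.piCongrLeft_apply_apply (fun _ : Fin n => Z) (Equiv.swap a b) z
      (Equiv.swap a b i)
    rw [Equiv.swap_apply_self] at this
    exact this
  have hi' := (hmp.integrable_comp_emb (MeasurableEquiv.measurableEmbedding _)).2 hi
  have h1 := integral_add hi hi'
  have h2 := integral_mono (hi.add hi') (integrable_const (2 * N)) fun z => by
    simp only [Pi.add_apply, Function.comp_apply, hswap]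
    exact hN z
  have h3 := hmp.integral_comp' Θ
  simp only [Pi.add_apply, Function.comp_apply] at h1 h2
  rw [h1, h3] at h2
  simp only [integral_const, probReal_univ, one_smul] at h2
  linarith

variable [CompactSpace X] [CompactSpace Y] [Nonempty X]

lemma measurable_mean_comp (hη : 0 < η) {α : Type*} [MeasurableSpace α]
    {h q : α → C(X, ℝ)} (hh : Measurable h) (hq : Measurable q) :
    Measurable fun a => mean η (h a) (q a) := by
  have := Measurable.comp (measurable_mean (X := X) hη) (hh.prodMk hq)
  exact this

omit [CompactSpace Y] in
/-- Replacing one point of the sample (by the fresh point `z 0`) has a small effect on the perturbed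
minimizer. -/
lemma mean_add_mean_swap_le (hη : 0 < η) {D L : ℝ} (hD0 : 0 < D) (hL : 0 ≤ L)
    (hX : ∀ x x' : X, l1Dist x x' ≤ D) (hY : ∀ y y' : Y, l1Dist y y' ≤ D)
    {k : C(Y, C(X, ℝ))} (hk : MixedLipschitz k L) {m : ℕ} (hm : 0 < m) (F : C(X, ℝ))
    (z : Fin (m + 1) → Y) (j : Fin m) :
    mean η (F + avg k fun i => z i.succ) (k (z 0) - k (z j.succ)) +
      mean η (F + avg k fun i : Fin m => z (Equiv.swap 0 j.succ i.succ))
        (k (z j.succ) - k (z 0)) ≤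
      2 * (stabilityConst d D η * L ^ 2 * D ^ 2 / (4 * m)) := by
  have hm' : (0 : ℝ) < m := by exact_mod_cast hm
  set h1 := F + avg k fun i => z i.succ with hh1
  set h2 := F + avg k fun i : Fin m => z (Equiv.swap 0 j.succ i.succ) with hh2
  have hq := hk.lipschitz_sub hL hY
  have hdiff : h2 - h1 = (m : ℝ)⁻¹ • (k (z 0) - k (z j.succ)) := by
    rw [hh1, hh2, add_sub_add_left_eq_sub, avg_swap_sub]
  have hdr : drift η h1 h2 ≤ stabilityConst d D η / 2 * ((m : ℝ)⁻¹ * (L * D)) := by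
    refine drift_le_of_lipschitz hX hη hD0 (by positivity) fun x x' => ?_
    rw [hdiff]
    simp only [ContinuousMap.smul_apply, smul_eq_mul]
    rw [← mul_sub, abs_mul, abs_of_pos (inv_pos.2 hm'), mul_assoc]
    exact mul_le_mul_of_nonneg_left (hq x x' (z 0) (z j.succ)) (inv_pos.2 hm').le
  have h3 := (le_abs_self _).trans
    (abs_mean_sub_mean_le hX hη (fun x x' => hq x x' (z 0) (z j.succ)) h1 h2)
  have h4 : mean η h2 (k (z j.succ) - k (z 0)) = -mean η h2 (k (z 0) - k (z j.succ)) := by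
    rw [mean_sub hη, mean_sub hη]
    ring
  rw [h4, ← sub_eq_add_neg]
  calc _ ≤ L * D * drift η h1 h2 := h3
    _ ≤ L * D * (stabilityConst d D η / 2 * ((m : ℝ)⁻¹ * (L * D))) :=
        mul_le_mul_of_nonneg_left hdr (by positivity)
    _ = 2 * (stabilityConst d D η * L ^ 2 * D ^ 2 / (4 * m)) := by field_simp; ring

lemma mean_mixed_sub_avg (hη : 0 < η) (k : C(Y, C(X, ℝ))) {m : ℕ} (hm : 0 < m) (h : C(X, ℝ))
    (τ : Measure Y) [IsProbabilityMeasure τ] (ys : Fin m → Y) :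
    mean η h (mixed k τ - avg k ys) =
      ∫ y, (m : ℝ)⁻¹ * ∑ j, mean η h (k y - k (ys j)) ∂τ := by
  have hm' : (m : ℝ) ≠ 0 := by positivity
  have hki : ∀ c : C(X, ℝ), Integrable (fun y => k y - c) τ := fun c =>
    (integrable_of_continuous k.continuous τ).sub (integrable_const c)
  have hmi : ∀ c : C(X, ℝ), Integrable (fun y => mean η h (k y - c)) τ := fun c =>
    (meanCLM hη h).integrable_comp (hki c)
  rw [integral_const_mul, integral_finsetSum _ fun j _ => hmi _]
  have h1 : ∀ j, ∫ y, mean η h (k y - k (ys j)) ∂τ = meanCLM hη h (mixed k τ - k (ys j)) := by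
    intro j
    rw [integral_mean hη _ (hki _), integral_sub (integrable_of_continuous k.continuous τ)
      (integrable_const _)]
    simp only [integral_const, probReal_univ, one_smul]
    rfl
  simp only [h1]
  rw [← map_sum, ← smul_eq_mul, ← map_smul, Finset.sum_sub_distrib]
  have h2 : (m : ℝ)⁻¹ • (∑ j : Fin m, mixed k τ - ∑ j, k (ys j)) = mixed k τ - avg k ys := by
    rw [smul_sub]
    simp only [Finset.sum_const, Finset.card_univ, Fintype.card_fin]
    rw [← Nat.cast_smul_eq_nsmul ℝ, smul_smul, inv_mul_cancel₀ hm', one_smul]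
    rfl
  rw [h2]
  rfl

/-- The empirical loss generalizes: on average over the sample, the perturbed minimizer of
`F + avg k ys` does not do much better on the sample than on the population. By exchangeability the
difference is the effect of replacing one point of the sample, which stability controls. -/
lemma integral_mean_mixed_sub_avg_le (hη : 0 < η) {D L : ℝ} (hD0 : 0 < D) (hL : 0 ≤ L)
    (hX : ∀ x x' : X, l1Dist x x' ≤ D) (hY : ∀ y y' : Y, l1Dist y y' ≤ D)
    {k : C(Y, C(X, ℝ))} (hk : MixedLipschitz k L) {m : ℕ} (hm : 0 < m) (F : C(X, ℝ))
    (τ : Measure Y) [IsProbabilityMeasure τ] :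
    ∫ ys : Fin m → Y, mean η (F + avg k ys) (mixed k τ - avg k ys) ∂Measure.pi (fun _ => τ) ≤
      stabilityConst d D η * L ^ 2 * D ^ 2 / (4 * m) := by
  have hm' : (0 : ℝ) < m := by exact_mod_cast hm
  set N := stabilityConst d D η * L ^ 2 * D ^ 2 / (4 * m) with hN
  have hA : Measurable (avg k : (Fin m → Y) → C(X, ℝ)) := (continuous_avg k).measurable
  have htail : Measurable fun z : Fin (m + 1) → Y => (fun i : Fin m => z i.succ) := by fun_prop
  -- `z 0` is a fresh point, the other coordinates of `z` are the sample
  set Θ : Fin m → (Fin (m + 1) → Y) → ℝ := fun j z =>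
    mean η (F + avg k fun i => z i.succ) (k (z 0) - k (z j.succ)) with hΘ
  have hΘm : ∀ j, Measurable (Θ j) := fun j => by
    refine measurable_mean_comp hη (measurable_const.add (hA.comp htail)) ?_
    exact (k.continuous.measurable.comp (measurable_pi_apply 0)).sub
      (k.continuous.measurable.comp (measurable_pi_apply j.succ))
  have hΘb : ∀ j z, ‖Θ j z‖ ≤ 2 * ‖k‖ := fun j z => by
    refine (abs_mean_le hη _ _).trans ((norm_sub_le _ _).trans ?_)
    linarith [k.norm_coe_le_norm (z 0), k.norm_coe_le_norm (z j.succ)]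
  have hΘi : ∀ j, Integrable (Θ j) (Measure.pi fun _ => τ) := fun j =>
    Integrable.of_bound (hΘm j).aestronglyMeasurable _ (ae_of_all _ (hΘb j))
  have hΘN : ∀ j, ∫ z, Θ j z ∂Measure.pi (fun _ => τ) ≤ N := by
    intro j
    refine integral_le_of_add_swap_le 0 j.succ (hΘi j) fun z => ?_
    have := mean_add_mean_swap_le hη hD0 hL hX hY hk hm F z j
    simp only [hΘ]
    rwa [Equiv.swap_apply_left, Equiv.swap_apply_right]
  -- integrate the fresh point first
  have hmp := measurePreserving_piFinSuccAbove (fun _ : Fin (m + 1) => τ) 0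
  set Ψ : Y × (Fin m → Y) → ℝ := fun p =>
    (m : ℝ)⁻¹ * ∑ j, mean η (F + avg k p.2) (k p.1 - k (p.2 j)) with hΨ
  have hΨi : Integrable Ψ (τ.prod (Measure.pi fun _ => τ)) := by
    rw [← hmp.integrable_comp_emb (MeasurableEquiv.measurableEmbedding _)]
    exact (integrable_finsetSum _ fun j _ => hΘi j).const_mul _
  have h1 : ∫ ys : Fin m → Y, mean η (F + avg k ys) (mixed k τ - avg k ys)
      ∂Measure.pi (fun _ => τ) = ∫ p, Ψ p ∂(τ.prod (Measure.pi fun _ => τ)) := by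
    rw [integral_prod_symm _ hΨi]
    exact integral_congr_ae (ae_of_all _ fun ys => mean_mixed_sub_avg hη k hm (F + avg k ys) τ ys)
  rw [h1, ← hmp.integral_comp (MeasurableEquiv.measurableEmbedding _)]
  have h2 : ∫ z, (m : ℝ)⁻¹ * ∑ j, Θ j z ∂Measure.pi (fun _ => τ) ≤ N := by
    rw [integral_const_mul, integral_finsetSum _ fun j _ => hΘi j, inv_mul_le_iff₀ hm']
    calc _ ≤ ∑ j : Fin m, N := Finset.sum_le_sum fun j _ => hΘN j
      _ = _ := by simp
  exact h2

end

section

variable {d : ℕ} {X Y : Set (Fin d → ℝ)} {η : ℝ}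

lemma stabilityConst_pos (hd : 0 < d) (hη : 0 < η) {D : ℝ} (hD0 : 0 < D) :
    0 < stabilityConst d D η := by
  have : (0 : ℝ) < d := by exact_mod_cast hd
  unfold stabilityConst
  positivity

variable [CompactSpace X] [CompactSpace Y] [Nonempty X]

/-- The increase of the potential when the loss `F` is replaced by `F + b`, compared with the loss
that is suffered by the perturbed minimizer of `F + a`, where `a` is the guess for `b`. Here `P` and
`P'` are thought of as the means of `a` and of `b`. The last three terms are sampling errors. -/
lemma le_potential_add_sub (hd : 0 < d) (hη : 0 < η) {D l : ℝ} (hD0 : 0 < D)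
    (hX : ∀ x x' : X, l1Dist x x' ≤ D) (F a b P P' : C(X, ℝ))
    (hl : ∀ x x' : X, |(P' - P) x - (P' - P) x'| ≤ l * l1Dist x x') :
    mean η (F + a) P' + drift η F (F + a) ^ 2 / stabilityConst d D η
        - stabilityConst d D η / 4 * l ^ 2
        - mean η (F + a) (P - a) - mean η (F + b) (P' - b) + mean η (F + b) (P - a) ≤
      potential η (F + b) - potential η F := by
  have hγ := stabilityConst_pos hd hη hD0
  set γ := stabilityConst d D η
  have h1 : drift η (F + a) F ^ 2 / γ ≤ bregman η F (F + a) := by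
    rw [div_le_iff₀ hγ, mul_comm]
    exact drift_sq_le hX hη hD0 _ _
  have h2 : drift η (F + b) (F + a) ^ 2 / γ ≤ bregman η (F + a) (F + b) := by
    rw [div_le_iff₀ hγ, mul_comm]
    exact drift_sq_le hX hη hD0 _ _
  rw [drift_comm] at h1
  have h3 : bregman η F (F + a) =
      potential η (F + a) - mean η (F + a) a - potential η F := by
    unfold bregman
    rw [show F - (F + a) = 0 - a by abel, mean_sub hη, show mean η (F + a) 0 = 0 by simp [mean]]
    ring
  have h4 : bregman η (F + a) (F + b) =
      potential η (F + b) + mean η (F + b) a - mean η (F + b) b - potential η (F + a) := by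
    unfold bregman
    rw [add_sub_add_left_eq_sub, mean_sub hη]
    ring
  have h5 := (abs_le.1 (abs_mean_sub_mean_le hX hη hl (F + b) (F + a))).1
  -- the drift that the change from `P` to `P'` costs is paid for by the Bregman divergence
  have h6 : l * drift η (F + b) (F + a) ≤
      drift η (F + b) (F + a) ^ 2 / γ + γ / 4 * l ^ 2 := by
    have h7 : drift η (F + b) (F + a) ^ 2 / γ + γ / 4 * l ^ 2
        - l * drift η (F + b) (F + a) =
        (drift η (F + b) (F + a) - γ / 2 * l) ^ 2 / γ := by
      field_simp
      ring
    have : 0 ≤ (drift η (F + b) (F + a) - γ / 2 * l) ^ 2 / γ := by positivity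
    linarith
  simp only [mean_sub hη] at h5 ⊢
  linarith

/-- One round for one player: `τ` is the law of the points of the guess, `τ'` the law of the points
that the opponent plays. The square of the movement caused by the guess is gained, and the square of
the change from `τ` to `τ'` is lost. -/
lemma le_integral_potential_sub (hd : 0 < d) (hη : 0 < η) {D L l : ℝ} (hD0 : 0 < D) (hL : 0 ≤ L)
    (hX : ∀ x x' : X, l1Dist x x' ≤ D) (hY : ∀ y y' : Y, l1Dist y y' ≤ D)
    {k : C(Y, C(X, ℝ))} (hk : MixedLipschitz k L) {m : ℕ} (hm : 0 < m) (F : C(X, ℝ))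
    (τ τ' : Measure Y) [IsProbabilityMeasure τ] [IsProbabilityMeasure τ']
    (hl : ∀ x x' : X, |(mixed k τ' - mixed k τ) x - (mixed k τ' - mixed k τ) x'| ≤
      l * l1Dist x x') :
    ∫ ys : Fin m → Y, (mean η (F + avg k ys) (mixed k τ') +
        drift η F (F + avg k ys) ^ 2 / stabilityConst d D η) ∂Measure.pi (fun _ => τ)
      - stabilityConst d D η / 4 * l ^ 2
      - 2 * (stabilityConst d D η * L ^ 2 * D ^ 2 / (4 * m)) ≤
    ∫ ys : Fin m → Y, (potential η (F + avg k ys) - potential η F)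
      ∂Measure.pi (fun _ => τ') := by
  set γ := stabilityConst d D η with hγ
  set N := γ * L ^ 2 * D ^ 2 / (4 * m) with hN
  have hA : Measurable (avg k : (Fin m → Y) → C(X, ℝ)) := (continuous_avg k).measurable
  have hAi : ∀ σ : Measure Y, IsProbabilityMeasure σ → Integrable (avg k : (Fin m → Y) → C(X, ℝ))
      (Measure.pi fun _ => σ) := fun σ _ => integrable_of_continuous (continuous_avg k) _
  have hFA : Measurable fun ys : Fin m → Y => F + avg k ys := measurable_const.add hA
  have hbd : ∀ (c : C(X, ℝ)) (ys : Fin m → Y), ‖c - avg k ys‖ ≤ ‖c‖ + ‖k‖ := fun c ys =>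
    (norm_sub_le _ _).trans (by linarith [norm_avg_le k ys])
  have hG : ∀ (c : C(X, ℝ)) (σ : Measure Y), IsProbabilityMeasure σ →
      Integrable (fun ys : Fin m → Y => mean η (F + avg k ys) (c - avg k ys))
        (Measure.pi fun _ => σ) := fun c σ _ =>
    Integrable.of_bound
      (measurable_mean_comp hη hFA (measurable_const.sub hA)).aestronglyMeasurable
      (‖c‖ + ‖k‖) (ae_of_all _ fun ys => (abs_mean_le hη _ _).trans (hbd c ys))
  have hM : Integrable (fun ys : Fin m → Y => mean η (F + avg k ys) (mixed k τ'))
      (Measure.pi fun _ => τ) :=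
    Integrable.of_bound (measurable_mean_comp hη hFA measurable_const).aestronglyMeasurable
      ‖mixed k τ'‖ (ae_of_all _ fun ys => abs_mean_le hη _ _)
  have hDr : Integrable (fun ys : Fin m → Y => drift η F (F + avg k ys) ^ 2 / γ)
      (Measure.pi fun _ => τ) := by
    have h1 := (measurable_drift (X := X) hη).comp ((measurable_const (a := F)).prodMk hFA)
    refine Integrable.of_bound ((h1.pow_const 2).div_const γ).aestronglyMeasurable
      (D ^ 2 / γ) (ae_of_all _ fun ys => ?_)
    have h0 := drift_nonneg (η := η) F (F + avg k ys)
    have h3 := drift_le_diam hX hη F (F + avg k ys)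
    have hγ0 : 0 < γ := stabilityConst_pos hd hη hD0
    rw [Real.norm_eq_abs, abs_of_nonneg (by positivity)]
    gcongr
  have hPot : Integrable (fun ys : Fin m → Y => potential η (F + avg k ys) - potential η F)
      (Measure.pi fun _ => τ') :=
    integrable_of_continuous (((continuous_potential hη).comp
      (continuous_const.add (continuous_avg k))).sub continuous_const) _
  -- for a fixed sample of played points, average over the sample of the guess
  have h1 : ∀ zs : Fin m → Y,
      ∫ ys : Fin m → Y, (mean η (F + avg k ys) (mixed k τ') + drift η F (F + avg k ys) ^ 2 / γ)
        ∂Measure.pi (fun _ => τ) - γ / 4 * l ^ 2 - N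
        - mean η (F + avg k zs) (mixed k τ' - avg k zs) ≤
      potential η (F + avg k zs) - potential η F := by
    intro zs
    have hC : Integrable (fun ys : Fin m → Y => mean η (F + avg k zs) (mixed k τ - avg k ys))
        (Measure.pi fun _ => τ) :=
      Integrable.of_bound
        (measurable_mean_comp hη measurable_const (measurable_const.sub hA)).aestronglyMeasurable
        (‖mixed k τ‖ + ‖k‖) (ae_of_all _ fun ys => (abs_mean_le hη _ _).trans (hbd _ ys))
    have hC0 : ∫ ys : Fin m → Y, mean η (F + avg k zs) (mixed k τ - avg k ys)
        ∂Measure.pi (fun _ => τ) = 0 := by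
      rw [integral_mean hη _ (φ := fun ys => mixed k τ - avg k ys)
          ((integrable_const _).sub (hAi τ inferInstance)),
        integral_sub (integrable_const _) (hAi τ inferInstance), integral_avg hm]
      simp [mean]
    have hle := integral_mean_mixed_sub_avg_le hη hD0 hL hX hY hk hm F τ
    have hmono := integral_mono
      (((((hM.add hDr).sub (integrable_const (γ / 4 * l ^ 2))).sub
        (hG (mixed k τ) τ inferInstance)).sub (integrable_const (mean η (F + avg k zs) (mixed k τ' - avg k zs)))).add hC)
      (integrable_const (potential η (F + avg k zs) - potential η F)) fun ys =>
        le_potential_add_sub hd hη hD0 hX F (avg k ys) (avg k zs) (mixed k τ) (mixed k τ') hl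
    rw [integral_add' ((((hM.add hDr).sub (integrable_const _)).sub (hG _ τ inferInstance)).sub
        (integrable_const _)) hC, integral_sub' (((hM.add hDr).sub (integrable_const _)).sub
        (hG _ τ inferInstance)) (integrable_const _), integral_sub' ((hM.add hDr).sub
        (integrable_const _)) (hG _ τ inferInstance), integral_sub' (hM.add hDr)
        (integrable_const _), hC0] at hmono
    simp only [integral_const, probReal_univ, one_smul, Pi.add_apply] at hmono
    linarith
  have hle := integral_mean_mixed_sub_avg_le hη hD0 hL hX hY hk hm F τ'
  have hmono := integral_mono ((integrable_const _).sub (hG (mixed k τ') τ' inferInstance)) hPot h1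
  rw [integral_sub' (integrable_const _) (hG _ τ' inferInstance)] at hmono
  simp only [integral_const, probReal_univ, one_smul] at hmono
  linarith

end

/-! ### One round, for both players -/

section

variable {d : ℕ} {X Y : Set (Fin d → ℝ)} {η : ℝ}

/-- The law of the perturbed minimizer of `h`. -/
noncomputable def bestLaw [Nonempty X] (η : ℝ) (h : C(X, ℝ)) : Measure X :=
  (perturbLaw η d).map (best h)

/-- The law of `m` independent perturbation vectors. -/
noncomputable def blockLaw (η : ℝ) (d m : ℕ) : Measure (Fin m → Fin d → ℝ) :=
  Measure.pi fun _ => perturbLaw η d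

lemma isProbabilityMeasure_blockLaw (hη : 0 < η) (d m : ℕ) :
    IsProbabilityMeasure (blockLaw η d m) := by
  have := isProbabilityMeasure_perturbLaw hη d
  unfold blockLaw
  infer_instance

/-- The perturbed minimizers of `h` for the perturbation vectors `r j`. -/
noncomputable def sample [Nonempty X] {m : ℕ} (h : C(X, ℝ)) (r : Fin m → Fin d → ℝ) : Fin m → X :=
  fun j => best h (r j)

variable [CompactSpace X] [CompactSpace Y] [Nonempty X] [Nonempty Y]

omit [CompactSpace Y] [Nonempty Y] in
lemma isProbabilityMeasure_bestLaw (hη : 0 < η) (h : C(X, ℝ)) :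
    IsProbabilityMeasure (bestLaw η h) := by
  have := isProbabilityMeasure_perturbLaw hη d
  exact Measure.isProbabilityMeasure_map (measurable_best_right h).aemeasurable

omit [CompactSpace Y] [Nonempty Y] in
lemma measurable_best_comp {α : Type*} [MeasurableSpace α] {h : α → C(X, ℝ)}
    {s : α → Fin d → ℝ} (hh : Measurable h) (hs : Measurable s) :
    Measurable fun a => best (h a) (s a) := by
  have h1 := Measurable.comp (measurable_best (X := X)) (hh.prodMk hs)
  exact h1

omit [CompactSpace Y] [Nonempty Y] in
lemma measurable_sample_comp {α : Type*} [MeasurableSpace α] {m : ℕ} {h : α → C(X, ℝ)}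
    {r : α → Fin m → Fin d → ℝ} (hh : Measurable h) (hr : Measurable r) :
    Measurable fun a => sample (h a) (r a) :=
  measurable_pi_iff.2 fun j => measurable_best_comp hh ((measurable_pi_apply j).comp hr)

omit [CompactSpace Y] [Nonempty Y] in
lemma map_sample (hη : 0 < η) {m : ℕ} (h : C(X, ℝ)) :
    (blockLaw η d m).map (sample h) = Measure.pi fun _ => bestLaw η h := by
  have := isProbabilityMeasure_perturbLaw hη d
  have := isProbabilityMeasure_bestLaw hη h
  exact Measure.pi_map_pi (f := fun _ : Fin m => best h)
    fun _ => (measurable_best_right h).aemeasurable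

omit [CompactSpace Y] [Nonempty Y] in
lemma integral_sample (hη : 0 < η) {m : ℕ} (h : C(X, ℝ)) {φ : (Fin m → X) → ℝ}
    (hφ : Measurable φ) :
    ∫ r, φ (sample h r) ∂blockLaw η d m = ∫ xs, φ xs ∂Measure.pi fun _ => bestLaw η h := by
  have hS : Measurable fun r : Fin m → Fin d → ℝ => sample h r :=
    measurable_sample_comp measurable_const measurable_id
  rw [← map_sample hη h]
  exact (integral_map hS.aemeasurable hφ.aestronglyMeasurable).symm

omit [Nonempty X] in
lemma mixed_bestLaw (k : C(Y, C(X, ℝ))) (g : C(Y, ℝ)) :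
    mixed k (bestLaw η g) = ∫ s, k (best g s) ∂perturbLaw η d :=
  integral_map (measurable_best_right g).aemeasurable k.continuous.aestronglyMeasurable

omit [Nonempty X] in
lemma integrable_response (hη : 0 < η) (k : C(Y, C(X, ℝ))) (g : C(Y, ℝ)) :
    Integrable (fun s => k (best g s)) (perturbLaw η d) := by
  have := isProbabilityMeasure_perturbLaw hη d
  exact Integrable.of_bound
    (k.continuous.measurable.comp (measurable_best_right g)).aestronglyMeasurable ‖k‖
    (ae_of_all _ fun s => k.norm_coe_le_norm _)

omit [Nonempty X] in
lemma norm_mixed_bestLaw_le (hη : 0 < η) (k : C(Y, C(X, ℝ))) (g : C(Y, ℝ)) :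
    ‖mixed k (bestLaw η g)‖ ≤ ‖k‖ := by
  have := isProbabilityMeasure_perturbLaw hη d
  rw [mixed_bestLaw]
  have := norm_integral_le_of_norm_le_const (μ := perturbLaw η d) (f := fun s => k (best g s))
    (ae_of_all _ fun s => k.norm_coe_le_norm _)
  simpa using this

omit [Nonempty X] in
lemma measurable_mixed_bestLaw (hη : 0 < η) (k : C(Y, C(X, ℝ))) :
    Measurable fun g : C(Y, ℝ) => mixed k (bestLaw η g) := by
  have := isProbabilityMeasure_perturbLaw hη d
  have h1 : Measurable fun q : C(Y, ℝ) × (Fin d → ℝ) => k (best q.1 q.2) :=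
    Measurable.comp k.continuous.measurable measurable_best
  simp only [mixed_bestLaw]
  exact h1.stronglyMeasurable.integral_prod_right.measurable

omit [Nonempty X] in
/-- The mixed second differences turn a drift of the opponent into a Lipschitz bound for the change
of the expected loss. -/
lemma MixedLipschitz.abs_mixed_sub_le (hη : 0 < η) {D L : ℝ} (hY : ∀ y y' : Y, l1Dist y y' ≤ D)
    {k : C(Y, C(X, ℝ))} (hk : MixedLipschitz k L) (g g' : C(Y, ℝ)) (x x' : X) :
    |(mixed k (bestLaw η g') - mixed k (bestLaw η g)) x -
      (mixed k (bestLaw η g') - mixed k (bestLaw η g)) x'| ≤ L * drift η g g' * l1Dist x x' := by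
  have h1 : ∀ z : X, (mixed k (bestLaw η g') - mixed k (bestLaw η g)) z =
      ∫ s, (k (best g' s) - k (best g s)) z ∂perturbLaw η d := by
    intro z
    rw [mixed_bestLaw, mixed_bestLaw, ← integral_sub (integrable_response hη k g')
      (integrable_response hη k g)]
    exact ((ContinuousMap.evalCLM ℝ z).integral_comp_comm
      ((integrable_response hη k g').sub (integrable_response hη k g))).symm
  have h2 : ∀ z : X, Integrable (fun s => (k (best g' s) - k (best g s)) z) (perturbLaw η d) :=
    fun z => (ContinuousMap.evalCLM ℝ z).integrable_comp
      ((integrable_response hη k g').sub (integrable_response hη k g))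
  rw [h1, h1, ← integral_sub (h2 x) (h2 x'), ← Real.norm_eq_abs]
  refine (norm_integral_le_of_norm_le ((integrable_l1Dist_best hY hη g g').const_mul
    (L * l1Dist x x')) (ae_of_all _ fun s => ?_)).trans (le_of_eq ?_)
  · rw [l1Dist_comm (best g s)]
    exact hk x x' (best g' s) (best g s)
  · rw [integral_const_mul]
    unfold drift
    ring

/-- The expected payoff of two independent perturbed minimizers, seen by either player. -/
lemma mean_mixed_bestLaw_eq_neg (hη : 0 < η) {k : C(Y, C(X, ℝ))} {k' : C(X, C(Y, ℝ))}
    (hkk : ∀ x y, k' x y = -k y x) (h : C(X, ℝ)) (g : C(Y, ℝ)) :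
    mean η g (mixed k' (bestLaw η h)) = -mean η h (mixed k (bestLaw η g)) := by
  have := isProbabilityMeasure_perturbLaw hη d
  have h1 : mean η h (mixed k (bestLaw η g)) =
      ∫ s', ∫ s, k (best g s') (best h s) ∂perturbLaw η d ∂perturbLaw η d := by
    rw [mixed_bestLaw, ← integral_mean hη h (integrable_response hη k g)]
    rfl
  have h2 : mean η g (mixed k' (bestLaw η h)) =
      ∫ s, ∫ s', -k (best g s') (best h s) ∂perturbLaw η d ∂perturbLaw η d := by
    rw [mixed_bestLaw, ← integral_mean hη g (integrable_response hη k' h)]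
    simp only [mean, hkk]
  have hi : Integrable (Function.uncurry fun s' s => k (best g s') (best h s))
      ((perturbLaw η d).prod (perturbLaw η d)) := by
    have h3 : Measurable fun q : (Fin d → ℝ) × (Fin d → ℝ) => k (best g q.1) :=
      k.continuous.measurable.comp ((measurable_best_right g).comp measurable_fst)
    have h4 : Measurable fun q : C(X, ℝ) × X => q.1 q.2 := continuous_eval.measurable
    have h5 := h4.comp (h3.prodMk ((measurable_best_right h).comp measurable_snd))
    exact Integrable.of_bound h5.aestronglyMeasurable ‖k‖ (ae_of_all _ fun q =>
      ((k (best g q.1)).norm_coe_le_norm _).trans (k.norm_coe_le_norm _))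
  rw [h1, h2, integral_integral_swap hi]
  simp only [integral_neg]

/-- The bound for one round in terms of the perturbations of this round, for an opponent who guesses
with the total loss `H` and plays with the total loss `H'`. -/
lemma le_integral_blockLaw (hd : 0 < d) (hη : 0 < η) {D L : ℝ} (hD0 : 0 < D) (hL : 0 ≤ L)
    (hX : ∀ x x' : X, l1Dist x x' ≤ D) (hY : ∀ y y' : Y, l1Dist y y' ≤ D)
    {k : C(Y, C(X, ℝ))} (hk : MixedLipschitz k L)
    {m : ℕ} (hm : 0 < m) (F : C(X, ℝ)) (H H' : C(Y, ℝ)) :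
    ∫ r : Fin m → Fin d → ℝ, mean η (F + avg k (sample H r)) (mixed k (bestLaw η H'))
        ∂blockLaw η d m
      + (∫ r : Fin m → Fin d → ℝ, drift η F (F + avg k (sample H r)) ^ 2 ∂blockLaw η d m)
        / stabilityConst d D η
      - stabilityConst d D η / 4 * (L * drift η H H') ^ 2
      - 2 * (stabilityConst d D η * L ^ 2 * D ^ 2 / (4 * m)) ≤
    ∫ r : Fin m → Fin d → ℝ, (potential η (F + avg k (sample H' r)) - potential η F)
      ∂blockLaw η d m := by
  have := isProbabilityMeasure_bestLaw hη H
  have := isProbabilityMeasure_bestLaw hη H'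
  have := isProbabilityMeasure_blockLaw hη d m
  have key := le_integral_potential_sub hd hη hD0 hL hX hY hk hm F (bestLaw η H) (bestLaw η H')
    fun x x' => hk.abs_mixed_sub_le hη hY H H' x x'
  have hA : Measurable (avg k : (Fin m → Y) → C(X, ℝ)) := (continuous_avg k).measurable
  have hFA : Measurable fun ys : Fin m → Y => F + avg k ys := measurable_const.add hA
  have hP : Measurable fun ys : Fin m → Y => potential η (F + avg k ys) - potential η F :=
    ((continuous_potential hη).measurable.comp hFA).sub_const _
  have hM : Measurable fun ys : Fin m → Y => mean η (F + avg k ys) (mixed k (bestLaw η H')) :=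
    measurable_mean_comp hη hFA measurable_const
  have hDr : Measurable fun ys : Fin m → Y => drift η F (F + avg k ys) ^ 2 :=
    ((measurable_drift (X := X) hη).comp ((measurable_const (a := F)).prodMk hFA)).pow_const 2
  have hS : Measurable fun r : Fin m → Fin d → ℝ => sample H r :=
    measurable_sample_comp measurable_const measurable_id
  have e1 := integral_sample hη H (φ := fun ys : Fin m → Y =>
    mean η (F + avg k ys) (mixed k (bestLaw η H')) +
      drift η F (F + avg k ys) ^ 2 / stabilityConst d D η) (hM.add (hDr.div_const _))
  have e2 := integral_sample hη H' (φ := fun ys : Fin m → Y =>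
    potential η (F + avg k ys) - potential η F) hP
  rw [← e1, ← e2, integral_add, integral_div] at key
  · exact key
  · exact Integrable.of_bound (hM.comp hS).aestronglyMeasurable ‖mixed k (bestLaw η H')‖
      (ae_of_all _ fun ys => abs_mean_le hη _ _)
  · refine Integrable.of_bound ((hDr.div_const _).comp hS).aestronglyMeasurable
      (D ^ 2 / stabilityConst d D η) (ae_of_all _ fun r => ?_)
    have hγ := stabilityConst_pos hd hη hD0
    have h0 := drift_nonneg (η := η) F (F + avg k (sample H r))
    have h3 := drift_le_diam hX hη F (F + avg k (sample H r))
    rw [Real.norm_eq_abs, abs_of_nonneg (by positivity)]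
    gcongr

/-- The increase of the potential of the first player in one round. Here `a` is the perturbation of
the points of the first player that the opponent's guess is made of, and `e` is the perturbation of
the points that the opponent plays; `w` is the weight of the guess. -/
noncomputable def gain {m : ℕ} (η : ℝ) (k : C(Y, C(X, ℝ))) (k' : C(X, C(Y, ℝ))) (w : ℝ)
    (F : C(X, ℝ)) (H : C(Y, ℝ)) (a e : Fin m → Fin d → ℝ) : ℝ :=
  potential η (F + avg k (sample (H + w • avg k' (sample F a)) e)) - potential η F

lemma abs_gain_le (hη : 0 < η) {m : ℕ} (k : C(Y, C(X, ℝ))) (k' : C(X, C(Y, ℝ))) (w : ℝ)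
    (F : C(X, ℝ)) (H : C(Y, ℝ)) (a e : Fin m → Fin d → ℝ) :
    |gain η k k' w F H a e| ≤ ‖k‖ := by
  refine (abs_potential_sub_le hη _ _).trans ?_
  rw [add_sub_cancel_left]
  exact norm_avg_le _ _

/-- The loss of a round as a function of the state at its beginning and its perturbations. -/
lemma measurable_response {m : ℕ} (k : C(Y, C(X, ℝ))) (k' : C(X, C(Y, ℝ))) (w : ℝ) :
    Measurable fun q : (C(X, ℝ) × C(Y, ℝ)) × (Fin m → Fin d → ℝ) × (Fin m → Fin d → ℝ) =>
      avg k (sample (q.1.2 + w • avg k' (sample q.1.1 q.2.1)) q.2.2) := by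
  have hF : Measurable fun q : (C(X, ℝ) × C(Y, ℝ)) × (Fin m → Fin d → ℝ) × (Fin m → Fin d → ℝ) =>
    q.1.1 := measurable_fst.comp measurable_fst
  have hH : Measurable fun q : (C(X, ℝ) × C(Y, ℝ)) × (Fin m → Fin d → ℝ) × (Fin m → Fin d → ℝ) =>
    q.1.2 := measurable_snd.comp measurable_fst
  have ha : Measurable fun q : (C(X, ℝ) × C(Y, ℝ)) × (Fin m → Fin d → ℝ) × (Fin m → Fin d → ℝ) =>
    q.2.1 := measurable_fst.comp measurable_snd
  have he : Measurable fun q : (C(X, ℝ) × C(Y, ℝ)) × (Fin m → Fin d → ℝ) × (Fin m → Fin d → ℝ) =>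
    q.2.2 := measurable_snd.comp measurable_snd
  have h1 := Measurable.comp (continuous_avg k' (m := m)).measurable (measurable_sample_comp hF ha)
  have h2 := hH.add (h1.const_smul w)
  have h3 := Measurable.comp (continuous_avg k (m := m)).measurable (measurable_sample_comp h2 he)
  exact h3

lemma measurable_gain (hη : 0 < η) {m : ℕ} (k : C(Y, C(X, ℝ))) (k' : C(X, C(Y, ℝ))) (w : ℝ) :
    Measurable fun q : (C(X, ℝ) × C(Y, ℝ)) × (Fin m → Fin d → ℝ) × (Fin m → Fin d → ℝ) =>
      gain η k k' w q.1.1 q.1.2 q.2.1 q.2.2 := by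
  have hF : Measurable fun q : (C(X, ℝ) × C(Y, ℝ)) × (Fin m → Fin d → ℝ) × (Fin m → Fin d → ℝ) =>
    q.1.1 := measurable_fst.comp measurable_fst
  have h4 := Measurable.comp (continuous_potential (X := X) hη).measurable
    (hF.add (measurable_response k k' w))
  have h5 := Measurable.comp (continuous_potential (X := X) hη).measurable hF
  exact h4.sub h5

lemma integrable_gain (hη : 0 < η) {m : ℕ} (k : C(Y, C(X, ℝ))) (k' : C(X, C(Y, ℝ))) (w : ℝ)
    (F : C(X, ℝ)) (H : C(Y, ℝ)) :
    Integrable (fun q : (Fin m → Fin d → ℝ) × (Fin m → Fin d → ℝ) =>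
      gain η k k' w F H q.1 q.2) ((blockLaw η d m).prod (blockLaw η d m)) := by
  have := isProbabilityMeasure_blockLaw hη d m
  have h := Measurable.comp (measurable_gain hη (m := m) k k' w)
    ((measurable_const (a := (F, H))).prodMk measurable_id)
  exact Integrable.of_bound h.aestronglyMeasurable ‖k‖
    (ae_of_all _ fun q => abs_gain_le hη k k' w F H q.1 q.2)

lemma integrable_payoff (hη : 0 < η) {m : ℕ} (k : C(Y, C(X, ℝ))) (k' : C(X, C(Y, ℝ)))
    (F : C(X, ℝ)) (H : C(Y, ℝ)) :
    Integrable (fun q : (Fin m → Fin d → ℝ) × (Fin m → Fin d → ℝ) =>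
      mean η (F + avg k (sample H q.2)) (mixed k (bestLaw η (H + avg k' (sample F q.1)))))
      ((blockLaw η d m).prod (blockLaw η d m)) := by
  have := isProbabilityMeasure_blockLaw hη d m
  have ha : Measurable fun q : (Fin m → Fin d → ℝ) × (Fin m → Fin d → ℝ) =>
      H + avg k' (sample F q.1) := by
    have h1 := Measurable.comp (continuous_avg k' (m := m)).measurable
      (measurable_sample_comp (measurable_const (a := F))
        (measurable_fst (α := Fin m → Fin d → ℝ) (β := Fin m → Fin d → ℝ)))
    exact measurable_const.add h1
  have hr : Measurable fun q : (Fin m → Fin d → ℝ) × (Fin m → Fin d → ℝ) =>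
      F + avg k (sample H q.2) := by
    have h1 := Measurable.comp (continuous_avg k (m := m)).measurable
      (measurable_sample_comp (measurable_const (a := H))
        (measurable_snd (α := Fin m → Fin d → ℝ) (β := Fin m → Fin d → ℝ)))
    exact measurable_const.add h1
  have h2 := Measurable.comp (measurable_mixed_bestLaw hη k) ha
  have h3 := measurable_mean_comp hη hr h2
  exact Integrable.of_bound h3.aestronglyMeasurable ‖k‖ (ae_of_all _ fun q =>
    (abs_mean_le hη _ _).trans (norm_mixed_bestLaw_le hη k _))

lemma integrable_drift_sq (hη : 0 < η) {D : ℝ} (hX : ∀ x x' : X, l1Dist x x' ≤ D) {m : ℕ}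
    (k : C(Y, C(X, ℝ))) (F : C(X, ℝ)) (H : C(Y, ℝ)) :
    Integrable (fun r : Fin m → Fin d → ℝ => drift η F (F + avg k (sample H r)) ^ 2)
      (blockLaw η d m) := by
  have := isProbabilityMeasure_blockLaw hη d m
  have h1 := Measurable.comp (continuous_avg k (m := m)).measurable
    (measurable_sample_comp (measurable_const (a := H))
      (measurable_id (α := Fin m → Fin d → ℝ)))
  have h2 : Measurable fun r : Fin m → Fin d → ℝ => (F, F + avg k (sample H r)) :=
    measurable_const.prodMk (measurable_const.add h1)
  have h3 := Measurable.comp (measurable_drift (X := X) hη) h2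
  refine Integrable.of_bound (h3.pow_const 2).aestronglyMeasurable (D ^ 2)
    (ae_of_all _ fun r => ?_)
  have h4 := drift_nonneg (η := η) F (F + avg k (sample H r))
  have h5 := drift_le_diam hX hη F (F + avg k (sample H r))
  rw [Real.norm_eq_abs]
  change |drift η F (F + avg k (sample H r)) ^ 2| ≤ D ^ 2
  rw [abs_of_nonneg (sq_nonneg _)]
  gcongr

/-- The bound for one round with guesses, for one player. -/
lemma le_integral_gain (hd : 0 < d) (hη : 0 < η) {D L : ℝ} (hD0 : 0 < D) (hL : 0 ≤ L)
    (hX : ∀ x x' : X, l1Dist x x' ≤ D) (hY : ∀ y y' : Y, l1Dist y y' ≤ D)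
    {k : C(Y, C(X, ℝ))} (hk : MixedLipschitz k L) (k' : C(X, C(Y, ℝ)))
    {m : ℕ} (hm : 0 < m) (F : C(X, ℝ)) (H : C(Y, ℝ)) :
    ∫ a : Fin m → Fin d → ℝ, ∫ r : Fin m → Fin d → ℝ,
        mean η (F + avg k (sample H r)) (mixed k (bestLaw η (H + avg k' (sample F a))))
        ∂blockLaw η d m ∂blockLaw η d m
      + (∫ r : Fin m → Fin d → ℝ, drift η F (F + avg k (sample H r)) ^ 2 ∂blockLaw η d m)
        / stabilityConst d D η
      - stabilityConst d D η / 4 * L ^ 2 *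
        (∫ a : Fin m → Fin d → ℝ, drift η H (H + avg k' (sample F a)) ^ 2 ∂blockLaw η d m)
      - 2 * (stabilityConst d D η * L ^ 2 * D ^ 2 / (4 * m)) ≤
    ∫ q : (Fin m → Fin d → ℝ) × (Fin m → Fin d → ℝ), gain η k k' 1 F H q.1 q.2
      ∂(blockLaw η d m).prod (blockLaw η d m) := by
  have := isProbabilityMeasure_blockLaw hη d m
  rw [integral_prod _ (integrable_gain hη k k' 1 F H)]
  have i1 := (integrable_payoff hη (m := m) k k' F H).integral_prod_left
  have i2 := integrable_drift_sq hη hY (m := m) k' H F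
  have i3 := (integrable_gain hη (m := m) k k' 1 F H).integral_prod_left
  have key := integral_mono (((i1.add (integrable_const
    ((∫ r : Fin m → Fin d → ℝ, drift η F (F + avg k (sample H r)) ^ 2 ∂blockLaw η d m)
        / stabilityConst d D η))).sub (i2.const_mul (stabilityConst d D η / 4 * L ^ 2))).sub
    (integrable_const (2 * (stabilityConst d D η * L ^ 2 * D ^ 2 / (4 * m))))) i3 fun a => by
      have h := le_integral_blockLaw hd hη hD0 hL hX hY hk hm F H (H + avg k' (sample F a))
      simp only [gain, one_smul, Pi.add_apply, Pi.sub_apply]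
      rw [mul_pow, ← mul_assoc] at h
      exact h
  rw [integral_sub' ((i1.add (integrable_const _)).sub (i2.const_mul _)) (integrable_const _),
    integral_sub' (i1.add (integrable_const _)) (i2.const_mul _),
    integral_add' i1 (integrable_const _), integral_const_mul] at key
  simpa only [integral_const, probReal_univ, one_smul] using key

/-- In a round in which both players use their guesses the potentials decrease at most by the
sampling errors. The payoffs of the players cancel, and what each player loses through the movement
of the opponent is gained by the opponent. -/
lemma le_integral_gain_add (hd : 0 < d) (hη : 0 < η) {D L : ℝ} (hD0 : 0 < D) (hL : 0 ≤ L)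
    (hγ : stabilityConst d D η * L ≤ 2)
    (hX : ∀ x x' : X, l1Dist x x' ≤ D) (hY : ∀ y y' : Y, l1Dist y y' ≤ D)
    {k : C(Y, C(X, ℝ))} (hk : MixedLipschitz k L) {k' : C(X, C(Y, ℝ))} (hk' : MixedLipschitz k' L)
    (hkk : ∀ x y, k' x y = -k y x) {m : ℕ} (hm : 0 < m) (F : C(X, ℝ)) (H : C(Y, ℝ)) :
    -(stabilityConst d D η * L ^ 2 * D ^ 2 / m) ≤
    ∫ q : (Fin m → Fin d → ℝ) × (Fin m → Fin d → ℝ), gain η k k' 1 F H q.1 q.2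
      ∂(blockLaw η d m).prod (blockLaw η d m) +
    ∫ q : (Fin m → Fin d → ℝ) × (Fin m → Fin d → ℝ), gain η k' k 1 H F q.1 q.2
      ∂(blockLaw η d m).prod (blockLaw η d m) := by
  have := isProbabilityMeasure_blockLaw hη d m
  have h1 := le_integral_gain hd hη hD0 hL hX hY hk k' hm F H
  have h2 := le_integral_gain hd hη hD0 hL hY hX hk' k hm H F
  simp only [mean_mixed_bestLaw_eq_neg hη hkk, integral_neg] at h2
  rw [integral_integral_swap (integrable_payoff hη (m := m) k k' F H)] at h1
  have hg := stabilityConst_pos hd hη hD0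
  set γ := stabilityConst d D η
  have hA : 0 ≤ ∫ r : Fin m → Fin d → ℝ, drift η F (F + avg k (sample H r)) ^ 2 ∂blockLaw η d m :=
    integral_nonneg fun _ => sq_nonneg _
  have hB : 0 ≤ ∫ a : Fin m → Fin d → ℝ, drift η H (H + avg k' (sample F a)) ^ 2
      ∂blockLaw η d m := integral_nonneg fun _ => sq_nonneg _
  have h3 : ∀ A : ℝ, 0 ≤ A → γ / 4 * L ^ 2 * A ≤ A / γ := by
    intro A hA
    rw [le_div_iff₀ hg]
    have : (γ * L) ^ 2 ≤ 2 ^ 2 := by gcongr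
    nlinarith
  have h4 := h3 _ hA
  have h5 := h3 _ hB
  have h6 : γ * L ^ 2 * D ^ 2 / m = 4 * (γ * L ^ 2 * D ^ 2 / (4 * m)) := by
    field_simp
  linarith

/-- Without guesses: by concavity the potential increases at least by the expected loss, up to the
oscillation of the loss. -/
lemma le_gain_zero (hη : 0 < η) {B : ℝ} {k : C(Y, C(X, ℝ))}
    (hB : ∀ y x x', |k y x - k y x'| ≤ B) (k' : C(X, C(Y, ℝ))) {m : ℕ} (hm : 0 < m) (F : C(X, ℝ))
    (H : C(Y, ℝ)) :
    mean η F (mixed k (bestLaw η H)) - B ≤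
    ∫ q : (Fin m → Fin d → ℝ) × (Fin m → Fin d → ℝ), gain η k k' 0 F H q.1 q.2
      ∂(blockLaw η d m).prod (blockLaw η d m) := by
  have := isProbabilityMeasure_blockLaw hη d m
  have := isProbabilityMeasure_bestLaw hη H
  have := isProbabilityMeasure_perturbLaw hη d
  have hm' : (0 : ℝ) < m := by exact_mod_cast hm
  have h1 : ∀ ys : Fin m → Y, mean η F (avg k ys) - B ≤
      potential η (F + avg k ys) - potential η F := by
    intro ys
    have h2 := bregman_nonneg hη (F + avg k ys) F
    have h3 : bregman η F (F + avg k ys) =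
        potential η (F + avg k ys) - mean η (F + avg k ys) (avg k ys) - potential η F := by
      unfold bregman
      rw [show F - (F + avg k ys) = 0 - avg k ys by abel, mean_sub hη,
        show mean η (F + avg k ys) 0 = 0 by simp [mean]]
      ring
    have h4 : ∀ x x' : X, avg k ys x - avg k ys x' ≤ B := by
      intro x x'
      have h5 : avg k ys x - avg k ys x' = (m : ℝ)⁻¹ * ∑ j, (k (ys j) x - k (ys j) x') := by
        simp [avg, Finset.sum_sub_distrib, mul_sub]
      rw [h5, inv_mul_le_iff₀ hm']
      calc _ ≤ ∑ j : Fin m, B := Finset.sum_le_sum fun j _ => (le_abs_self _).trans (hB _ _ _)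
        _ = _ := by simp
    have h6 : mean η F (avg k ys) - mean η (F + avg k ys) (avg k ys) ≤ B := by
      unfold mean
      rw [← integral_sub (integrable_comp_best hη _ _) (integrable_comp_best hη _ _)]
      calc _ ≤ ∫ _, B ∂perturbLaw η d := integral_mono
            ((integrable_comp_best hη _ _).sub (integrable_comp_best hη _ _))
            (integrable_const _) fun s => h4 _ _
        _ = B := by simp
    linarith
  rw [integral_prod _ (integrable_gain hη k k' 0 F H)]
  simp only [gain, zero_smul, add_zero, integral_const, probReal_univ, one_smul]
  have hA : Continuous (avg k : (Fin m → Y) → C(X, ℝ)) := continuous_avg k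
  have hP : Continuous fun ys : Fin m → Y => potential η (F + avg k ys) - potential η F :=
    ((continuous_potential hη).comp (continuous_const.add hA)).sub continuous_const
  rw [integral_sample hη H hP.measurable, ← integral_avg hm,
    ← integral_mean hη F (integrable_of_continuous hA _)]
  have i1 : Integrable (fun ys : Fin m → Y => mean η F (avg k ys))
      (Measure.pi fun _ => bestLaw η H) :=
    integrable_of_continuous ((meanCLM hη F).continuous.comp hA) _
  have i2 : Integrable (fun ys : Fin m → Y => potential η (F + avg k ys) - potential η F)
      (Measure.pi fun _ => bestLaw η H) := integrable_of_continuous hP _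
  have := integral_mono (i1.sub (integrable_const B)) i2 h1
  rw [integral_sub' i1 (integrable_const _)] at this
  simpa using this

/-- In a round without guesses the potentials decrease at most by the oscillations of the losses. -/
lemma le_gain_zero_add (hη : 0 < η) {B : ℝ} {k : C(Y, C(X, ℝ))} {k' : C(X, C(Y, ℝ))}
    (hB : ∀ y x x', |k y x - k y x'| ≤ B) (hB' : ∀ x y y', |k' x y - k' x y'| ≤ B)
    (hkk : ∀ x y, k' x y = -k y x) {m : ℕ} (hm : 0 < m) (F : C(X, ℝ)) (H : C(Y, ℝ)) :
    -(2 * B) ≤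
    ∫ q : (Fin m → Fin d → ℝ) × (Fin m → Fin d → ℝ), gain η k k' 0 F H q.1 q.2
      ∂(blockLaw η d m).prod (blockLaw η d m) +
    ∫ q : (Fin m → Fin d → ℝ) × (Fin m → Fin d → ℝ), gain η k' k 0 H F q.1 q.2
      ∂(blockLaw η d m).prod (blockLaw η d m) := by
  have h1 := le_gain_zero hη hB k' hm F H
  have h2 := le_gain_zero hη hB' k hm H F
  rw [mean_mixed_bestLaw_eq_neg hη hkk] at h2
  linarith

end

/-! ### Random variables determined by a part of an independent family -/

section

variable {Ω κ E β γ : Type*} [MeasurableSpace Ω] [MeasurableSpace E] [MeasurableSpace β]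
  [MeasurableSpace γ] {μ : Measure Ω} {σ : κ → Ω → E} {S S' : Set κ}

/-- The `σ`-algebra generated by the variables `σ i`, `i ∈ S`. -/
@[reducible] def generatedBy (σ : κ → Ω → E) (S : Set κ) : MeasurableSpace Ω :=
  ⨆ i ∈ S, MeasurableSpace.comap (σ i) inferInstance

/-- Up to a null set, `V` is a measurable function of the variables `σ i`, `i ∈ S`. -/
def Determined (μ : Measure Ω) (σ : κ → Ω → E) (S : Set κ) (V : Ω → β) : Prop :=
  ∃ V' : Ω → β, Measurable[generatedBy σ S] V' ∧ V =ᵐ[μ] V'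

lemma Determined.mono {V : Ω → β} (hV : Determined μ σ S V) (h : S ⊆ S') : Determined μ σ S' V := by
  obtain ⟨V', h1, h2⟩ := hV
  exact ⟨V', h1.mono (biSup_mono h) le_rfl, h2⟩

lemma Determined.congr {V W : Ω → β} (hV : Determined μ σ S V) (h : W =ᵐ[μ] V) :
    Determined μ σ S W := by
  obtain ⟨V', h1, h2⟩ := hV
  exact ⟨V', h1, h.trans h2⟩

lemma Determined.comp {V : Ω → β} (hV : Determined μ σ S V) {g : β → γ} (hg : Measurable g) :
    Determined μ σ S fun ω => g (V ω) := by
  obtain ⟨V', h1, h2⟩ := hV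
  exact ⟨fun ω => g (V' ω), hg.comp h1, h2.fun_comp g⟩

lemma Determined.prodMk {V : Ω → β} {W : Ω → γ} (hV : Determined μ σ S V)
    (hW : Determined μ σ S W) : Determined μ σ S fun ω => (V ω, W ω) := by
  obtain ⟨V', h1, h2⟩ := hV
  obtain ⟨W', h3, h4⟩ := hW
  exact ⟨fun ω => (V' ω, W' ω), h1.prodMk h3, h2.prodMk h4⟩

lemma Determined.pi {ι : Type*} [Countable ι] {V : ι → Ω → β} (hV : ∀ i, Determined μ σ S (V i)) :
    Determined μ σ S fun ω i => V i ω := by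
  choose V' h1 h2 using hV
  refine ⟨fun ω i => V' i ω, @measurable_pi_lambda _ _ _ (generatedBy σ S) _ _ h1, ?_⟩
  filter_upwards [ae_all_iff.2 h2] with ω hω
  exact funext hω

lemma determined_const (b : β) : Determined μ σ S fun _ => b :=
  ⟨fun _ => b, measurable_const, Filter.EventuallyEq.rfl⟩

lemma determined_coord {i : κ} (hi : i ∈ S) : Determined μ σ S (σ i) :=
  ⟨σ i, (comap_measurable (σ i)).mono (le_biSup (fun i => MeasurableSpace.comap (σ i) _) hi) le_rfl,
    Filter.EventuallyEq.rfl⟩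

lemma Determined.aemeasurable {V : Ω → β} (hV : Determined μ σ S V) (hσ : ∀ i, Measurable (σ i)) :
    AEMeasurable V μ := by
  obtain ⟨V', h1, h2⟩ := hV
  exact ⟨V', h1.mono (iSup₂_le fun i _ => (hσ i).comap_le) le_rfl, h2⟩

/-- Variables that are determined by disjoint parts of an independent family are independent. -/
lemma Determined.indepFun {V : Ω → β} {W : Ω → γ} (hV : Determined μ σ S V)
    (hW : Determined μ σ S' W) (hσ : ∀ i, Measurable (σ i)) (hind : iIndepFun σ μ)
    (hS : Disjoint S S') : IndepFun V W μ := by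
  obtain ⟨V', h1, h2⟩ := hV
  obtain ⟨W', h3, h4⟩ := hW
  refine IndepFun.congr ?_ h2.symm h4.symm
  have h5 := indep_iSup_of_disjoint (fun i => (hσ i).comap_le) hind hS
  exact indep_of_indep_of_le_left (indep_of_indep_of_le_right h5 h3.comap_le) h1.comap_le

end

/-- The law of a block of coordinates of an independent family of exponential variables. -/
lemma map_block {Ω κ : Type*} [MeasurableSpace Ω] {μ : Measure Ω} [IsProbabilityMeasure μ]
    {η : ℝ} (hη : 0 < η) {σ : κ → Ω → ℝ} (hσ : ∀ i, HasLaw (σ i) (expMeasure η⁻¹) μ)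
    (hind : iIndepFun σ μ) {m d : ℕ} (e : Fin m → Fin d → κ)
    (he : Function.Injective fun p : Fin m × Fin d => e p.1 p.2) (hm : ∀ i, Measurable (σ i)) :
    μ.map (fun ω j i => σ (e j i) ω) = blockLaw η d m := by
  have := isProbabilityMeasure_expMeasure (inv_pos.2 hη)
  have h1 := (iIndepFun_iff_map_fun_eq_pi_map
    (f := fun p : Fin m × Fin d => σ (e p.1 p.2)) fun p => (hm _).aemeasurable).1 (hind.precomp he)
  simp only [(hσ _).map_eq] at h1
  have h2 := Measure.infinitePi_map_curry (fun (_ : Fin m) (_ : Fin d) => expMeasure η⁻¹)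
  rw [Measure.infinitePi_eq_pi, ← h1, Measure.map_map (MeasurableEquiv.measurable _)
    (measurable_pi_lambda _ fun p => hm _)] at h2
  simp only [Measure.infinitePi_eq_pi] at h2
  exact h2

/-! ### The play as a process driven by independent perturbations -/

/-- If `V` is independent of `W`, an expectation can be computed by averaging over `V` first. -/
lemma integral_comp_of_indepFun {Ω α β : Type*} [MeasurableSpace Ω] [MeasurableSpace α]
    [MeasurableSpace β] {μ : Measure Ω} [IsProbabilityMeasure μ] {W : Ω → α} {V : Ω → β}
    (hW : AEMeasurable W μ) (hV : AEMeasurable V μ) (hWV : IndepFun W V μ) {φ : α × β → ℝ}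
    (hφ : Measurable φ) {C : ℝ} (hC : ∀ p, |φ p| ≤ C) :
    ∫ ω, φ (W ω, V ω) ∂μ = ∫ ω, ∫ v, φ (W ω, v) ∂μ.map V ∂μ := by
  have := Measure.isProbabilityMeasure_map hW
  have := Measure.isProbabilityMeasure_map hV
  have hi : Integrable φ ((μ.map W).prod (μ.map V)) :=
    Integrable.of_bound hφ.aestronglyMeasurable C (ae_of_all _ hC)
  rw [← integral_map (hW.prodMk hV) hφ.aestronglyMeasurable,
    hWV.map_prod_eq_prod_map_map hW hV, integral_prod _ hi]
  have hφ' : StronglyMeasurable (Function.uncurry fun w v => φ (w, v)) := hφ.stronglyMeasurable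
  exact integral_map hW hφ'.integral_prod_right.measurable.aestronglyMeasurable

section

variable {d T m : ℕ} {Ω : Type*} [MeasurableSpace Ω] {μ : Measure Ω} {η : ℝ}

/-- The perturbation vectors of a player in one phase of round `t`. -/
def block (σ : Player × Phase × Fin T × Fin m × Fin d → Ω → ℝ) (p : Player) (h : Phase)
    (t : Fin T) (ω : Ω) : Fin m → Fin d → ℝ :=
  fun j i => σ (p, h, t, j, i) ω

lemma determined_block (μ : Measure Ω) (σ : Player × Phase × Fin T × Fin m × Fin d → Ω → ℝ)
    (p : Player) (h : Phase) (t : Fin T) :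
    Determined μ σ {q | q.1 = p ∧ q.2.1 = h ∧ q.2.2.1 = t} (block σ p h t) :=
  Determined.pi fun _ => Determined.pi fun _ => determined_coord ⟨rfl, rfl, rfl⟩

/-- The perturbations that are drawn before round `n`. -/
def past (d T m n : ℕ) : Set (Player × Phase × Fin T × Fin m × Fin d) := {q | q.2.2.1.val < n}

variable [IsProbabilityMeasure μ]

/-- A variable `W` that is determined by the past and the perturbations of two different players in
round `t` are independent. -/
lemma integral_comp_block {α : Type*} [MeasurableSpace α] (hη : 0 < η)
    {σ : Player × Phase × Fin T × Fin m × Fin d → Ω → ℝ}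
    (hσ : ∀ i, HasLaw (σ i) (expMeasure η⁻¹) μ) (hind : iIndepFun σ μ)
    (hm : ∀ i, Measurable (σ i)) {t : Fin T} {W : Ω → α} (hW : Determined μ σ (past d T m t) W)
    {p p' : Player} {h h' : Phase} (hne : p ≠ p')
    {φ : α × (Fin m → Fin d → ℝ) × (Fin m → Fin d → ℝ) → ℝ}
    (hφ : Measurable φ) {C : ℝ} (hC : ∀ q, |φ q| ≤ C) :
    ∫ ω, φ (W ω, block σ p h t ω, block σ p' h' t ω) ∂μ =
      ∫ ω, ∫ q, φ (W ω, q) ∂(blockLaw η d m).prod (blockLaw η d m) ∂μ := by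
  have h1 := determined_block μ σ p h t
  have h2 := determined_block μ σ p' h' t
  have h3 : ∀ (p : Player) (h : Phase), μ.map (block σ p h t) = blockLaw η d m := fun p h =>
    map_block hη hσ hind (fun j i => (p, h, t, j, i)) (fun a b hab => by
      simp only [Prod.mk.injEq, true_and] at hab
      exact Prod.ext hab.1 hab.2) hm
  have h4 : IndepFun (block σ p h t) (block σ p' h' t) μ := h1.indepFun h2 hm hind
    (Set.disjoint_left.2 fun q hq hq' => hne (hq.1.symm.trans hq'.1))
  have h5 : μ.map (fun ω => (block σ p h t ω, block σ p' h' t ω)) =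
      (blockLaw η d m).prod (blockLaw η d m) := by
    rw [h4.map_prod_eq_prod_map_map (h1.aemeasurable hm) (h2.aemeasurable hm), h3, h3]
  have h6 : Determined μ σ {q | q.2.2.1 = t} fun ω => (block σ p h t ω, block σ p' h' t ω) :=
    (h1.mono fun q hq => hq.2.2).prodMk (h2.mono fun q hq => hq.2.2)
  have h7 := hW.indepFun h6 hm hind (Set.disjoint_left.2 fun q hq hq' => by
    have h8 : q.2.2.1.val < t.val := hq
    have h9 : q.2.2.1 = t := hq'
    rw [h9] at h8
    exact lt_irrefl _ h8)
  rw [integral_comp_of_indepFun (hW.aemeasurable hm) (h6.aemeasurable hm) h7 hφ hC, h5]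

end

section

variable {d T m : ℕ} {X Y : Set (Fin d → ℝ)} {η : ℝ}

/-- The total loss of the rounds before round `n`, where `ys s` are the points that the opponent
plays in round `s`. -/
noncomputable def cumLoss (k : C(Y, C(X, ℝ))) (ys : Fin T → Fin m → Y) (n : ℕ) : C(X, ℝ) :=
  ∑ s : Fin T with s.val < n, avg k (ys s)

lemma cumLoss_zero (k : C(Y, C(X, ℝ))) (ys : Fin T → Fin m → Y) : cumLoss k ys 0 = 0 := by
  simp [cumLoss]

lemma cumLoss_succ (k : C(Y, C(X, ℝ))) (ys : Fin T → Fin m → Y) (t : Fin T) :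
    cumLoss k ys (t + 1) = cumLoss k ys t + avg k (ys t) := by
  have h : (Finset.univ.filter fun s : Fin T => s.val < t.val + 1) =
      insert t (Finset.univ.filter fun s : Fin T => s.val < t.val) := by
    ext s
    simp only [Finset.mem_filter, Finset.mem_univ, true_and, Finset.mem_insert, Fin.ext_iff]
    omega
  unfold cumLoss
  rw [h, Finset.sum_insert (by simp), add_comm]

lemma cumLoss_last (k : C(Y, C(X, ℝ))) (ys : Fin T → Fin m → Y) :
    cumLoss k ys T = ∑ s, avg k (ys s) := by
  simp [cumLoss]

variable {Ω : Type*} [MeasurableSpace Ω]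

/-- In the rounds before round `n` the points `xs` of player `p` and `ys` of player `p'` are the
perturbed minimizers of the optimistic total losses; `w` are the weights of the guesses. -/
structure IsPlay [Nonempty X] [Nonempty Y] (μ : Measure Ω) (w : Fin T → ℝ) (k : C(Y, C(X, ℝ)))
    (k' : C(X, C(Y, ℝ))) (σ : Player × Phase × Fin T × Fin m × Fin d → Ω → ℝ) (p p' : Player)
    (xs : Ω → Fin T → Fin m → X) (ys : Ω → Fin T → Fin m → Y) (n : ℕ) :
    Prop where
  left : ∀ t : Fin T, t.val < n → ∀ᵐ ω ∂μ, xs ω t = sample (cumLoss k (ys ω) t +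
    w t • avg k (sample (cumLoss k' (xs ω) t) (block σ p' .guess t ω))) (block σ p .play t ω)
  right : ∀ t : Fin T, t.val < n → ∀ᵐ ω ∂μ, ys ω t = sample (cumLoss k' (xs ω) t +
    w t • avg k' (sample (cumLoss k (ys ω) t) (block σ p .guess t ω))) (block σ p' .play t ω)

variable [CompactSpace X] [CompactSpace Y] [Nonempty X] [Nonempty Y] {μ : Measure Ω}

omit [Nonempty X] [Nonempty Y] in
lemma norm_cumLoss_le (k : C(Y, C(X, ℝ))) (ys : Fin T → Fin m → Y) (n : ℕ) :
    ‖cumLoss k ys n‖ ≤ T * ‖k‖ := by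
  refine (norm_sum_le _ _).trans ((Finset.sum_le_sum fun s _ => norm_avg_le k _).trans ?_)
  rw [Finset.sum_const, nsmul_eq_mul]
  gcongr
  exact (Finset.card_le_univ _).trans (by simp)

variable {w : Fin T → ℝ} {k : C(Y, C(X, ℝ))} {k' : C(X, C(Y, ℝ))}
  {σ : Player × Phase × Fin T × Fin m × Fin d → Ω → ℝ} {p p' : Player}
  {xs : Ω → Fin T → Fin m → X} {ys : Ω → Fin T → Fin m → Y}

omit [CompactSpace X] [CompactSpace Y] in
lemma IsPlay.mono {n n' : ℕ} (hp : IsPlay μ w k k' σ p p' xs ys n) (hn : n' ≤ n) :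
    IsPlay μ w k k' σ p p' xs ys n' :=
  ⟨fun t ht => hp.left t (ht.trans_le hn), fun t ht => hp.right t (ht.trans_le hn)⟩

omit [CompactSpace X] [CompactSpace Y] in
lemma IsPlay.symm {n : ℕ} (hp : IsPlay μ w k k' σ p p' xs ys n) :
    IsPlay μ w k' k σ p' p ys xs n :=
  ⟨hp.right, hp.left⟩

/-- The total losses before round `n` are functions of the perturbations of the rounds before `n`. -/
lemma IsPlay.determined {n : ℕ} (hp : IsPlay μ w k k' σ p p' xs ys n) (hn : n ≤ T) :
    Determined μ σ (past d T m n) fun ω => (cumLoss k (ys ω) n, cumLoss k' (xs ω) n) := by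
  induction n with
  | zero =>
    simp only [cumLoss_zero]
    exact determined_const _
  | succ n ih =>
    have h1 := (ih (hp.mono (Nat.le_succ n)) (by omega)).mono (S' := past d T m (n + 1))
      fun q (hq : q.2.2.1.val < n) => Nat.lt_succ_of_lt hq
    set t : Fin T := ⟨n, hn⟩
    have h2 : ∀ q h, Determined μ σ (past d T m (n + 1)) (block σ q h t) := fun q h =>
      (determined_block μ σ q h t).mono fun i hi => by
        have : i.2.2.1 = t := hi.2.2
        simp [past, this, t]
    have h3 := (h1.prodMk ((h2 p .guess).prodMk (h2 p' .play))).comp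
      (measurable_response k k' (w t))
    have h4 := (h1.comp measurable_swap).prodMk ((h2 p' .guess).prodMk (h2 p .play)) |>.comp
      (measurable_response k' k (w t))
    have h5 := ((h1.comp measurable_fst).prodMk h3).comp (g := fun q => q.1 + q.2)
      (measurable_fst.add measurable_snd)
    have h6 := ((h1.comp measurable_snd).prodMk h4).comp (g := fun q => q.1 + q.2)
      (measurable_fst.add measurable_snd)
    refine (h5.prodMk h6).congr ?_
    filter_upwards [hp.left t (Nat.lt_succ_self n), hp.right t (Nat.lt_succ_self n)] with ω hx hy
    have h7 := cumLoss_succ k (ys ω) t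
    have h8 := cumLoss_succ k' (xs ω) t
    rw [hy] at h7
    rw [hx] at h8
    exact Prod.ext h7 h8

variable [IsProbabilityMeasure μ]

/-- The expected increase of a potential in round `t` can be computed with fresh perturbations. -/
lemma IsPlay.integral_potential_sub (hη : 0 < η) (hp : IsPlay μ w k k' σ p p' xs ys T)
    (hσ : ∀ i, HasLaw (σ i) (expMeasure η⁻¹) μ) (hind : iIndepFun σ μ)
    (hm : ∀ i, Measurable (σ i)) (hne : p ≠ p') (t : Fin T) :
    ∫ ω, (potential η (cumLoss k (ys ω) (t + 1)) - potential η (cumLoss k (ys ω) t)) ∂μ =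
      ∫ ω, ∫ q : (Fin m → Fin d → ℝ) × (Fin m → Fin d → ℝ),
        gain η k k' (w t) (cumLoss k (ys ω) t) (cumLoss k' (xs ω) t) q.1 q.2
        ∂(blockLaw η d m).prod (blockLaw η d m) ∂μ := by
  rw [← integral_comp_block hη hσ hind hm ((hp.mono t.2.le).determined t.2.le) (p := p) (p' := p')
    (h := .guess) (h' := .play) hne (measurable_gain hη k k' (w t))
    fun q => abs_gain_le hη k k' _ _ _ _ _]
  refine integral_congr_ae ?_
  filter_upwards [hp.right t t.2] with ω hy
  simp only [cumLoss_succ, gain]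
  rw [hy]

lemma IsPlay.integrable_potential (hη : 0 < η) (hp : IsPlay μ w k k' σ p p' xs ys T)
    (hm : ∀ i, Measurable (σ i)) {n : ℕ} (hn : n ≤ T) :
    Integrable (fun ω => potential η (cumLoss k (ys ω) n)) μ := by
  have h1 := ((((hp.mono hn).determined hn).comp measurable_fst).comp
    (continuous_potential (X := X) hη).measurable).aemeasurable hm
  refine Integrable.of_bound h1.aestronglyMeasurable (T * ‖k‖) (ae_of_all _ fun ω => ?_)
  have h2 := abs_potential_sub_le hη (cumLoss k (ys ω) n) 0
  rw [potential_zero, sub_zero, sub_zero] at h2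
  exact h2.trans (norm_cumLoss_le k (ys ω) n)

lemma IsPlay.integrable_cumLoss (hp : IsPlay μ w k k' σ p p' xs ys T)
    (hm : ∀ i, Measurable (σ i)) (x : X) :
    Integrable (fun ω => cumLoss k (ys ω) T x) μ := by
  have h1 := (((hp.determined le_rfl).comp measurable_fst).comp
    (ContinuousMap.evalCLM ℝ x).continuous.measurable).aemeasurable hm
  refine Integrable.of_bound h1.aestronglyMeasurable (T * ‖k‖) (ae_of_all _ fun ω => ?_)
  exact ((cumLoss k (ys ω) T).norm_coe_le_norm x).trans (norm_cumLoss_le k (ys ω) T)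

lemma IsPlay.integrable_gain_state (hη : 0 < η) (hp : IsPlay μ w k k' σ p p' xs ys T)
    (hm : ∀ i, Measurable (σ i)) (t : Fin T) :
    Integrable (fun ω => ∫ q : (Fin m → Fin d → ℝ) × (Fin m → Fin d → ℝ),
      gain η k k' (w t) (cumLoss k (ys ω) t) (cumLoss k' (xs ω) t) q.1 q.2
      ∂(blockLaw η d m).prod (blockLaw η d m)) μ := by
  have := isProbabilityMeasure_blockLaw hη d m
  have h1 := (measurable_gain hη (m := m) k k' (w t)).stronglyMeasurable
  have h2 : Measurable fun W : C(X, ℝ) × C(Y, ℝ) =>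
      ∫ q : (Fin m → Fin d → ℝ) × (Fin m → Fin d → ℝ), gain η k k' (w t) W.1 W.2 q.1 q.2
      ∂(blockLaw η d m).prod (blockLaw η d m) := h1.integral_prod_right.measurable
  refine Integrable.of_bound
    ((((hp.mono t.2.le).determined t.2.le).comp h2).aemeasurable hm).aestronglyMeasurable ‖k‖ (ae_of_all _ fun ω => ?_)
  refine (norm_integral_le_of_norm_le_const (ae_of_all _ fun q =>
    abs_gain_le hη k k' _ _ _ _ _)).trans ?_
  simp

/-- The potentials decrease at most by the sum of what they can lose in the single rounds. -/
lemma IsPlay.neg_sum_le_integral_potential (hη : 0 < η) (hp : IsPlay μ w k k' σ p p' xs ys T)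
    (hσ : ∀ i, HasLaw (σ i) (expMeasure η⁻¹) μ) (hind : iIndepFun σ μ)
    (hm : ∀ i, Measurable (σ i)) (hne : p ≠ p') {c : Fin T → ℝ}
    (hc : ∀ (t : Fin T) (F : C(X, ℝ)) (H : C(Y, ℝ)), -c t ≤
      ∫ q : (Fin m → Fin d → ℝ) × (Fin m → Fin d → ℝ), gain η k k' (w t) F H q.1 q.2
        ∂(blockLaw η d m).prod (blockLaw η d m) +
      ∫ q : (Fin m → Fin d → ℝ) × (Fin m → Fin d → ℝ), gain η k' k (w t) H F q.1 q.2
        ∂(blockLaw η d m).prod (blockLaw η d m)) :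
    -∑ t, c t ≤ ∫ ω, potential η (cumLoss k (ys ω) T) ∂μ +
      ∫ ω, potential η (cumLoss k' (xs ω) T) ∂μ := by
  have := isProbabilityMeasure_blockLaw hη d m
  set a : ℕ → ℝ := fun n => ∫ ω, potential η (cumLoss k (ys ω) n) ∂μ +
    ∫ ω, potential η (cumLoss k' (xs ω) n) ∂μ with ha
  have h0 : a 0 = 0 := by simp [ha, cumLoss_zero, potential_zero]
  have h1 : ∀ t : Fin T, -c t ≤ a (t + 1) - a t := by
    intro t
    have e1 := hp.integral_potential_sub hη hσ hind hm hne t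
    have e2 := hp.symm.integral_potential_sub hη hσ hind hm hne.symm t
    rw [integral_sub (hp.integrable_potential hη hm t.2) (hp.integrable_potential hη hm t.2.le)]
      at e1
    rw [integral_sub (hp.symm.integrable_potential hη hm t.2)
      (hp.symm.integrable_potential hη hm t.2.le)] at e2
    have e3 : a (t + 1) - a t = ∫ ω, (∫ q : (Fin m → Fin d → ℝ) × (Fin m → Fin d → ℝ),
        gain η k k' (w t) (cumLoss k (ys ω) t) (cumLoss k' (xs ω) t) q.1 q.2
          ∂(blockLaw η d m).prod (blockLaw η d m) +
        ∫ q : (Fin m → Fin d → ℝ) × (Fin m → Fin d → ℝ),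
        gain η k' k (w t) (cumLoss k' (xs ω) t) (cumLoss k (ys ω) t) q.1 q.2
          ∂(blockLaw η d m).prod (blockLaw η d m)) ∂μ := by
      rw [integral_add (hp.integrable_gain_state hη hm t) (hp.symm.integrable_gain_state hη hm t),
        ← e1, ← e2]
      ring
    rw [e3]
    calc -c t = ∫ _, -c t ∂μ := by simp
      _ ≤ _ := integral_mono (integrable_const _)
        ((hp.integrable_gain_state hη hm t).add (hp.symm.integrable_gain_state hη hm t))
        fun ω => hc t _ _
  have h2 : ∑ t : Fin T, (a (t + 1) - a t) = a T := by
    rw [Fin.sum_univ_eq_sum_range (fun n => a (n + 1) - a n) T, Finset.sum_range_sub, h0, sub_zero]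
  calc -∑ t, c t = ∑ t, -c t := (Finset.sum_neg_distrib _).symm
    _ ≤ ∑ t : Fin T, (a (t + 1) - a t) := Finset.sum_le_sum fun t _ => h1 t
    _ = _ := h2

end

/-! ### Oracle calls return the perturbed minimizer -/

section

variable {d T m : ℕ} {X Y : Set (Fin d → ℝ)} {η : ℝ} {Ω : Type*} [MeasurableSpace Ω]
  {μ : Measure Ω}

/-- The points `xs j` minimize the loss `h` with the perturbations `s j`. -/
def Minimizes (h : C(X, ℝ)) (s : Fin m → Fin d → ℝ) (xs : Fin m → X) : Prop :=
  ∀ (j : Fin m) (u : X), h (xs j) - s j ⬝ᵥ (xs j : Fin d → ℝ) ≤ h u - s j ⬝ᵥ (u : Fin d → ℝ)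

/-- The points that the players compute are returned by minimization oracles: `xg`, `xs` are the
guesses and the played points of player `p`, and `yg`, `ys` those of player `p'`. -/
structure IsOracleRun (μ : Measure Ω) (w : Fin T → ℝ) (k : C(Y, C(X, ℝ)))
    (k' : C(X, C(Y, ℝ))) (σ : Player × Phase × Fin T × Fin m × Fin d → Ω → ℝ) (p p' : Player)
    (xg xs : Ω → Fin T → Fin m → X) (yg ys : Ω → Fin T → Fin m → Y) : Prop where
  guess_left : ∀ t : Fin T, ∀ᵐ ω ∂μ,
    Minimizes (cumLoss k (ys ω) t) (block σ p .guess t ω) (xg ω t)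
  guess_right : ∀ t : Fin T, ∀ᵐ ω ∂μ,
    Minimizes (cumLoss k' (xs ω) t) (block σ p' .guess t ω) (yg ω t)
  play_left : ∀ t : Fin T, ∀ᵐ ω ∂μ,
    Minimizes (cumLoss k (ys ω) t + w t • avg k (yg ω t)) (block σ p .play t ω) (xs ω t)
  play_right : ∀ t : Fin T, ∀ᵐ ω ∂μ,
    Minimizes (cumLoss k' (xs ω) t + w t • avg k' (xg ω t)) (block σ p' .play t ω) (ys ω t)

lemma IsOracleRun.symm {w : Fin T → ℝ} {k : C(Y, C(X, ℝ))}
    {k' : C(X, C(Y, ℝ))} {σ : Player × Phase × Fin T × Fin m × Fin d → Ω → ℝ} {p p' : Player}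
    {xg xs : Ω → Fin T → Fin m → X} {yg ys : Ω → Fin T → Fin m → Y}
    (hr : IsOracleRun μ w k k' σ p p' xg xs yg ys) : IsOracleRun μ w k' k σ p' p yg ys xg xs :=
  ⟨hr.guess_right, hr.guess_left, hr.play_right, hr.play_left⟩

/-- A run does not change if the perturbations are changed on a null set. -/
lemma IsOracleRun.congr {w : Fin T → ℝ} {k : C(Y, C(X, ℝ))}
    {k' : C(X, C(Y, ℝ))} {σ σ' : Player × Phase × Fin T × Fin m × Fin d → Ω → ℝ} {p p' : Player}
    {xg xs : Ω → Fin T → Fin m → X} {yg ys : Ω → Fin T → Fin m → Y}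
    (hr : IsOracleRun μ w k k' σ p p' xg xs yg ys) (hσ : ∀ i, σ i =ᵐ[μ] σ' i) :
    IsOracleRun μ w k k' σ' p p' xg xs yg ys := by
  have hb : ∀ q h t, ∀ᵐ ω ∂μ, block σ q h t ω = block σ' q h t ω := by
    intro q h t
    filter_upwards [ae_all_iff.2 fun j : Fin m => ae_all_iff.2 fun i : Fin d => hσ (q, h, t, j, i)]
      with ω hω
    exact funext fun j => funext fun i => hω j i
  refine ⟨fun t => ?_, fun t => ?_, fun t => ?_, fun t => ?_⟩
  · filter_upwards [hr.guess_left t, hb p .guess t] with ω h1 h2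
    rwa [← h2]
  · filter_upwards [hr.guess_right t, hb p' .guess t] with ω h1 h2
    rwa [← h2]
  · filter_upwards [hr.play_left t, hb p .play t] with ω h1 h2
    rwa [← h2]
  · filter_upwards [hr.play_right t, hb p' .play t] with ω h1 h2
    rwa [← h2]

variable [CompactSpace X] [CompactSpace Y] [Nonempty X] [Nonempty Y] [IsProbabilityMeasure μ]

omit [CompactSpace Y] [Nonempty Y] in
/-- If the loss is independent of the perturbation, then almost surely `value` is differentiable,
so that the minimizer is unique. -/
lemma ae_differentiableAt_value (hη : 0 < η) {W : Ω → C(X, ℝ)} {s : Ω → Fin d → ℝ}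
    (hW : AEMeasurable W μ) (hs : AEMeasurable s μ) (hWs : IndepFun W s μ)
    (hlaw : μ.map s = perturbLaw η d) :
    ∀ᵐ ω ∂μ, DifferentiableAt ℝ (value (W ω)) (s ω) := by
  have := Measure.isProbabilityMeasure_map hW
  have := isProbabilityMeasure_perturbLaw hη d
  have hmeas : MeasurableSet {p : C(X, ℝ) × (Fin d → ℝ) | DifferentiableAt ℝ (value p.1) p.2} :=
    measurableSet_of_differentiableAt_with_param ℝ continuous_value
  have h1 : ∀ᵐ p ∂(μ.map W).prod (perturbLaw η d), DifferentiableAt ℝ (value p.1) p.2 := by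
    rw [Measure.ae_prod_iff_ae_ae hmeas]
    refine ae_of_all _ fun h => (perturbLaw_absolutelyContinuous hη d).ae_le ?_
    obtain ⟨C, hC⟩ := exists_lipschitzWith_value X
    exact (hC h).ae_differentiableAt
  rw [← hlaw, ← hWs.map_prod_eq_prod_map_map hW hs] at h1
  exact ae_of_ae_map (hW.prodMk hs) h1

omit [CompactSpace Y] [Nonempty Y] in
/-- If the loss does not depend on a block of perturbations, then almost surely an oracle that is
called with this block returns the perturbed minimizers `best`. -/
lemma ae_eq_sample (hη : 0 < η) {σ : Player × Phase × Fin T × Fin m × Fin d → Ω → ℝ}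
    (hσ : ∀ i, HasLaw (σ i) (expMeasure η⁻¹) μ) (hind : iIndepFun σ μ)
    (hm : ∀ i, Measurable (σ i)) {p : Player} {h : Phase} {t : Fin T} {W : Ω → C(X, ℝ)}
    (hW : Determined μ σ {q | ¬(q.1 = p ∧ q.2.1 = h ∧ q.2.2.1 = t)} W) {xs : Ω → Fin m → X}
    (hxs : ∀ᵐ ω ∂μ, Minimizes (W ω) (block σ p h t ω) (xs ω)) :
    ∀ᵐ ω ∂μ, xs ω = sample (W ω) (block σ p h t ω) := by
  have := isProbabilityMeasure_perturbLaw hη d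
  have hb := determined_block μ σ p h t
  have hlaw : ∀ j, μ.map (fun ω => block σ p h t ω j) = perturbLaw η d := by
    intro j
    have h1 : μ.map (block σ p h t) = blockLaw η d m :=
      map_block hη hσ hind (fun j i => (p, h, t, j, i)) (fun a b hab => by
        simp only [Prod.mk.injEq, true_and] at hab
        exact Prod.ext hab.1 hab.2) hm
    have h2 := (measurePreserving_eval (fun _ : Fin m => perturbLaw η d) j).map_eq
    change (blockLaw η d m).map _ = _ at h2
    rw [← h1, AEMeasurable.map_map_of_aemeasurable (measurable_pi_apply j).aemeasurable
      (hb.aemeasurable hm)] at h2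
    exact h2
  have hdiff : ∀ j, ∀ᵐ ω ∂μ, DifferentiableAt ℝ (value (W ω)) (block σ p h t ω j) := fun j =>
    ae_differentiableAt_value hη (hW.aemeasurable hm)
      ((hb.comp (measurable_pi_apply j)).aemeasurable hm)
      (hW.indepFun (hb.comp (measurable_pi_apply j)) hm hind
        (Set.disjoint_left.2 fun q hq hq' => hq hq')) (hlaw j)
  filter_upwards [hxs, ae_all_iff.2 hdiff] with ω h1 h2
  funext j
  exact (best_eq_of_differentiableAt (h2 j)
    (le_antisymm (value_le _ _ _) (le_ciInf fun u => h1 j u))).symm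

variable {w : Fin T → ℝ} {k : C(Y, C(X, ℝ))} {k' : C(X, C(Y, ℝ))}
  {σ : Player × Phase × Fin T × Fin m × Fin d → Ω → ℝ} {p p' : Player}
  {xg xs : Ω → Fin T → Fin m → X} {yg ys : Ω → Fin T → Fin m → Y}

lemma IsOracleRun.left_eq (hr : IsOracleRun μ w k k' σ p p' xg xs yg ys) (hη : 0 < η)
    (hσ : ∀ i, HasLaw (σ i) (expMeasure η⁻¹) μ) (hind : iIndepFun σ μ)
    (hm : ∀ i, Measurable (σ i)) (hne : p ≠ p') (t : Fin T)
    (hp : IsPlay μ w k k' σ p p' xs ys t) :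
    ∀ᵐ ω ∂μ, xs ω t = sample (cumLoss k (ys ω) t +
      w t • avg k (sample (cumLoss k' (xs ω) t) (block σ p' .guess t ω)))
        (block σ p .play t ω) := by
  have hst := hp.determined t.2.le
  have hpast : ∀ q h, past d T m t ⊆ {i | ¬(i.1 = q ∧ i.2.1 = h ∧ i.2.2.1 = t)} := by
    intro q h i hi hi'
    have h1 : i.2.2.1.val < t.val := hi
    rw [hi'.2.2] at h1
    exact lt_irrefl _ h1
  have hg := ae_eq_sample hη hσ hind hm ((hst.comp measurable_snd).mono (hpast p' .guess))
    (hr.guess_right t)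
  have h1 := (determined_block μ σ p' .guess t).mono
    (S' := {i | ¬(i.1 = p ∧ i.2.1 = Phase.play ∧ i.2.2.1 = t)})
    fun i hi hi' => hne (hi'.1.symm.trans hi.1)
  have h2 := hst.mono (hpast p .play)
  have h3 : Measurable fun q : (C(X, ℝ) × C(Y, ℝ)) × (Fin m → Fin d → ℝ) =>
      q.1.1 + w t • avg k (sample q.1.2 q.2) := by
    have h4 := Measurable.comp (continuous_avg k (m := m)).measurable
      (measurable_sample_comp (measurable_snd.comp
        (measurable_fst (α := C(X, ℝ) × C(Y, ℝ)) (β := Fin m → Fin d → ℝ))) measurable_snd)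
    exact (measurable_fst.comp measurable_fst).add (h4.const_smul (w t))
  refine ae_eq_sample hη hσ hind hm ((h2.prodMk h1).comp h3) ?_
  filter_upwards [hg, hr.play_left t] with ω h4 h5
  rw [← h4]
  exact h5

/-- By induction on the number of rounds, since the uniqueness of the minimizers in a round uses that
the total losses are determined by the perturbations of the previous rounds. -/
lemma IsOracleRun.isPlay (hr : IsOracleRun μ w k k' σ p p' xg xs yg ys) (hη : 0 < η)
    (hσ : ∀ i, HasLaw (σ i) (expMeasure η⁻¹) μ) (hind : iIndepFun σ μ)
    (hm : ∀ i, Measurable (σ i)) (hne : p ≠ p') {n : ℕ} (hn : n ≤ T) :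
    IsPlay μ w k k' σ p p' xs ys n := by
  induction n with
  | zero => exact ⟨fun t ht => absurd ht (by omega), fun t ht => absurd ht (by omega)⟩
  | succ n ih =>
    have hp := ih (by omega)
    refine ⟨fun t ht => ?_, fun t ht => ?_⟩
    · exact hr.left_eq hη hσ hind hm hne t (hp.mono (by omega))
    · exact hr.symm.left_eq hη hσ hind hm hne.symm t (hp.mono (by omega)).symm

end

/-! ### The loss of a fixed point and the potential -/

section

variable {d : ℕ} {X : Set (Fin d → ℝ)} [CompactSpace X] [Nonempty X] {η : ℝ}

/-- The potential of a total loss `h` is at most the loss of any point of `X`, up to the expected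
range of the linear perturbation. -/
lemma potential_le (hη : 0 < η) (hd : 0 < d) {D : ℝ} (hX : ∀ x x' : X, l1Dist x x' ≤ D)
    (h : C(X, ℝ)) (x : X) : potential η h ≤ h x + D * (2 * η * (Real.log d + 1)) := by
  have := isProbabilityMeasure_perturbLaw hη d
  rw [← integral_maxBound hη hd, ← integral_const_mul]
  calc potential η h ≤ ∫ s, (h x + D * maxBound η s) ∂perturbLaw η d := by
        refine integral_mono_ae (integrable_value_sub hη h 0)
          ((integrable_const _).add ((integrable_maxBound hη d).const_mul D)) ?_
        filter_upwards [ae_nonneg_perturbLaw hη d] with s hs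
        obtain ⟨x', hx'⟩ := exists_value_eq (0 : C(X, ℝ)) s
        have h1 := value_le h s x
        have h2 : 0 ≤ maxBound η s := (hs ⟨0, hd⟩).trans (le_maxBound hη s ⟨0, hd⟩)
        have h3 : s ⬝ᵥ (x' : Fin d → ℝ) - s ⬝ᵥ (x : Fin d → ℝ) ≤ D * maxBound η s := by
          calc s ⬝ᵥ (x' : Fin d → ℝ) - s ⬝ᵥ (x : Fin d → ℝ)
              = ∑ i, s i * ((x' : Fin d → ℝ) i - (x : Fin d → ℝ) i) := by
                simp [dotProduct, mul_sub, Finset.sum_sub_distrib]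
            _ ≤ ∑ i, maxBound η s * |(x' : Fin d → ℝ) i - (x : Fin d → ℝ) i| :=
                Finset.sum_le_sum fun i _ =>
                  (mul_le_mul_of_nonneg_left (le_abs_self _) (hs i)).trans
                    (mul_le_mul_of_nonneg_right (le_maxBound hη s i) (abs_nonneg _))
            _ = maxBound η s * l1Dist x' x := by
                rw [← Finset.mul_sum]
                rfl
            _ ≤ _ := by
                rw [mul_comm D]
                exact mul_le_mul_of_nonneg_left (hX x' x) h2
        rw [ContinuousMap.zero_apply] at hx'
        linarith
    _ = _ := by
        rw [integral_add (integrable_const _) ((integrable_maxBound hη d).const_mul D)]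
        simp

end

/-! ### Consequences of smoothness -/

section

variable {d : ℕ}

lemma abs_pairing_le (g v : Fin d → ℝ) : |pairing g v| ≤ ‖g‖ * l1Norm v := by
  have h1 : pairing g v = ∑ i, g i * v i := by simp [pairing]
  rw [h1, l1Norm, Finset.mul_sum]
  refine (Finset.abs_sum_le_sum_abs _ _).trans (Finset.sum_le_sum fun i _ => ?_)
  rw [abs_mul]
  exact mul_le_mul_of_nonneg_right (norm_le_pi_norm g i) (abs_nonneg _)

lemma l1Norm_smul (c : ℝ) (v : Fin d → ℝ) : l1Norm (c • v) = |c| * l1Norm v := by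
  simp [l1Norm, abs_mul, Finset.mul_sum]

/-- The mean value inequality along a segment, for the `ℓ¹` norm. -/
lemma abs_sub_le_of_pairing {S : Set (Fin d → ℝ)} {φ : (Fin d → ℝ) → ℝ}
    {g : (Fin d → ℝ) → Fin d → ℝ} {c : ℝ} (hS : Convex ℝ S)
    (hφ : ∀ u ∈ S, HasFDerivWithinAt φ (pairing (g u)) S u) {x x' : Fin d → ℝ} (hx : x ∈ S)
    (hx' : x' ∈ S)
    (hg : ∀ u ∈ S, l1Norm (u - x') ≤ l1Norm (x - x') → ‖g u‖ ≤ c) :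
    |φ x - φ x'| ≤ c * l1Norm (x - x') := by
  have hmem : ∀ r ∈ Set.Icc (0 : ℝ) 1, x' + r • (x - x') ∈ S := fun r hr =>
    hS.add_smul_sub_mem hx' hx hr
  have hd : ∀ r ∈ Set.Icc (0 : ℝ) 1, HasDerivWithinAt (fun r : ℝ => φ (x' + r • (x - x')))
      (pairing (g (x' + r • (x - x'))) (x - x')) (Set.Icc 0 1) r := by
    intro r hr
    have h1 : HasDerivWithinAt (fun r : ℝ => x' + r • (x - x')) (x - x') (Set.Icc 0 1) r := by
      have := ((hasDerivWithinAt_id r (Set.Icc (0 : ℝ) 1)).smul_const (x - x')).const_add x'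
      simpa using this
    exact (hφ _ (hmem r hr)).comp_hasDerivWithinAt r h1 hmem
  have h2 := norm_image_sub_le_of_norm_deriv_le_segment_01' hd (C := c * l1Norm (x - x'))
    fun r hr => by
      have hr' : r ∈ Set.Icc (0 : ℝ) 1 := ⟨hr.1, hr.2.le⟩
      refine (abs_pairing_le _ _).trans (mul_le_mul_of_nonneg_right (hg _ (hmem r hr') ?_)
        (l1Norm_nonneg _))
      rw [add_sub_cancel_left, l1Norm_smul, abs_of_nonneg hr.1]
      exact mul_le_of_le_one_left (l1Norm_nonneg _) hr.2.le
  simpa using h2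

variable {X Y : Set (Fin d → ℝ)} {f : (Fin d → ℝ) → (Fin d → ℝ) → ℝ}
  {gx gy : (Fin d → ℝ) → (Fin d → ℝ) → (Fin d → ℝ)} {G L : ℝ}

lemma l1Norm_sub_self (x : Fin d → ℝ) : l1Norm (x - x) = 0 := by simp [l1Norm]

lemma IsSmoothGame.norm_gx_sub_le (hf : IsSmoothGame X Y f gx gy G L) {x x' y y' : Fin d → ℝ}
    (hx : x ∈ convexHull ℝ X) (hx' : x' ∈ convexHull ℝ X) (hy : y ∈ convexHull ℝ Y)
    (hy' : y' ∈ convexHull ℝ Y) :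
    ‖gx x y - gx x' y'‖ ≤ L * l1Norm (x - x') + L * l1Norm (y - y') :=
  (le_add_of_nonneg_right (norm_nonneg _)).trans (hf.smooth x hx x' hx' y hy y' hy')

lemma IsSmoothGame.norm_gy_sub_le (hf : IsSmoothGame X Y f gx gy G L) {x x' y y' : Fin d → ℝ}
    (hx : x ∈ convexHull ℝ X) (hx' : x' ∈ convexHull ℝ X) (hy : y ∈ convexHull ℝ Y)
    (hy' : y' ∈ convexHull ℝ Y) :
    ‖gy x y - gy x' y'‖ ≤ L * l1Norm (x - x') + L * l1Norm (y - y') :=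
  (le_add_of_nonneg_left (norm_nonneg _)).trans (hf.smooth x hx x' hx' y hy y' hy')

lemma IsSmoothGame.abs_mixed_difference_le (hf : IsSmoothGame X Y f gx gy G L)
    {x x' y y' : Fin d → ℝ} (hx : x ∈ X) (hx' : x' ∈ X) (hy : y ∈ Y) (hy' : y' ∈ Y) :
    |(f x y - f x y') - (f x' y - f x' y')| ≤ L * l1Norm (x - x') * l1Norm (y - y') := by
  have hX := subset_convexHull ℝ X
  have hY := subset_convexHull ℝ Y
  have hsub : ∀ a b : Fin d → ℝ, pairing a - pairing b = pairing (a - b) := by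
    intro a b
    ext v
    simp [pairing, sub_mul, Finset.sum_sub_distrib]
  have h := abs_sub_le_of_pairing (c := L * l1Norm (y - y')) (convex_convexHull ℝ X)
    (φ := fun u => f u y - f u y') (g := fun u => gx u y - gx u y') (fun u hu => by
      rw [← hsub]
      exact (hf.grad_x u hu y (hY hy)).sub (hf.grad_x u hu y' (hY hy'))) (hX hx) (hX hx')
    fun u hu _ => by
      have := hf.norm_gx_sub_le hu hu (hY hy) (hY hy')
      rwa [l1Norm_sub_self, mul_zero, zero_add] at this
  calc _ ≤ _ := h
    _ = _ := by ring

lemma IsSmoothGame.abs_sub_left_le (hf : IsSmoothGame X Y f gx gy G L) (hL : 0 ≤ L) {D : ℝ}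
    {x x' y : Fin d → ℝ} (hx : x ∈ X) (hx' : x' ∈ X) (hy : y ∈ Y) (hD : l1Norm (x - x') ≤ D)
    (hG : 0 ≤ G) : |f x y - f x' y| ≤ (G + L * D) * D := by
  have hX := subset_convexHull ℝ X
  have hY := subset_convexHull ℝ Y
  have hD0 := (l1Norm_nonneg _).trans hD
  refine (abs_sub_le_of_pairing (c := G + L * D) (convex_convexHull ℝ X)
    (fun u hu => hf.grad_x u hu y (hY hy)) (hX hx) (hX hx') fun u hu hux => ?_).trans
    (mul_le_mul_of_nonneg_left hD (by positivity))
  have h1 := hf.norm_gx_sub_le hu (hX hx') (hY hy) (hY hy)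
  have h2 := (le_max_left _ _).trans (hf.grad_bound x' hx' y hy)
  rw [l1Norm_sub_self, mul_zero, add_zero] at h1
  have h3 := norm_le_norm_add_norm_sub' (gx u y) (gx x' y)
  have h4 := mul_le_mul_of_nonneg_left (hux.trans hD) hL
  linarith

lemma IsSmoothGame.abs_sub_right_le (hf : IsSmoothGame X Y f gx gy G L) (hL : 0 ≤ L) {D : ℝ}
    {x y y' : Fin d → ℝ} (hx : x ∈ X) (hy : y ∈ Y) (hy' : y' ∈ Y) (hD : l1Norm (y - y') ≤ D)
    (hG : 0 ≤ G) : |f x y - f x y'| ≤ (G + L * D) * D := by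
  have hX := subset_convexHull ℝ X
  have hY := subset_convexHull ℝ Y
  have hD0 := (l1Norm_nonneg _).trans hD
  refine (abs_sub_le_of_pairing (c := G + L * D) (convex_convexHull ℝ Y)
    (fun u hu => hf.grad_y x (hX hx) u hu) (hY hy) (hY hy') fun u hu hux => ?_).trans
    (mul_le_mul_of_nonneg_left hD (by positivity))
  have h1 := hf.norm_gy_sub_le (hX hx) (hX hx) hu (hY hy')
  have h2 := (le_max_right _ _).trans (hf.grad_bound x hx y' hy')
  rw [l1Norm_sub_self, mul_zero, zero_add] at h1
  have h3 := norm_le_norm_add_norm_sub' (gy x u) (gy x y')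
  have h4 := mul_le_mul_of_nonneg_left (hux.trans hD) hL
  linarith

lemma IsSmoothGame.continuous (hf : IsSmoothGame X Y f gx gy G L) :
    Continuous fun p : X × Y => f p.1 p.2 := by
  obtain ⟨M, hM⟩ := hf.lipschitz
  refine continuous_iff_continuousAt.2 fun p => ?_
  refine tendsto_iff_dist_tendsto_zero.2 (squeeze_zero (fun _ => dist_nonneg)
    (g := fun q : X × Y => M * (l1Norm ((q.1 : Fin d → ℝ) - (p.1 : Fin d → ℝ)) +
      l1Norm ((q.2 : Fin d → ℝ) - (p.2 : Fin d → ℝ)))) (fun q => ?_) ?_)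
  · rw [Real.dist_eq]
    exact hM _ q.1.2 _ p.1.2 _ q.2.2 _ p.2.2
  · have hc : Continuous fun q : X × Y => M * (l1Norm ((q.1 : Fin d → ℝ) - (p.1 : Fin d → ℝ)) +
      l1Norm ((q.2 : Fin d → ℝ) - (p.2 : Fin d → ℝ))) :=
      continuous_const.mul ((continuous_l1Norm.comp
        ((continuous_subtype_val.comp continuous_fst).sub continuous_const)).add
        (continuous_l1Norm.comp
        ((continuous_subtype_val.comp continuous_snd).sub continuous_const)))
    have := hc.tendsto p
    simp only [l1Norm_sub_self, add_zero, mul_zero] at this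
    exact this

lemma IsSmoothGame.nonneg (hf : IsSmoothGame X Y f gx gy G L) (hX : X.Nonempty) (hY : Y.Nonempty) :
    0 ≤ G := by
  obtain ⟨x, hx⟩ := hX
  obtain ⟨y, hy⟩ := hY
  exact (norm_nonneg _).trans ((le_max_left _ _).trans (hf.grad_bound x hx y hy))

end

/-! ### The diameter -/

section

variable {d : ℕ} {X Y : Set (Fin d → ℝ)}

lemma l1Norm_sub_le_l1Diam (hX : IsCompact X) {x x' : Fin d → ℝ} (hx : x ∈ X) (hx' : x' ∈ X) :
    l1Norm (x - x') ≤ l1Diam X := by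
  refine le_csSup ?_ ⟨x, hx, x', hx', rfl⟩
  have h := (hX.prod hX).bddAbove_image (f := fun p : (Fin d → ℝ) × (Fin d → ℝ) =>
    l1Norm (p.1 - p.2)) (continuous_l1Norm.comp (continuous_fst.sub continuous_snd)).continuousOn
  refine h.mono ?_
  rintro r ⟨a, ha, b, hb, rfl⟩
  exact ⟨(a, b), ⟨ha, hb⟩, rfl⟩

lemma exists_l1Norm_pos (h : 0 < l1Diam X) : ∃ x ∈ X, ∃ x' ∈ X, 0 < l1Norm (x - x') := by
  by_contra! hc
  refine absurd h (not_lt.2 (Real.sSup_nonpos ?_))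
  rintro r ⟨a, ha, b, hb, rfl⟩
  exact hc a ha b hb

lemma pos_of_l1Norm_pos {v : Fin d → ℝ} (h : 0 < l1Norm v) : 0 < d := by
  rcases Nat.eq_zero_or_pos d with rfl | hd
  · simp [l1Norm] at h
  · exact hd

lemma pos_of_l1Diam_pos (h : 0 < max (l1Diam X) (l1Diam Y)) : 0 < d := by
  rcases lt_max_iff.1 h with h | h
  all_goals
    obtain ⟨a, -, b, -, hab⟩ := exists_l1Norm_pos h
    exact pos_of_l1Norm_pos hab

lemma IsSmoothGame.smoothness_nonneg {f : (Fin d → ℝ) → (Fin d → ℝ) → ℝ}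
    {gx gy : (Fin d → ℝ) → (Fin d → ℝ) → (Fin d → ℝ)} {G L : ℝ}
    (hf : IsSmoothGame X Y f gx gy G L) (hX : X.Nonempty) (hY : Y.Nonempty)
    (h : 0 < max (l1Diam X) (l1Diam Y)) : 0 ≤ L := by
  have hX' := subset_convexHull ℝ X
  have hY' := subset_convexHull ℝ Y
  rcases lt_max_iff.1 h with h | h
  · obtain ⟨a, ha, b, hb, hab⟩ := exists_l1Norm_pos h
    obtain ⟨y, hy⟩ := hY
    have h1 := (norm_nonneg _).trans
      (hf.norm_gx_sub_le (hX' ha) (hX' hb) (hY' hy) (hY' hy))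
    rw [l1Norm_sub_self, mul_zero, add_zero] at h1
    exact nonneg_of_mul_nonneg_left h1 hab
  · obtain ⟨a, ha, b, hb, hab⟩ := exists_l1Norm_pos h
    obtain ⟨x, hx⟩ := hX
    have h1 := (norm_nonneg _).trans
      (hf.norm_gx_sub_le (hX' hx) (hX' hx) (hY' ha) (hY' hb))
    rw [l1Norm_sub_self, mul_zero, zero_add] at h1
    exact nonneg_of_mul_nonneg_left h1 hab

end

/-! ### Empirical distributions and the losses of the game -/

lemma integral_mixture {E : Type*} [MeasurableSpace E] {n : ℕ} {P : Fin n → Measure E} {φ : E → ℝ}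
    (h : ∀ k, Integrable φ (P k)) : ∫ x, φ x ∂mixture P = (n : ℝ)⁻¹ * ∑ k, ∫ x, φ x ∂P k := by
  unfold mixture
  rw [integral_smul_measure, integral_finsetSum_measure fun k _ => h k]
  simp

lemma integrable_dirac_of_singleton {E : Type*} [MeasurableSpace E] [MeasurableSingletonClass E]
    (φ : E → ℝ) (x : E) : Integrable φ (Measure.dirac x) :=
  integrable_dirac (by simp)

lemma integral_empirical {E : Type*} [MeasurableSpace E] [MeasurableSingletonClass E] {m : ℕ}
    (x : Fin m → E) (φ : E → ℝ) : ∫ u, φ u ∂empirical x = (m : ℝ)⁻¹ * ∑ j, φ (x j) := by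
  unfold empirical
  rw [integral_mixture fun j => integrable_dirac_of_singleton φ (x j)]
  simp

lemma integrable_empirical {E : Type*} [MeasurableSpace E] [MeasurableSingletonClass E] {m : ℕ}
    (hm : 0 < m) (x : Fin m → E) (φ : E → ℝ) : Integrable φ (empirical x) := by
  unfold empirical mixture
  exact (integrable_finsetSum_measure.2 fun j _ =>
    integrable_dirac_of_singleton φ (x j)).smul_measure (by simp [hm.ne'])

section

variable {d : ℕ} {X Y : Set (Fin d → ℝ)} {f : (Fin d → ℝ) → (Fin d → ℝ) → ℝ}

/-- The loss of the first player. -/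
def lossX (hf : Continuous fun p : X × Y => f p.1 p.2) : C(Y, C(X, ℝ)) :=
  ContinuousMap.curry ⟨fun p => f p.2 p.1, hf.comp continuous_swap⟩

/-- The loss of the second player. -/
def lossY (hf : Continuous fun p : X × Y => f p.1 p.2) : C(X, C(Y, ℝ)) :=
  ContinuousMap.curry ⟨fun p => -f p.1 p.2, hf.neg⟩

lemma lossX_apply (hf : Continuous fun p : X × Y => f p.1 p.2) (y : Y) (x : X) :
    lossX hf y x = f x y := rfl

lemma lossY_apply (hf : Continuous fun p : X × Y => f p.1 p.2) (x : X) (y : Y) :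
    lossY hf x y = -f x y := rfl

lemma avg_lossX {m : ℕ} (hf : Continuous fun p : X × Y => f p.1 p.2) (ys : Fin m → Y) (u : X) :
    avg (lossX hf) ys u = evalRight f u (empirical fun j => (ys j : Fin d → ℝ)) := by
  rw [evalRight, integral_empirical]
  simp [avg, lossX_apply]

lemma avg_lossY {m : ℕ} (hf : Continuous fun p : X × Y => f p.1 p.2) (xs : Fin m → X) (v : Y) :
    avg (lossY hf) xs v = -evalLeft f (empirical fun j => (xs j : Fin d → ℝ)) v := by
  rw [evalLeft, integral_empirical]
  simp [avg, lossY_apply]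

lemma sum_Iio_eq {T : ℕ} (t : Fin T) (a : Fin T → ℝ) :
    ∑ s ∈ Finset.Iio t, a s = ∑ s : Fin T with s.val < t.val, a s := by
  refine Finset.sum_congr ?_ fun _ _ => rfl
  ext s
  simp

lemma cumLoss_lossX {T m : ℕ} (hf : Continuous fun p : X × Y => f p.1 p.2)
    (ys : Fin T → Fin m → Y) (t : Fin T) (u : X) : cumLoss (lossX hf) ys t u =
      ∑ s ∈ Finset.Iio t, evalRight f u (empirical fun j => (ys s j : Fin d → ℝ)) := by
  rw [sum_Iio_eq, cumLoss, ContinuousMap.sum_apply]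
  exact Finset.sum_congr rfl fun s _ => avg_lossX hf (ys s) u

lemma cumLoss_lossY {T m : ℕ} (hf : Continuous fun p : X × Y => f p.1 p.2)
    (xs : Fin T → Fin m → X) (t : Fin T) (v : Y) : cumLoss (lossY hf) xs t v =
      -∑ s ∈ Finset.Iio t, evalLeft f (empirical fun j => (xs s j : Fin d → ℝ)) v := by
  rw [sum_Iio_eq, cumLoss, ContinuousMap.sum_apply, ← Finset.sum_neg_distrib]
  exact Finset.sum_congr rfl fun s _ => avg_lossY hf (xs s) v

open Classical in
/-- A point of `ℝ^d` as a point of `X`, with an arbitrary value outside of `X`. -/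
noncomputable def toSubtype (X : Set (Fin d → ℝ)) [Nonempty X] (z : Fin d → ℝ) : X :=
  if h : z ∈ X then ⟨z, h⟩ else Classical.arbitrary X

lemma coe_toSubtype [Nonempty X] {z : Fin d → ℝ} (h : z ∈ X) :
    (toSubtype X z : Fin d → ℝ) = z := by
  simp [toSubtype, h]

variable {T m : ℕ} {Ω : Type*} [MeasurableSpace Ω] {μ : Measure Ω} {fr : FirstRound}
  {σ : Player → Phase → Fin T → Fin m → Fin d → Ω → ℝ}
  {z : Player → Phase → Fin T → Fin m → Ω → (Fin d → ℝ)}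

/-- The points computed by a player in one phase, as points of the player's set. -/
noncomputable def points (X : Set (Fin d → ℝ)) [Nonempty X]
    (z : Player → Phase → Fin T → Fin m → Ω → (Fin d → ℝ)) (p : Player) (h : Phase) (ω : Ω) :
    Fin T → Fin m → X :=
  fun t j => toSubtype X (z p h t j ω)

omit [MeasurableSpace Ω] in
lemma empirical_points [Nonempty X] {p : Player} {h : Phase} {ω : Ω}
    (hz : ∀ t j, z p h t j ω ∈ X) (t : Fin T) :
    (empirical fun j => (points X z p h ω t j : Fin d → ℝ)) = dist z p h t ω := by
  unfold points dist
  simp only [coe_toSubtype (hz t _)]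

/-- A run of the game, with the maximization of the second player turned into a minimization. -/
lemma IsRun.isOracleRun [Nonempty X] [Nonempty Y] (hr : IsRun μ X Y f fr σ z)
    (hf : Continuous fun p : X × Y => f p.1 p.2) :
    IsOracleRun μ (guessWeight fr) (lossX hf) (lossY hf)
      (fun k => σ k.1 k.2.1 k.2.2.1 k.2.2.2.1 k.2.2.2.2) .px .py
      (points X z .px .guess) (points X z .px .play)
      (points Y z .py .guess) (points Y z .py .play) := by
  have hx : ∀ h, ∀ᵐ ω ∂μ, ∀ t j, z .px h t j ω ∈ X := fun h =>
    ae_all_iff.2 fun t => ae_all_iff.2 fun j => hr.mem_x h t j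
  have hy : ∀ h, ∀ᵐ ω ∂μ, ∀ t j, z .py h t j ω ∈ Y := fun h =>
    ae_all_iff.2 fun t => ae_all_iff.2 fun j => hr.mem_y h t j
  refine ⟨fun t => ?_, fun t => ?_, fun t => ?_, fun t => ?_⟩
  · filter_upwards [hx .guess, hy .play, ae_all_iff.2 (hr.guess_x t)] with ω h1 h2 h3 j u
    have h4 := h3 j u.2
    simp only [Set.mem_ofPred_eq] at h4
    simp only [cumLoss_lossX, empirical_points h2]
    simpa only [points, coe_toSubtype (h1 t j), dotProduct, block] using h4
  · filter_upwards [hy .guess, hx .play, ae_all_iff.2 (hr.guess_y t)] with ω h1 h2 h3 j u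
    have h4 := h3 j u.2
    simp only [Set.mem_ofPred_eq] at h4
    simp only [cumLoss_lossY, empirical_points h2]
    simp only [points, coe_toSubtype (h1 t j), dotProduct, block]
    linarith
  · filter_upwards [hx .play, hy .play, hy .guess, ae_all_iff.2 (hr.play_x t)]
      with ω h1 h2 h3 h5 j u
    have h4 := h5 j u.2
    simp only [Set.mem_ofPred_eq] at h4
    simp only [ContinuousMap.add_apply, ContinuousMap.smul_apply, smul_eq_mul, cumLoss_lossX,
      avg_lossX, empirical_points h2, empirical_points h3]
    simpa only [points, coe_toSubtype (h1 t j), dotProduct, block] using h4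
  · filter_upwards [hy .play, hx .play, hx .guess, ae_all_iff.2 (hr.play_y t)]
      with ω h1 h2 h3 h5 j u
    have h4 := h5 j u.2
    simp only [Set.mem_ofPred_eq] at h4
    simp only [ContinuousMap.add_apply, ContinuousMap.smul_apply, smul_eq_mul, cumLoss_lossY,
      avg_lossY, empirical_points h2, empirical_points h3]
    simp only [points, coe_toSubtype (h1 t j), dotProduct, block]
    linarith

/-- The duality gap in terms of the total losses of the players. -/
lemma IsRun.ae_mul_gap_eq [Nonempty X] [Nonempty Y] (hr : IsRun μ X Y f fr σ z)
    (hf : Continuous fun p : X × Y => f p.1 p.2) (hm : 0 < m) (x : X) (y : Y) :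
    ∀ᵐ ω ∂μ, gap f z x y ω = -(T : ℝ)⁻¹ * (cumLoss (lossX hf) (points Y z .py .play ω) T x +
      cumLoss (lossY hf) (points X z .px .play ω) T y) := by
  have hx : ∀ᵐ ω ∂μ, ∀ t j, z .px .play t j ω ∈ X :=
    ae_all_iff.2 fun t => ae_all_iff.2 fun j => hr.mem_x .play t j
  have hy : ∀ᵐ ω ∂μ, ∀ t j, z .py .play t j ω ∈ Y :=
    ae_all_iff.2 fun t => ae_all_iff.2 fun j => hr.mem_y .play t j
  filter_upwards [hx, hy] with ω h1 h2
  rw [cumLoss_last, cumLoss_last, ContinuousMap.sum_apply, ContinuousMap.sum_apply]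
  simp only [avg_lossX, avg_lossY, empirical_points h1, empirical_points h2]
  unfold gap
  have e1 : evalLeft f (mixture fun t => dist z .px .play t ω) y =
      (T : ℝ)⁻¹ * ∑ t, evalLeft f (dist z .px .play t ω) y :=
    integral_mixture fun t => integrable_empirical hm _ _
  have e2 : evalRight f x (mixture fun t => dist z .py .play t ω) =
      (T : ℝ)⁻¹ * ∑ t, evalRight f x (dist z .py .play t ω) :=
    integral_mixture fun t => integrable_empirical hm _ _
  rw [e1, e2, Finset.sum_neg_distrib]
  ring

end

/-! ### The bound for the expected duality gap -/

section

variable {d T m : ℕ} {X Y : Set (Fin d → ℝ)} {η : ℝ} {Ω : Type*} [MeasurableSpace Ω]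
  {μ : Measure Ω}

/-- The total losses of two points are bounded from below by the potentials. -/
lemma IsPlay.le_integral_cumLoss_add [CompactSpace X] [CompactSpace Y] [Nonempty X] [Nonempty Y]
    [IsProbabilityMeasure μ] {w : Fin T → ℝ} {k : C(Y, C(X, ℝ))} {k' : C(X, C(Y, ℝ))}
    {σ : Player × Phase × Fin T × Fin m × Fin d → Ω → ℝ} {p p' : Player}
    {xs : Ω → Fin T → Fin m → X} {ys : Ω → Fin T → Fin m → Y}
    (hp : IsPlay μ w k k' σ p p' xs ys T) (hη : 0 < η) (hd : 0 < d)
    (hσ : ∀ i, HasLaw (σ i) (expMeasure η⁻¹) μ) (hind : iIndepFun σ μ)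
    (hm : ∀ i, Measurable (σ i)) (hne : p ≠ p') {D : ℝ} (hX : ∀ x x' : X, l1Dist x x' ≤ D)
    (hY : ∀ y y' : Y, l1Dist y y' ≤ D) {c : Fin T → ℝ}
    (hc : ∀ (t : Fin T) (F : C(X, ℝ)) (H : C(Y, ℝ)), -c t ≤
      ∫ q : (Fin m → Fin d → ℝ) × (Fin m → Fin d → ℝ), gain η k k' (w t) F H q.1 q.2
        ∂(blockLaw η d m).prod (blockLaw η d m) +
      ∫ q : (Fin m → Fin d → ℝ) × (Fin m → Fin d → ℝ), gain η k' k (w t) H F q.1 q.2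
        ∂(blockLaw η d m).prod (blockLaw η d m)) (x : X) (y : Y) :
    Integrable (fun ω => cumLoss k (ys ω) T x + cumLoss k' (xs ω) T y) μ ∧
      -(∑ t, c t + 2 * (D * (2 * η * (Real.log d + 1)))) ≤
        ∫ ω, (cumLoss k (ys ω) T x + cumLoss k' (xs ω) T y) ∂μ := by
  have h1 := hp.integrable_cumLoss hm x
  have h2 := hp.symm.integrable_cumLoss hm y
  have h3 := hp.neg_sum_le_integral_potential hη hσ hind hm hne hc
  have h4 := integral_mono (hp.integrable_potential hη hm le_rfl) (h1.add (integrable_const _))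
    fun ω => potential_le hη hd hX (cumLoss k (ys ω) T) x
  have h5 := integral_mono (hp.symm.integrable_potential hη hm le_rfl)
    (h2.add (integrable_const _)) fun ω => potential_le hη hd hY (cumLoss k' (xs ω) T) y
  rw [integral_add' h1 (integrable_const _)] at h4
  rw [integral_add' h2 (integrable_const _)] at h5
  simp only [integral_const, probReal_univ, one_smul] at h4 h5
  refine ⟨h1.add h2, ?_⟩
  rw [integral_add h1 h2]
  linarith

/-- The perturbations may be assumed to be measurable, and not only almost everywhere equal to
measurable functions. -/
lemma IsRun.exists_isPlay [CompactSpace X] [CompactSpace Y] [Nonempty X] [Nonempty Y]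
    [IsProbabilityMeasure μ] {f : (Fin d → ℝ) → (Fin d → ℝ) → ℝ} {fr : FirstRound}
    {σ : Player → Phase → Fin T → Fin m → Fin d → Ω → ℝ}
    {z : Player → Phase → Fin T → Fin m → Ω → (Fin d → ℝ)} (hr : IsRun μ X Y f fr σ z)
    (hf : Continuous fun p : X × Y => f p.1 p.2) (hη : 0 < η) (hσ : IsExpPerturbation μ η σ) :
    ∃ σ' : Player × Phase × Fin T × Fin m × Fin d → Ω → ℝ,
      (∀ i, HasLaw (σ' i) (expMeasure η⁻¹) μ) ∧ iIndepFun σ' μ ∧ (∀ i, Measurable (σ' i)) ∧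
      IsPlay μ (guessWeight fr) (lossX hf) (lossY hf) σ' .px .py
        (points X z .px .play) (points Y z .py .play) T := by
  have hae : ∀ i : Player × Phase × Fin T × Fin m × Fin d,
      AEMeasurable (σ i.1 i.2.1 i.2.2.1 i.2.2.2.1 i.2.2.2.2) μ := fun i =>
    (hσ.law _ _ _ _ _).aemeasurable
  have h1 : ∀ i, HasLaw ((hae i).mk _) (expMeasure η⁻¹) μ := fun i =>
    (hσ.law _ _ _ _ _).congr (hae i).ae_eq_mk.symm
  have h2 : iIndepFun (fun i => (hae i).mk _) μ := hσ.indep.congr fun i => (hae i).ae_eq_mk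
  exact ⟨fun i => (hae i).mk _, h1, h2, fun i => (hae i).measurable_mk,
    ((hr.isOracleRun hf).congr fun i => (hae i).ae_eq_mk).isPlay hη h1 h2
      (fun i => (hae i).measurable_mk) (by simp) le_rfl⟩

variable {f : (Fin d → ℝ) → (Fin d → ℝ) → ℝ} {gx gy : (Fin d → ℝ) → (Fin d → ℝ) → (Fin d → ℝ)}
  {D G L : ℝ}

/-- The duality gap for any perturbation size `η` that makes the perturbed minimizer stable. In
the case `fr = .plain` the first round costs `2 (G + L D) D`. -/
lemma IsRun.integral_gap_le [IsProbabilityMeasure μ] {fr : FirstRound}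
    {σ : Player → Phase → Fin T → Fin m → Fin d → Ω → ℝ}
    {z : Player → Phase → Fin T → Fin m → Ω → (Fin d → ℝ)} (hr : IsRun μ X Y f fr σ z)
    (hT : 0 < T) (hm : 0 < m) (hX : X.Nonempty) (hY : Y.Nonempty) (hXc : IsCompact X)
    (hYc : IsCompact Y) (hD : D = max (l1Diam X) (l1Diam Y)) (hD0 : 0 < D)
    (hf : IsSmoothGame X Y f gx gy G L) (hη : 0 < η) (hγ : stabilityConst d D η * L ≤ 2)
    (hσ : IsExpPerturbation μ η σ) {c : ℝ} (hc : 0 ≤ c)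
    (hfr : fr = .plain → 2 * ((G + L * D) * D) ≤ c)
    {x y : Fin d → ℝ} (hx : x ∈ X) (hy : y ∈ Y) :
    Integrable (gap f z x y) μ ∧
      ∫ ω, gap f z x y ω ∂μ ≤ (T : ℝ)⁻¹ * (T * (stabilityConst d D η * L ^ 2 * D ^ 2 / m) + c +
        2 * (D * (2 * η * (Real.log d + 1)))) := by
  have hd : 0 < d := pos_of_l1Diam_pos (hD ▸ hD0)
  have hL : 0 ≤ L := hf.smoothness_nonneg hX hY (hD ▸ hD0)
  have hG : 0 ≤ G := hf.nonneg hX hY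
  have := isCompact_iff_compactSpace.1 hXc
  have := isCompact_iff_compactSpace.1 hYc
  have := hX.to_subtype
  have := hY.to_subtype
  have hXd : ∀ x x' : X, l1Dist x x' ≤ D := fun x x' =>
    (l1Norm_sub_le_l1Diam hXc x.2 x'.2).trans (hD ▸ le_max_left _ _)
  have hYd : ∀ y y' : Y, l1Dist y y' ≤ D := fun y y' =>
    (l1Norm_sub_le_l1Diam hYc y.2 y'.2).trans (hD ▸ le_max_right _ _)
  have hfc := hf.continuous
  have hk : MixedLipschitz (lossX hfc) L := fun x x' y y' => by
    have h := hf.abs_mixed_difference_le x.2 x'.2 y.2 y'.2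
    simpa only [ContinuousMap.sub_apply, lossX_apply, l1Dist] using h
  have hk' : MixedLipschitz (lossY hfc) L := fun y y' x x' => by
    have h := hf.abs_mixed_difference_le x'.2 x.2 y.2 y'.2
    simp only [ContinuousMap.sub_apply, lossY_apply]
    calc _ = |(f x' y - f x' y') - (f x y - f x y')| := by congr 1; ring
      _ ≤ _ := h
      _ = L * l1Dist y y' * l1Dist x' x := by unfold l1Dist; ring
      _ = _ := by rw [l1Dist_comm x' x]
  have hB : ∀ y x x', |lossX hfc y x - lossX hfc y x'| ≤ (G + L * D) * D := fun y x x' =>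
    hf.abs_sub_left_le hL x.2 x'.2 y.2 (hXd x x') hG
  have hB' : ∀ x y y', |lossY hfc x y - lossY hfc x y'| ≤ (G + L * D) * D := fun x y y' => by
    have h := hf.abs_sub_right_le hL x.2 y'.2 y.2 (hYd y' y) hG
    simp only [lossY_apply]
    rwa [neg_sub_neg]
  have hkk : ∀ x y, lossY hfc x y = -lossX hfc y x := fun x y => rfl
  obtain ⟨σ', h1, h2, h3, hp⟩ := hr.exists_isPlay hfc hη hσ
  set N := stabilityConst d D η * L ^ 2 * D ^ 2 / m with hN
  have hN0 : 0 ≤ N := by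
    have := stabilityConst_pos hd hη hD0
    positivity
  have hcost : ∀ (t : Fin T) (F : C(X, ℝ)) (H : C(Y, ℝ)), -(N + if t.val = 0 then c else 0) ≤
      ∫ q : (Fin m → Fin d → ℝ) × (Fin m → Fin d → ℝ),
        gain η (lossX hfc) (lossY hfc) (guessWeight fr t) F H q.1 q.2
        ∂(blockLaw η d m).prod (blockLaw η d m) +
      ∫ q : (Fin m → Fin d → ℝ) × (Fin m → Fin d → ℝ),
        gain η (lossY hfc) (lossX hfc) (guessWeight fr t) H F q.1 q.2
        ∂(blockLaw η d m).prod (blockLaw η d m) := by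
    intro t F H
    have e1 := le_integral_gain_add hd hη hD0 hL hγ hXd hYd hk hk' hkk hm F H
    have e2 := le_gain_zero_add hη hB hB' hkk hm F H
    cases fr with
    | optimistic =>
      simp only [guessWeight]
      split_ifs <;> linarith
    | plain =>
      have e3 := hfr rfl
      simp only [guessWeight]
      split_ifs <;> linarith
  obtain ⟨hi, hle⟩ := hp.le_integral_cumLoss_add hη hd h1 h2 h3 (by simp) hXd hYd hcost
    ⟨x, hx⟩ ⟨y, hy⟩
  have hgap := hr.ae_mul_gap_eq hfc hm ⟨x, hx⟩ ⟨y, hy⟩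
  have hsum : ∑ t : Fin T, (N + if t.val = 0 then c else 0) = T * N + c := by
    rw [Finset.sum_add_distrib]
    have : ∑ t : Fin T, (if t.val = 0 then c else 0) = c := by
      rw [Finset.sum_eq_single (⟨0, hT⟩ : Fin T)]
      · simp
      · intro b _ hb
        rw [if_neg]
        exact fun h => hb (Fin.ext h)
      · simp
    simp [this]
  rw [hsum] at hle
  refine ⟨(hi.const_mul (-(T : ℝ)⁻¹)).congr (hgap.mono fun ω h => h.symm), ?_⟩
  rw [integral_congr_ae hgap, integral_const_mul, neg_mul, ← mul_neg]
  refine mul_le_mul_of_nonneg_left ?_ (by positivity)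
  linarith

end

lemma stabilityConst_eq {d : ℕ} (hd : 0 < d) {D L : ℝ} (hD : 0 < D) (hL : 0 ≤ L) :
    stabilityConst d D (10 * (d : ℝ) ^ 2 * D * (L + 1)) = 4 / (5 * (L + 1)) := by
  have : (0 : ℝ) < d := by exact_mod_cast hd
  unfold stabilityConst
  field_simp
  norm_num

lemma stabilityConst_mul_le {d : ℕ} (hd : 0 < d) {D L : ℝ} (hD : 0 < D) (hL : 0 ≤ L) :
    stabilityConst d D (10 * (d : ℝ) ^ 2 * D * (L + 1)) * L ≤ 1 := by
  rw [stabilityConst_eq hd hD hL, div_mul_eq_mul_div, div_le_one (by positivity)]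
  linarith

/-- The bound of `IsRun.integral_gap_le` for `η = 10 d² D (L + 1)` and `m = T`. -/
lemma total_le {d T : ℕ} (hd : 0 < d) (hT : 0 < T) {D L : ℝ} (hD : 0 < D) (hL : 0 ≤ L) (c : ℝ) :
    T * (stabilityConst d D (10 * (d : ℝ) ^ 2 * D * (L + 1)) * L ^ 2 * D ^ 2 / T) + c +
      2 * (D * (2 * (10 * (d : ℝ) ^ 2 * D * (L + 1)) * (Real.log d + 1))) + 2 * (L * D ^ 2) ≤
    100 * ((d : ℝ) ^ 2 * D ^ 2 * (L + 1) * max 1 (Real.log d)) + c := by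
  have hT' : (T : ℝ) ≠ 0 := by positivity
  have h1 := mul_le_mul_of_nonneg_right (stabilityConst_mul_le hd hD hL)
    (show 0 ≤ L * D ^ 2 by positivity)
  rw [mul_div_cancel₀ _ hT']
  have hd1 : (1 : ℝ) ≤ (d : ℝ) ^ 2 := one_le_pow₀ (by exact_mod_cast hd)
  have hm1 := le_max_left 1 (Real.log d)
  have hm2 := le_max_right 1 (Real.log d)
  set M := max 1 (Real.log d)
  have h2 : (d : ℝ) ^ 2 * D ^ 2 * (L + 1) * (Real.log d + 1) ≤
      (d : ℝ) ^ 2 * D ^ 2 * (L + 1) * (2 * M) :=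
    mul_le_mul_of_nonneg_left (by linarith) (by positivity)
  have h3 : L * D ^ 2 ≤ (d : ℝ) ^ 2 * D ^ 2 * (L + 1) * M := by
    calc L * D ^ 2 ≤ D ^ 2 * (L + 1) := by nlinarith [sq_nonneg D]
      _ = 1 * (D ^ 2 * (L + 1)) * 1 := by ring
      _ ≤ (d : ℝ) ^ 2 * (D ^ 2 * (L + 1)) * M := by gcongr
      _ = _ := by ring
  nlinarith

end OFTPL

theorem mainTheorem2 :
    ∃ K : ℝ, 0 < K ∧
      ∀ (d T : ℕ) (X Y : Set (Fin d → ℝ)) (f : (Fin d → ℝ) → (Fin d → ℝ) → ℝ)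
        (gx gy : (Fin d → ℝ) → (Fin d → ℝ) → (Fin d → ℝ)) (D G L η : ℝ),
        1 ≤ T → X.Nonempty → Y.Nonempty → IsCompact X → IsCompact Y →
        D = max (OFTPL.l1Diam X) (OFTPL.l1Diam Y) → 0 < D →
        OFTPL.IsSmoothGame X Y f gx gy G L →
        η = 10 * (d : ℝ) ^ 2 * D * (L + 1) →
        ∀ (Ω : Type*) [MeasurableSpace Ω] (μ : Measure Ω) [IsProbabilityMeasure μ]
          (σ : OFTPL.Player → OFTPL.Phase → Fin T → Fin T → Fin d → Ω → ℝ)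
          (z : OFTPL.Player → OFTPL.Phase → Fin T → Fin T → Ω → (Fin d → ℝ)),
          OFTPL.IsExpPerturbation μ η σ →
          (OFTPL.IsRun μ X Y f .optimistic σ z →
            ∀ x ∈ X, ∀ y ∈ Y,
              Integrable (OFTPL.gap f z x y) μ ∧
              ∫ ω, OFTPL.gap f z x y ω ∂μ ≤
                K * ((d : ℝ) ^ 2 * D ^ 2 * (L + 1) * max 1 (Real.log d) / T)
                + K * min (D ^ 2 * L) ((d : ℝ) ^ 2 * G ^ 2 * Real.log T / (L * T))) ∧
          (OFTPL.IsRun μ X Y f .plain σ z →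
            ∀ x ∈ X, ∀ y ∈ Y,
              Integrable (OFTPL.gap f z x y) μ ∧
              ∫ ω, OFTPL.gap f z x y ω ∂μ ≤
                K * ((d : ℝ) ^ 2 * D ^ 2 * (L + 1) * max 1 (Real.log d) / T)
                + K * min (D ^ 2 * L) ((d : ℝ) ^ 2 * G ^ 2 * Real.log T / (L * T))
                + K * (G * D / T)) := by
  refine ⟨100, by norm_num, ?_⟩
  intro d T X Y f gx gy D G L η hT hX hY hXc hYc hD hD0 hf hη Ω _ μ _ σ z hσ
  have hd : 0 < d := OFTPL.pos_of_l1Diam_pos (hD ▸ hD0)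
  have hL : 0 ≤ L := hf.smoothness_nonneg hX hY (hD ▸ hD0)
  have hG : 0 ≤ G := hf.nonneg hX hY
  have hd' : (0 : ℝ) < d := by exact_mod_cast hd
  have hT' : (0 : ℝ) < T := by exact_mod_cast hT
  have hη0 : 0 < η := by rw [hη]; positivity
  have hγ : OFTPL.stabilityConst d D η * L ≤ 2 := by
    rw [hη]
    linarith [OFTPL.stabilityConst_mul_le hd hD0 hL]
  -- the bound holds even without this term
  have hmin : 0 ≤ (100 : ℝ) *
      min (D ^ 2 * L) ((d : ℝ) ^ 2 * G ^ 2 * Real.log T / (L * T)) := by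
    have : 0 ≤ Real.log T := Real.log_natCast_nonneg T
    positivity
  constructor
  · intro hr x hx y hy
    obtain ⟨h1, h2⟩ := hr.integral_gap_le hT hT hX hY hXc hYc hD hD0 hf hη0 hγ hσ le_rfl
      (fun h => by cases h) hx hy
    refine ⟨h1, h2.trans ?_⟩
    have h3 := OFTPL.total_le hd hT hD0 hL 0
    rw [← hη] at h3
    have h4 : 0 ≤ L * D ^ 2 := by positivity
    rw [inv_mul_eq_div]
    refine (div_le_div_of_nonneg_right (b :=
      100 * ((d : ℝ) ^ 2 * D ^ 2 * (L + 1) * max 1 (Real.log d))) ?_ hT'.le).trans ?_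
    · linarith
    · rw [mul_div_assoc (100 : ℝ)]
      linarith
  · intro hr x hx y hy
    obtain ⟨h1, h2⟩ := hr.integral_gap_le hT hT hX hY hXc hYc hD hD0 hf hη0 hγ hσ
      (c := 2 * ((G + L * D) * D)) (by positivity) (fun _ => le_rfl) hx hy
    refine ⟨h1, h2.trans ?_⟩
    have h3 := OFTPL.total_le hd hT hD0 hL (2 * (G * D))
    rw [← hη] at h3
    have h4 : 0 ≤ G * D := by positivity
    rw [inv_mul_eq_div]
    refine (div_le_div_of_nonneg_right (b :=
      100 * ((d : ℝ) ^ 2 * D ^ 2 * (L + 1) * max 1 (Real.log d)) + 100 * (G * D)) ?_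
      hT'.le).trans ?_
    · linarith
    · rw [add_div, mul_div_assoc (100 : ℝ), mul_div_assoc (100 : ℝ)]
      linarith
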